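/- **Theorem 1.3 (theta lifting of Eisenstein series).** Let $N\ge 1$ be an integer. Write $\mathbb H$ for the upper half plane, $e(x)=e^{2\pi i x}$, $z=x+iy$, $\tau=u+iv\in\mathbb H$. *Lattice.* Let $V_{\mathbb R}$ be the space of real $2\times 2$ matrices of trace $0$ with $Q(w)=N\det w$ and $(w,w')=Q(w+w')-Q(w)-Q(w')$. Let $L=\left\{\begin{pmatrix} b&-a/N\\ c&-b\end{pmatrix}: a,b,c\in\mathbb Z\right\}$, with dual lattice $L^\sharp$, and identify $\mathbb Z/2N\cong L^\sharp/L$ by $r\mapsto\mu_r=\mathrm{diag}(\tfrac{r}{2N},-\tfrac{r}{2N})$. Let $\{e_\mu\}$ be the standard basis of $\mathbb C[L^\sharp/L]$. *Theta kernel.* Put $w(z)=\frac{1}{\sqrt N\,y}\begin{pmatrix}-x&z\bar z\\-1&x\end{pmatrix}$, $R(w,z)=\tfrac12(w,w(z))^2-(w,w)$, $\varphi^0(w,z)=\big((w,w(z))^2-\tfrac1{2\pi}\big)e^{-2\pi R(w,z)}\frac{dx\,dy}{y^2}$, and $$\Theta_L(\tau,z)=\sum_{\mu\in L^\sharp/L}\theta_\mu(\tau,z)e_\mu,\qquad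 \theta_\mu(\tau,z)=\sum_{w\in\mu+L}e(Q(w)\tau)\,\varphi^0(\sqrt v\,w,z).$$ For a function $f$ on $\Gamma_0(N)\backslash\mathbb H$ put $I(\tau,f)=\int_{\Gamma_0(N)\backslash\mathbb H}f(z)\,\Theta_L(\tau,z)=\sum_\mu I_\mu(\tau,f)e_\mu$. *Weight $0$.* Let $\Gamma_\infty=\{\pm\begin{pmatrix}1&n\\0&1\end{pmatrix}:n\in\mathbb Z\}$, $\zeta^{(N)}(s)=\zeta(s)\prod_{p\mid N}(1-p^{-s})$ and, for $\mathrm{Re}(s)>1$, $$\mathcal E(N,z,s)=N^{2s}\pi^{-s}\Gamma(s)\zeta^{(N)}(2s)\sum_{\gamma\in\Gamma_\infty\backslash\Gamma_0(N)}\mathrm{Im}(\gamma z)^s .$$ *Weight $3/2$.* Let $\Gamma'$ be the group of pairs $\gamma'=(\gamma,\phi)$ with $\gamma=\begin{pmatrix}a&b\\c&d\end{pmatrix}\in\mathrm{SL}_2(\mathbb Z)$ and $\phi$ holomorphic on $\mathbb H$ with $\phi(\tau)^2=c\tau+d$, and product $(\gamma_1,\phi_1)(\gamma_2,\phi_2)=(\gamma_1\gamma_2,\phi_1(\gamma_2\tau)\phi_2(\tau))$.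 Let $\Gamma'_\infty$ be the preimage in $\Gamma'$ of $\{\begin{pmatrix}1&n\\0&1\end{pmatrix}:n\in\mathbb Z\}$, so that $\Gamma'_\infty\backslash\Gamma'$ is the set of all coprime pairs $(c,d)\in\mathbb Z^2$. Let $\rho_L$ be the Weil representation of $\Gamma'$ on $\mathbb C[L^\sharp/L]$, i.e. the representation with $$\rho_L(T)e_\mu=e(Q(\mu))e_\mu,\qquad \rho_L(S)e_\mu=\frac{e(1/8)}{\sqrt{2N}}\sum_{\mu'\in L^\sharp/L}e(-(\mu,\mu'))e_{\mu'},$$ where $T=\big(\begin{pmatrix}1&1\\0&1\end{pmatrix},1\big)$ and $S=\big(\begin{pmatrix}0&-1\\1&0\end{pmatrix},\sqrt\tau\big)$ (principal branch). Put $(f|_{3/2}\gamma')(\tau)=\phi(\tau)^{-3}\rho_L(\gamma')^{-1}f(\gamma\tau)$ and, for $\mathrm{Re}(s)>3/2$, $$\mathcal E_L(\tau,s)=-\frac s4\,\pi^{-s-1}\Gamma(s)\zeta^{(N)}(2s)N^{\frac12+\frac32 s}\sum_{\gamma'\in\Gamma'_\infty\backslash\Gamma'}\big(v^{\frac{s-1}2}e_{\mu_0}\big)\big|_{3/2}\gamma'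 .$$ *Statement.* The representation $\rho_L$ exists. The three series above converge absolutely (the two Eisenstein series in the stated half planes). For fixed $z$ the function $\mathcal E(N,z,s)$ continues meromorphically to $s\in\mathbb C$, holomorphically on $\mathbb C\setminus\{0,1\}$. For fixed $\tau$ each component of $\mathcal E_L(\tau,s)$ continues meromorphically to $s\in\mathbb C$, holomorphically on $\mathrm{Re}(s)>1$. Denote the continuations by the same letters, let $w_N=\begin{pmatrix}0&-1\\N&0\end{pmatrix}$, so that $w_Nz=-1/(Nz)$, and let $\zeta^*(s)=\pi^{-s/2}\Gamma(s/2)\zeta(s)$, continued meromorphically. Then for all $\tau\in\mathbb H$ and $s\in\mathbb C\setminus\{0,1\}$ the integrals $I(\tau,\mathcal E(N,z,s))$ and $I(\tau,\mathcal E(N,w_Nz,s))$ converge absolutely, and, as meromorphic functions of $s$, $$I(\tau,\mathcal E(N,z,s))=I(\tau,\mathcal E(N,w_Nz,s))=\zeta^*(s)\,\mathcal E_L(\tau,s).$$ More precisely, the first equality holds for every $s\in\mathbb C\setminus\{0,1\}$, and the second holds in each component $\mu$ at every such $s$ that is not a pole of the $\mu$-component of $\mathcal E_L(\tau,s)$.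 -/

import Mathlib

open scoped UpperHalfPlane MatrixGroups Manifold
open MeasureTheory

noncomputable section

namespace KudlaMillson

/-! ## The quadratic space and the lattice -/

/-- The real quadratic space `V_ℝ` of trace zero matrices, as a subspace of all matrices. -/
def V : Submodule ℝ (Matrix (Fin 2) (Fin 2) ℝ) :=
  LinearMap.ker (Matrix.traceLinearMap (Fin 2) ℝ ℝ)

/-- The quadratic form `Q(w) = N det w`. -/
def Q (N : ℕ) (w : Matrix (Fin 2) (Fin 2) ℝ) : ℝ := N * w.det

/-- The bilinear form `(w, w') = Q(w + w') - Q(w) - Q(w')`, so that `(w, w) = 2 Q(w)`. -/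
def bil (N : ℕ) (w w' : Matrix (Fin 2) (Fin 2) ℝ) : ℝ := Q N (w + w') - Q N w - Q N w'

/-- The lattice `L` of the matrices `(b, -a/N; c, -b)` with `a, b, c ∈ ℤ`. -/
def lattice (N : ℕ) : AddSubgroup (Matrix (Fin 2) (Fin 2) ℝ) where
  carrier := {w | ∃ a b c : ℤ, w = !![(b : ℝ), -(a : ℝ) / N; (c : ℝ), -(b : ℝ)]}
  zero_mem' := ⟨0, 0, 0, by ext i j; fin_cases i <;> fin_cases j <;> simp⟩
  add_mem' := by
    rintro _ _ ⟨a, b, c, rfl⟩ ⟨a', b', c', rfl⟩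
    refine ⟨a + a', b + b', c + c', ?_⟩
    ext i j; fin_cases i <;> fin_cases j <;> simp <;> ring
  neg_mem' := by
    rintro _ ⟨a, b, c, rfl⟩
    refine ⟨-a, -b, -c, ?_⟩
    ext i j; fin_cases i <;> fin_cases j <;> simp [neg_div]

theorem bil_eq (N : ℕ) (w w' : Matrix (Fin 2) (Fin 2) ℝ) :
    bil N w w' = N * (w 0 0 * w' 1 1 + w' 0 0 * w 1 1 - w 0 1 * w' 1 0 - w' 0 1 * w 1 0) := by
  simp only [bil, Q, Matrix.det_fin_two, Matrix.add_apply]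
  ring

/-- The dual lattice `L♯`. -/
def dualLattice (N : ℕ) : AddSubgroup (Matrix (Fin 2) (Fin 2) ℝ) where
  carrier := {w | w ∈ V ∧ ∀ l ∈ lattice N, ∃ k : ℤ, bil N w l = k}
  zero_mem' := ⟨V.zero_mem, fun l _ => ⟨0, by simp [bil_eq]⟩⟩
  add_mem' := by
    rintro x y ⟨hx, hx'⟩ ⟨hy, hy'⟩
    refine ⟨V.add_mem hx hy, fun l hl => ?_⟩
    obtain ⟨k, hk⟩ := hx' l hl
    obtain ⟨m, hm⟩ := hy' l hl
    refine ⟨k + m, ?_⟩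
    push_cast
    rw [← hk, ← hm]
    simp only [bil_eq, Matrix.add_apply]
    ring
  neg_mem' := by
    rintro x ⟨hx, hx'⟩
    refine ⟨V.neg_mem hx, fun l hl => ?_⟩
    obtain ⟨k, hk⟩ := hx' l hl
    refine ⟨-k, ?_⟩
    push_cast
    rw [← hk]
    simp only [bil_eq, Matrix.neg_apply]
    ring

/-- The representative `μ_r = diag(r / 2N, -r / 2N)` of the class of `L♯ / L` attached to
`r ∈ ℤ / 2N`. -/
def mu (N : ℕ) (r : ZMod (2 * N)) : Matrix (Fin 2) (Fin 2) ℝ :=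
  !![(r.val : ℝ) / (2 * N), 0; 0, -((r.val : ℝ) / (2 * N))]

theorem mu_mem_dualLattice (N : ℕ) [NeZero N] (r : ZMod (2 * N)) : mu N r ∈ dualLattice N := by
  have hN : (N : ℝ) ≠ 0 := by exact_mod_cast NeZero.ne N
  refine ⟨by simp [V, mu, Matrix.trace_fin_two], ?_⟩
  rintro _ ⟨a, b, c, rfl⟩
  refine ⟨-(r.val : ℤ) * b, ?_⟩
  simp [bil_eq, mu]
  field_simp
  ring

/-- The identification `ℤ / 2N ≅ L♯ / L`, `r ↦ μ_r + L`. -/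
theorem mu_bijective (N : ℕ) [NeZero N] :
    Function.Bijective (fun r : ZMod (2 * N) =>
      (QuotientAddGroup.mk ⟨mu N r, mu_mem_dualLattice N r⟩ :
        dualLattice N ⧸ (lattice N).addSubgroupOf (dualLattice N))) := by
  have hN0 : N ≠ 0 := NeZero.ne N
  have hN : (N : ℝ) ≠ 0 := by exact_mod_cast hN0
  constructor
  · intro r r' h
    rw [QuotientAddGroup.eq] at h
    obtain ⟨a, b, c, h⟩ := h
    have h0 := congrFun (congrFun h 0) 0
    simp [mu, -ZMod.natCast_val] at h0
    field_simp at h0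
    have h1 : (r'.val : ℤ) = r.val + (2 * N : ℕ) * b := by
      have : (r'.val : ℝ) = r.val + (2 * N : ℕ) * b := by push_cast; linarith
      exact_mod_cast this
    have h2 := congrArg (fun k : ℤ => (k : ZMod (2 * N))) h1
    push_cast at h2
    simp only [ZMod.natCast_val, ZMod.cast_id', id_eq] at h2
    have h3 : (2 * (N : ZMod (2 * N))) = 0 := by
      have := ZMod.natCast_self (2 * N)
      push_cast at this
      exact this
    rw [h3] at h2
    simpa using h2.symm
  · intro q
    obtain ⟨⟨w, hw⟩, rfl⟩ := QuotientAddGroup.mk_surjective q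
    obtain ⟨hV, hd⟩ := id hw
    have htr : w 1 1 = -w 0 0 := by
      have : w 0 0 + w 1 1 = 0 := by simpa [V, Matrix.trace_fin_two] using hV
      linarith
    obtain ⟨k, hk⟩ := hd !![1, 0; 0, -1] ⟨0, 1, 0, by simp⟩
    obtain ⟨m, hm⟩ := hd !![0, 0; 1, 0] ⟨0, 0, 1, by simp⟩
    obtain ⟨n, hn⟩ := hd !![0, -1 / N; 0, 0] ⟨1, 0, 0, by simp⟩
    simp [bil_eq, htr] at hk hm hn
    field_simp at hn
    refine ⟨((-k : ℤ) : ZMod (2 * N)), ?_⟩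
    simp only
    rw [QuotientAddGroup.eq]
    have hv : ∃ j : ℤ, ((((-k : ℤ) : ZMod (2 * N)).val : ℕ) : ℤ) + (2 * N : ℕ) * j = -k := by
      rw [ZMod.val_intCast]
      exact ⟨(-k) / (2 * N : ℕ), Int.emod_add_mul_ediv _ _⟩
    obtain ⟨j, hj⟩ := hv
    have hj' : ((((-k : ℤ) : ZMod (2 * N)).val : ℕ) : ℝ) = -k - 2 * N * j := by
      have : ((((-k : ℤ) : ZMod (2 * N)).val : ℕ) : ℝ) + (2 * N : ℕ) * j = -k := by
        exact_mod_cast hj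
      push_cast at this
      push_cast
      linarith
    refine ⟨m, j, n, ?_⟩
    ext i i'
    fin_cases i <;> fin_cases i' <;> simp [mu, htr, -ZMod.natCast_val, -Int.cast_neg] <;>
      (try rw [hj']) <;> (try field_simp) <;> linarith

/-- The coset `L_μ = μ + L` for `μ = μ_r`. -/
def coset (N : ℕ) (r : ZMod (2 * N)) : Set (Matrix (Fin 2) (Fin 2) ℝ) :=
  {w | w - mu N r ∈ lattice N}

/-! ## The Kudla--Millson theta function -/

/-- The vector `w(z) = (1 / (√N y)) (-x, z z̄; -1, x)`. -/
def vec (N : ℕ) (z : ℍ) : Matrix (Fin 2) (Fin 2) ℝ :=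
  (1 / (Real.sqrt N * z.im)) • !![-z.re, Complex.normSq z; -1, z.re]

theorem Q_vec (N : ℕ) [NeZero N] (z : ℍ) : Q N (vec N z) = 1 := by
  have hN : (0 : ℝ) < N := by exact_mod_cast Nat.pos_of_ne_zero (NeZero.ne N)
  have hy : z.im ≠ 0 := z.im_ne_zero
  have hs : Real.sqrt N ≠ 0 := (Real.sqrt_pos.mpr hN).ne'
  have hs2 : Real.sqrt N ^ 2 = N := Real.sq_sqrt hN.le
  simp [Q, vec, Matrix.det_fin_two, Complex.normSq_apply]
  field_simp
  rw [hs2]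
  ring

/-- The orthogonal projection `w_z` of `w` to the positive line `ℝ w(z)`; note that
`(w(z), w(z)) = 2`. -/
def posPart (N : ℕ) (w : Matrix (Fin 2) (Fin 2) ℝ) (z : ℍ) : Matrix (Fin 2) (Fin 2) ℝ :=
  (bil N w (vec N z) / 2) • vec N z

/-- `R(w, z) = -(w_{z^⊥}, w_{z^⊥})` where `w = w_z + w_{z^⊥}`. -/
def R (N : ℕ) (w : Matrix (Fin 2) (Fin 2) ℝ) (z : ℍ) : ℝ :=
  -bil N (w - posPart N w z) (w - posPart N w z)

theorem R_eq (N : ℕ) [NeZero N] (w : Matrix (Fin 2) (Fin 2) ℝ) (z : ℍ) :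
    R N w z = bil N w (vec N z) ^ 2 / 2 - bil N w w := by
  have h : N * (vec N z 0 0 * vec N z 1 1 - vec N z 0 1 * vec N z 1 0) = 1 := by
    have := Q_vec N z
    rwa [Q, Matrix.det_fin_two] at this
  simp only [R, posPart]
  generalize hβ : bil N w (vec N z) = β
  rw [bil_eq] at hβ
  simp only [bil_eq, Matrix.sub_apply, Matrix.smul_apply, smul_eq_mul]
  linear_combination β * hβ - β ^ 2 / 2 * h

/-- The coefficient of `dx dy / y ^ 2` in the Kudla--Millson form `φ⁰(w, z)`. -/
def phi0 (N : ℕ) (w : Matrix (Fin 2) (Fin 2) ℝ) (z : ℍ) : ℝ :=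
  (bil N w (vec N z) ^ 2 - 1 / (2 * Real.pi)) * Real.exp (-2 * Real.pi * R N w z)

/-- `e(x) = exp(2 π i x)`. -/
def e (x : ℂ) : ℂ := Complex.exp (2 * Real.pi * Complex.I * x)

/-- The coefficient of `dx dy / y ^ 2` in `φ(w, τ, z) = e(Q(w) τ) φ⁰(√v w, z)`, `v = Im τ`. -/
def phi (N : ℕ) (w : Matrix (Fin 2) (Fin 2) ℝ) (τ z : ℍ) : ℂ :=
  e (Q N w * τ) * (phi0 N (Real.sqrt τ.im • w) z : ℂ)

/-- The coefficient of `dx dy / y ^ 2` in the component `θ_μ(τ, z)` of the Kudla--Millson theta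
function `Θ_L(τ, z) = ∑_μ θ_μ(τ, z) e_μ`. -/
def theta (N : ℕ) (τ z : ℍ) (r : ZMod (2 * N)) : ℂ :=
  ∑' w : coset N r, phi N (w : Matrix (Fin 2) (Fin 2) ℝ) τ z

/-- A fundamental domain for `Γ₀(N)` acting on the upper half plane: the union of the translates
`h 𝒟` of the standard fundamental domain of `SL₂(ℤ)`, for `h` running over representatives
of `Γ₀(N) \ SL₂(ℤ)` (the inverses of representatives of `SL₂(ℤ) / Γ₀(N)`). -/
def fundamentalDomain (N : ℕ) : Set ℍ :=
  ⋃ q : SL(2, ℤ) ⧸ CongruenceSubgroup.Gamma0 N,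
    (fun z : ℍ => (Quotient.out q)⁻¹ • z) '' ModularGroup.fd

/-- The component `I_μ(τ, f)` of the theta lift `I(τ, f) = ∫_{Γ₀(N) \ ℍ} f(z) Θ_L(τ, z)`.
The measure on `ℍ` is `dx dy / y ^ 2`. -/
def thetaLift (N : ℕ) (τ : ℍ) (f : ℍ → ℂ) (r : ZMod (2 * N)) : ℂ :=
  ∫ z in fundamentalDomain N, f z * theta N τ z r

/-- Absolute convergence of the integral `I_μ(τ, f)`. -/
def ThetaLiftConverges (N : ℕ) (τ : ℍ) (f : ℍ → ℂ) (r : ZMod (2 * N)) : Prop :=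
  IntegrableOn (fun z => f z * theta N τ z r) (fundamentalDomain N)

/-! ## The metaplectic group and the Weil representation -/

/-- The metaplectic cover `Γ'` of `SL₂(ℤ)`: pairs `(γ, φ)` with `φ` holomorphic on `ℍ` and
`φ(τ) ^ 2 = c τ + d`. -/
@[ext]
structure Mp2Z where
  mat : SL(2, ℤ)
  root : ℍ → ℂ
  holomorphic : MDifferentiable 𝓘(ℂ) 𝓘(ℂ) root
  sq : ∀ τ : ℍ, root τ ^ 2 = (mat 1 0 : ℂ) * τ + (mat 1 1 : ℂ)

namespace Mp2Z

theorem coe_smul (g : SL(2, ℤ)) (τ : ℍ) :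
    ((g • τ : ℍ) : ℂ) = ((g 0 0 : ℂ) * τ + (g 0 1 : ℂ)) / ((g 1 0 : ℂ) * τ + (g 1 1 : ℂ)) := by
  rw [UpperHalfPlane.coe_specialLinearGroup_apply]
  simp

theorem denom_ne_zero (g : SL(2, ℤ)) (τ : ℍ) : (g 1 0 : ℂ) * τ + (g 1 1 : ℂ) ≠ 0 := by
  have := UpperHalfPlane.denom_ne_zero (g : GL (Fin 2) ℝ) τ
  simpa [UpperHalfPlane.denom] using this

theorem denom_mul (g h : SL(2, ℤ)) (τ : ℍ) :
    ((g * h) 1 0 : ℂ) * τ + ((g * h) 1 1 : ℂ) =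
      ((g 1 0 : ℂ) * (h • τ : ℍ) + (g 1 1 : ℂ)) * ((h 1 0 : ℂ) * τ + (h 1 1 : ℂ)) := by
  have h0 := denom_ne_zero h τ
  rw [coe_smul, add_mul, mul_assoc, div_mul_cancel₀ _ h0]
  simp [Matrix.SpecialLinearGroup.coe_mul, Matrix.mul_apply, Fin.sum_univ_two]
  ring

theorem root_ne_zero (g : Mp2Z) (τ : ℍ) : g.root τ ≠ 0 := fun h =>
  denom_ne_zero g.mat τ (by rw [← g.sq, h]; simp)

theorem mdifferentiable_smul (g : SL(2, ℤ)) :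
    MDifferentiable 𝓘(ℂ) 𝓘(ℂ) (fun τ : ℍ => g • τ) :=
  UpperHalfPlane.mdifferentiable_smul (g := (g : GL (Fin 2) ℝ)) (by simp)

theorem ext_iff' {g h : Mp2Z} (h1 : g.mat = h.mat) (h2 : ∀ τ, g.root τ = h.root τ) : g = h :=
  Mp2Z.ext h1 (funext h2)

/-- The product `(g, φ) (h, ψ) = (g h, φ(h τ) ψ(τ))`. -/
instance : Mul Mp2Z where
  mul g h :=
    { mat := g.mat * h.mat
      root := fun τ => g.root (h.mat • τ) * h.root τ
      holomorphic := (g.holomorphic.comp (mdifferentiable_smul h.mat)).mul h.holomorphic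
      sq := fun τ => by rw [mul_pow, g.sq, h.sq, denom_mul] }

instance : One Mp2Z where
  one :=
    { mat := 1
      root := fun _ => 1
      holomorphic := mdifferentiable_const
      sq := fun τ => by simp }

instance : Inv Mp2Z where
  inv g :=
    { mat := g.mat⁻¹
      root := fun τ => (g.root (g.mat⁻¹ • τ))⁻¹
      holomorphic := by
        have h := g.holomorphic.comp (mdifferentiable_smul g.mat⁻¹)
        rw [UpperHalfPlane.mdifferentiable_iff] at h ⊢
        exact h.inv fun z _ => root_ne_zero g _
      sq := fun τ => by
        rw [inv_pow, g.sq]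
        have h := denom_mul g.mat g.mat⁻¹ τ
        rw [mul_inv_cancel] at h
        refine (eq_inv_of_mul_eq_one_right ?_).symm
        rw [← h]
        simp }

@[simp] theorem mul_mat (g h : Mp2Z) : (g * h).mat = g.mat * h.mat := rfl
@[simp] theorem mul_root (g h : Mp2Z) (τ : ℍ) :
    (g * h).root τ = g.root (h.mat • τ) * h.root τ := rfl
@[simp] theorem one_mat : (1 : Mp2Z).mat = 1 := rfl
@[simp] theorem one_root (τ : ℍ) : (1 : Mp2Z).root τ = 1 := rfl
@[simp] theorem inv_mat (g : Mp2Z) : (g⁻¹).mat = g.mat⁻¹ := rfl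
@[simp] theorem inv_root (g : Mp2Z) (τ : ℍ) : (g⁻¹).root τ = (g.root (g.mat⁻¹ • τ))⁻¹ := rfl

instance : Group Mp2Z where
  mul_assoc a b c := ext_iff' (by simp [mul_assoc]) fun τ => by simp [mul_assoc, mul_smul]
  one_mul a := ext_iff' (by simp) fun τ => by simp
  mul_one a := ext_iff' (by simp) fun τ => by simp
  inv_mul_cancel a := ext_iff' (by simp) fun τ => by simp [root_ne_zero]

/-- The projection `Γ' → SL₂(ℤ)`. -/
def proj : Mp2Z →* SL(2, ℤ) where
  toFun g := g.mat
  map_one' := rfl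
  map_mul' _ _ := rfl

/-- `T = ((1, 1; 0, 1), 1)`. -/
def T : Mp2Z where
  mat := ModularGroup.T
  root := fun _ => 1
  holomorphic := mdifferentiable_const
  sq := fun τ => by simp [ModularGroup.T]

/-- `S = ((0, -1; 1, 0), √τ)`, with the principal branch of the square root. -/
def S : Mp2Z where
  mat := ModularGroup.S
  root := fun τ => (τ : ℂ) ^ (1 / 2 : ℂ)
  holomorphic := by
    rw [UpperHalfPlane.mdifferentiable_iff]
    have h : DifferentiableOn ℂ (fun z : ℂ => z ^ (1 / 2 : ℂ)) {z | 0 < z.im} := fun z hz =>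
      (differentiableAt_id.cpow_const
        (Complex.mem_slitPlane_iff.mpr (Or.inr (ne_of_gt hz)))).differentiableWithinAt
    refine h.congr fun z hz => ?_
    simp [UpperHalfPlane.ofComplex_apply_of_im_pos hz]
  sq := fun τ => by
    rw [← Complex.cpow_nat_mul]
    simp [ModularGroup.S]

/-- `Γ'_∞`, the preimage in `Γ'` of the group of all `(1, n; 0, 1)`, `n ∈ ℤ`. The map
`(γ, φ) ↦ (c, d)` identifies `Γ'_∞ \ Γ'` with the set of all coprime pairs of integers. -/
def stabInfty : Subgroup Mp2Z := (Subgroup.zpowers ModularGroup.T).comap proj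

end Mp2Z

/-- The basis vector `e_μ` of `ℂ[L♯ / L]`, `μ = μ_r`. -/
def basisVec (N : ℕ) (r : ZMod (2 * N)) : ZMod (2 * N) → ℂ := Pi.single r 1

/-- The formulas on the generators `T`, `S` of `Γ'` which characterize the Weil representation
`ρ_L` of `Γ'` on `ℂ[L♯ / L]` (here `|L♯ / L| = 2N`). -/
def IsWeilRepresentation (N : ℕ) [NeZero N]
    (ρ : Mp2Z →* Module.End ℂ (ZMod (2 * N) → ℂ)) : Prop :=
  (∀ r, ρ Mp2Z.T (basisVec N r) = e (Q N (mu N r)) • basisVec N r) ∧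
  (∀ r, ρ Mp2Z.S (basisVec N r) = (e (1 / 8) / (Real.sqrt (2 * N) : ℂ)) •
    ∑ r' : ZMod (2 * N), e (-(bil N (mu N r) (mu N r') : ℂ)) • basisVec N r')

open Classical in
/-- The Weil representation `ρ_L`: the homomorphism with the prescribed values on `T` and `S`. -/
def weilRepresentation (N : ℕ) [NeZero N] : Mp2Z →* Module.End ℂ (ZMod (2 * N) → ℂ) :=
  if h : ∃ ρ, IsWeilRepresentation N ρ then h.choose else 1

/-- The Petersson slash operator `(f |_{3/2} γ')(τ) = φ(τ)⁻³ ρ_L(γ')⁻¹ f(γ τ)`. -/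
def slash (N : ℕ) [NeZero N] (f : ℍ → ZMod (2 * N) → ℂ) (g : Mp2Z) (τ : ℍ) :
    ZMod (2 * N) → ℂ :=
  (g.root τ ^ 3)⁻¹ • weilRepresentation N g⁻¹ (f (g.mat • τ))

/-! ## Eisenstein series -/

/-- `F` is the meromorphic continuation to `ℂ` of the restriction of `f` to `U`. (Normal form:
`F` is analytic at every point that is not a pole, and takes the value `0` at the poles.) -/
def IsMeromorphicContinuation (f : ℂ → ℂ) (U : Set ℂ) (F : ℂ → ℂ) : Prop :=
  MeromorphicNFOn F Set.univ ∧ Set.EqOn F f U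

open Classical in
/-- The meromorphic continuation to `ℂ` of the restriction of `f` to `U`. -/
def meromorphicContinuation (f : ℂ → ℂ) (U : Set ℂ) : ℂ → ℂ :=
  if h : ∃ F, IsMeromorphicContinuation f U F then h.choose else f

/-- The meromorphic continuation from a nonempty open set is unique. -/
theorem IsMeromorphicContinuation.unique {f : ℂ → ℂ} {U : Set ℂ} {F G : ℂ → ℂ}
    (hU : IsOpen U) (hne : U.Nonempty) (hF : IsMeromorphicContinuation f U F)
    (hG : IsMeromorphicContinuation f U G) : F = G := by
  obtain ⟨u, hu⟩ := hne
  have hm : MeromorphicOn (F - G) Set.univ :=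
    hF.1.meromorphicOn.sub hG.1.meromorphicOn
  have hu' : meromorphicOrderAt (F - G) u = ⊤ := by
    rw [meromorphicOrderAt_eq_top_iff]
    refine (Filter.Eventually.filter_mono nhdsWithin_le_nhds ?_)
    filter_upwards [hU.mem_nhds hu] with z hz
    simp [hF.2 hz, hG.2 hz]
  have hall : ∀ z, meromorphicOrderAt (F - G) z = ⊤ := by
    intro z
    by_contra hz
    have := (hm.exists_meromorphicOrderAt_ne_top_iff_forall
      ⟨Set.univ_nonempty, isPreconnected_univ⟩).mp ⟨⟨z, trivial⟩, hz⟩ ⟨u, trivial⟩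
    exact this hu'
  funext z
  have h1 : F =ᶠ[nhdsWithin z {z}ᶜ] G := by
    have := meromorphicOrderAt_eq_top_iff.mp (hall z)
    filter_upwards [this] with w hw
    exact sub_eq_zero.mp hw
  exact (((hF.1 (Set.mem_univ z)).eventuallyEq_nhdsNE_iff_eventuallyEq_nhds
    (hG.1 (Set.mem_univ z))).mp h1).eq_of_nhds

/-- `ζ^{(N)}(s) = ζ(s) ∏_{p ∣ N} (1 - p^{-s})`. -/
def zetaN (N : ℕ) (s : ℂ) : ℂ :=
  riemannZeta s * ∏ p ∈ N.primeFactors, (1 - (p : ℂ) ^ (-s))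

/-- `ζ*(s) = π^{-s/2} Γ(s/2) ζ(s)`, as a meromorphic function on `ℂ`. -/
def zetaStar (s : ℂ) : ℂ := completedRiemannZeta s

theorem zetaStar_eq {s : ℂ} (hs : 0 < s.re) :
    zetaStar s = (Real.pi : ℂ) ^ (-s / 2) * Complex.Gamma (s / 2) * riemannZeta s := by
  have h0 : s ≠ 0 := fun h => by simp [h] at hs
  have h1 : Complex.Gammaℝ s ≠ 0 := Complex.Gammaℝ_ne_zero_of_re_pos hs
  rw [riemannZeta_def_of_ne_zero h0, zetaStar, ← Complex.Gammaℝ_def]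
  field_simp

/-- The stabilizer `Γ_∞` of the cusp `∞` in `SL₂(ℤ)`, i.e. all `±(1, n; 0, 1)`. -/
def stabInfty : Subgroup SL(2, ℤ) where
  carrier := {g | g 1 0 = 0}
  one_mem' := by simp
  mul_mem' := by
    intro g h hg hh
    simp only [Set.mem_ofPred_eq] at hg hh ⊢
    simp [Matrix.SpecialLinearGroup.coe_mul, Matrix.mul_apply, Fin.sum_univ_two, hg, hh]
  inv_mem' := by
    intro g hg
    simp only [Set.mem_ofPred_eq] at hg ⊢
    simp [Matrix.SpecialLinearGroup.SL2_inv_expl, hg]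

/-- The set `Γ_∞ \ Γ₀(N)` of right cosets. -/
abbrev Cosets (N : ℕ) : Type :=
  Quotient (QuotientGroup.rightRel (stabInfty.subgroupOf (CongruenceSubgroup.Gamma0 N)))

/-- The set `Γ'_∞ \ Γ'` of right cosets. -/
abbrev MpCosets : Type := Quotient (QuotientGroup.rightRel Mp2Z.stabInfty)

/-- The term `Im(γ z)^s` of the Eisenstein series; it does not depend on the representative. -/
def eisensteinTerm (N : ℕ) (z : ℍ) (s : ℂ) (q : Cosets N) : ℂ :=
  ((((Quotient.out q : CongruenceSubgroup.Gamma0 N) : SL(2, ℤ)) • z : ℍ).im : ℂ) ^ s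

/-- The series `E(N, z, s) = ∑_{γ ∈ Γ_∞ \ Γ₀(N)} Im(γ z)^s`, for `Re s > 1`. -/
def eisensteinSeries (N : ℕ) (z : ℍ) (s : ℂ) : ℂ := ∑' q, eisensteinTerm N z s q

/-- The normalized series `N^{2s} π^{-s} Γ(s) ζ^{(N)}(2s) E(N, z, s)`, for `Re s > 1`. -/
def normalizedSeries (N : ℕ) (z : ℍ) (s : ℂ) : ℂ :=
  (N : ℂ) ^ (2 * s) * (Real.pi : ℂ) ^ (-s) * Complex.Gamma s * zetaN N (2 * s) *
    eisensteinSeries N z s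

/-- The normalized Eisenstein series `𝓔(N, z, s)` of weight `0`, for all `s`. -/
def calE (N : ℕ) (z : ℍ) : ℂ → ℂ :=
  meromorphicContinuation (normalizedSeries N z) {s | 1 < s.re}

/-- The term `(v^{(s-1)/2} e_{μ_0}) |_{3/2} γ'` of the vector valued Eisenstein series; it does
not depend on the representative. -/
def vectorTerm (N : ℕ) [NeZero N] (τ : ℍ) (s : ℂ) (q : MpCosets) : ZMod (2 * N) → ℂ :=
  slash N (fun τ' => ((τ'.im : ℂ) ^ ((s - 1) / 2)) • basisVec N 0) (Quotient.out q) τ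

/-- The series `E_L(τ, s) = ∑_{γ' ∈ Γ'_∞ \ Γ'} (v^{(s-1)/2} e_{μ_0}) |_{3/2} γ'`, for
`Re s > 3/2`. -/
def vectorSeries (N : ℕ) [NeZero N] (τ : ℍ) (s : ℂ) : ZMod (2 * N) → ℂ :=
  ∑' q, vectorTerm N τ s q

/-- The components of the normalized series
`-(s/4) π^{-s-1} Γ(s) ζ^{(N)}(2s) N^{1/2 + 3s/2} E_L(τ, s)`, for `Re s > 3/2`. -/
def normalizedVectorSeries (N : ℕ) [NeZero N] (τ : ℍ) (r : ZMod (2 * N)) (s : ℂ) : ℂ :=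
  -(s / 4) * (Real.pi : ℂ) ^ (-s - 1) * Complex.Gamma s * zetaN N (2 * s) *
    (N : ℂ) ^ (1 / 2 + 3 / 2 * s) * vectorSeries N τ s r

/-- The components of the normalized vector valued Eisenstein series `𝓔_L(τ, s)` of weight
`3/2`, for all `s`. -/
def calEL (N : ℕ) [NeZero N] (τ : ℍ) (r : ZMod (2 * N)) : ℂ → ℂ :=
  meromorphicContinuation (normalizedVectorSeries N τ r) {s | 3 / 2 < s.re}

/-- The Fricke matrix `w_N = (0, -1; N, 0)`, acting on `ℍ` by `z ↦ -1 / (N z)`. -/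
def fricke (N : ℕ) [NeZero N] : GL (Fin 2) ℝ :=
  Matrix.GeneralLinearGroup.mkOfDetNeZero !![0, -1; (N : ℝ), 0]
    (by simp [Matrix.det_fin_two, NeZero.ne N])

end KudlaMillson

end

open KudlaMillson

/-!
The proof is a Rankin--Selberg argument. For `Re s` large the theta lift of the Eisenstein series of
weight `0` unfolds to an integral over the strip `0 < x ≤ 1`, which is computed term by term and
gives the Eisenstein series of weight `3/2`. Everything else comes from continuation in `s`.

*The Weil representation.* The Jacobi theta functions `jacobiVec N r` are permuted linearly by the
weight `1/2`, index `N` action of the metaplectic group: this holds for `T` and `S` (`actsBy_T`,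
`actsBy_S`, the latter by Poisson summation), and `S`, `T` generate the group (`Mp2Z.closure_S_T`).
As the theta functions are linearly independent, the matrices of the action are multiplicative, and
their complex conjugates form the Weil representation. The generators also show that it is unique,
so that the chosen `weilRepresentation N` is this one, and its coefficients on `e_0` become
integrals of theta functions along a line through a lattice point (`integral_jacobiVec_denom`).

*The Eisenstein series of weight `0`.* Multiplied by `2 ζ^{(N)}(2s)` it is a sum over all pairs
`(m, n)` with `N ∣ m` and `n` prime to `N`, hence by Möbius inversion a combination of Epstein zeta
functions over the divisors of `N`. The Mellin transform of a binary theta series continues these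
(`hasSum_epstein`). The result is an entire part `eisEntire` minus a polar part `eisPolar` that does
not depend on `z` (`normalizedSeries_eq`); the entire part has moderate growth at every cusp.

*The theta kernel.* Poisson summation in the coordinate that is unipotent at the cusp replaces the
kernel by a sum over pairs `(c, n)` (`hasSum_phi_latMat`). The polynomial factor of `φ⁰` makes the
kernel a second derivative of a Gaussian, so the pair `(0, 0)` contributes nothing, and the kernel
decreases faster than every power of `y` at every cusp (`exists_norm_theta_le`). So the lift
converges for all `s ≠ 0, 1` and is the meromorphic function `liftMero`.

*Unfolding.* `setIntegral_eisensteinSeries_mul` leads to the integral of `y ^ s θ` over the strip.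
In the term of `(c, n)` the integral over `x` is that of a Jacobi theta function along the line
through `c τ + n`, i.e. a coefficient of the Weil representation, and the integral over `y` is a
Gamma factor. A nonzero pair `(c, n)` is a positive multiple of a coprime pair, and the sum over the
multipliers is `ζ(s)` (`integral_strip_theta`).

*Continuation.* The quotient of `liftMero` by `ζ*` is thus a meromorphic continuation of the
normalized series of weight `3/2`; the identity theorem covers the gap between the half plane
`Re s > 4`, where the unfolded sum is known to converge absolutely, and `Re s > 3/2`
(`lift_div_eqOn`). Since `ζ*` has no zero in `Re s > 1`, it is holomorphic there.

*The Fricke involution* preserves the theta kernel (`theta_fricke`) and the measure, and it maps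
fundamental domains of `Γ₀(N)` to fundamental domains, so both lifts agree (`setIntegral_fricke`).
-/

noncomputable section

namespace KudlaMillson

section

/-! ### Gaussian sums and Poisson summation -/

theorem hasSum_of_eq {ι E : Type*} [AddCommMonoid E] [TopologicalSpace E] {f g : ι → E} {a b : E}
    (h : HasSum f a) (hfg : ∀ i, g i = f i) (hab : b = a) : HasSum g b := by
  rw [hab, show g = f from funext hfg]
  exact h

theorem summable_exp_quadratic {A : ℝ} (hA : 0 < A) (B C : ℝ) :
    Summable fun n : ℤ => Real.exp (-A * n ^ 2 + B * |(n : ℝ)| + C) := by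
  have h := (summable_pow_mul_jacobiTheta₂_term_bound (B / (2 * Real.pi))
    (div_pos hA Real.pi_pos) 0).mul_right (Real.exp C)
  refine h.congr fun n => ?_
  rw [pow_zero, one_mul, ← Real.exp_add]
  congr 1
  have := Real.pi_ne_zero
  push_cast
  field_simp
  ring

/-- A quadratic exponential whose leading coefficient has negative real part is dominated by a
summable sequence, uniformly in bounded lower coefficients. -/
theorem norm_exp_quadratic_le {α β γ : ℂ} {A B C : ℝ} (hα : α.re ≤ -A) (hβ : ‖β‖ ≤ B)
    (hγ : ‖γ‖ ≤ C) (n : ℤ) :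
    ‖Complex.exp (α * n ^ 2 + β * n + γ)‖ ≤ Real.exp (-A * n ^ 2 + B * |(n : ℝ)| + C) := by
  rw [Complex.norm_exp, Real.exp_le_exp, Complex.add_re, Complex.add_re]
  have h1 : (α * (n : ℂ) ^ 2).re = α.re * n ^ 2 := by
    have : ((n : ℂ) ^ 2) = (((n : ℝ) ^ 2 : ℝ) : ℂ) := by push_cast; rfl
    rw [this, Complex.re_mul_ofReal]
  have h2 : (β * (n : ℂ)).re ≤ B * |(n : ℝ)| := by
    refine (Complex.re_le_norm _).trans ?_
    rw [norm_mul, Complex.norm_intCast]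
    gcongr
  have h3 : γ.re ≤ C := (Complex.re_le_norm _).trans hγ
  rw [h1]
  have : α.re * (n : ℝ) ^ 2 ≤ -A * n ^ 2 := by gcongr
  linarith

/-- A locally uniformly dominated series of entire functions may be differentiated twice term by
term. -/
theorem hasSum_deriv_deriv {ι : Type*} {F : ι → ℂ → ℂ} (hF : ∀ i, Differentiable ℂ (F i))
    (hb : ∀ R : ℝ, ∃ u : ι → ℝ, Summable u ∧ ∀ i w, ‖w‖ < R → ‖F i w‖ ≤ u i) (z : ℂ) :
    HasSum (fun i => deriv (deriv (F i)) z) (deriv (deriv fun w => ∑' i, F i w) z) := by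
  obtain ⟨u, hu, hu'⟩ := hb (‖z‖ + 1)
  set U : Set ℂ := Metric.ball 0 (‖z‖ + 1) with hU
  have hopen : IsOpen U := Metric.isOpen_ball
  have h0 : TendstoLocallyUniformlyOn (fun (t : Finset ι) x => ∑ n ∈ t, F n x)
      (fun x => ∑' n, F n x) Filter.atTop U :=
    (tendstoUniformlyOn_tsum hu fun n x hx =>
      hu' n x (by simpa [hU] using hx)).tendstoLocallyUniformlyOn
  have hd : ∀ t : Finset ι, Differentiable ℂ fun x => ∑ n ∈ t, F n x := fun t =>
    Differentiable.fun_sum fun i _ => hF i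
  have h1 := h0.deriv (Filter.Eventually.of_forall fun t => (hd t).differentiableOn) hopen
  have h2 := h1.deriv (Filter.Eventually.of_forall fun t =>
    ((hd t).differentiableOn (s := U)).deriv hopen) hopen
  have h3 := h2.tendsto_at (show z ∈ U by simp [hU])
  refine h3.congr fun t => ?_
  have e1 : deriv (fun x => ∑ n ∈ t, F n x) = fun x => ∑ n ∈ t, deriv (F n) x := by
    funext x
    exact deriv_fun_sum fun i _ => (hF i) x
  simp only [Function.comp_apply]
  rw [e1]
  exact deriv_fun_sum fun i _ => ((hF i).contDiff (n := 2)).differentiable_deriv_two z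

/-- Poisson summation for shifted Gaussians. -/
theorem tsum_gaussian_shift {a : ℂ} (ha : 0 < a.re) (b t : ℂ) :
    ∑' n : ℤ, Complex.exp (-Real.pi * a * (n + t) ^ 2 + 2 * Real.pi * b * (n + t)) =
      1 / a ^ (1 / 2 : ℂ) * ∑' n : ℤ, Complex.exp (2 * Real.pi * Complex.I * n * t +
        -Real.pi / a * (n + Complex.I * b) ^ 2) := by
  have ha0 : a ≠ 0 := fun h => by simp [h] at ha
  have h := Complex.tsum_exp_neg_quadratic ha (b - a * t)
  have h1 : ∀ n : ℤ, Complex.exp (-Real.pi * a * (n + t) ^ 2 + 2 * Real.pi * b * (n + t)) =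
      Complex.exp (-Real.pi * a * t ^ 2 + 2 * Real.pi * b * t) *
        Complex.exp (-Real.pi * a * n ^ 2 + 2 * Real.pi * (b - a * t) * n) := by
    intro n
    rw [← Complex.exp_add]
    congr 1
    ring
  simp_rw [h1]
  rw [tsum_mul_left, h, mul_left_comm, ← tsum_mul_left]
  congr 2
  funext n
  rw [← Complex.exp_add]
  congr 1
  have hI := Complex.I_sq
  field_simp
  linear_combination (-(b - a * t) ^ 2 + b ^ 2) * hI

theorem re_neg_pi_div_neg {a : ℂ} (ha : 0 < a.re) : (-(Real.pi : ℂ) / a).re < 0 := by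
  have ha0 : a ≠ 0 := fun h => by simp [h] at ha
  have : (-(Real.pi : ℂ) / a).re = -(Real.pi * (a⁻¹).re) := by
    rw [div_eq_mul_inv, neg_mul, Complex.neg_re, Complex.re_ofReal_mul]
  rw [this, Complex.inv_re]
  have := Complex.normSq_pos.mpr ha0
  have := Real.pi_pos
  have : 0 < Real.pi * (a.re / Complex.normSq a) := by positivity
  linarith

theorem deriv_deriv_exp_quadratic (p q r x : ℂ) :
    deriv (deriv fun w => Complex.exp (p * w ^ 2 + q * w + r)) x =
      ((2 * p * x + q) ^ 2 + 2 * p) * Complex.exp (p * x ^ 2 + q * x + r) := by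
  have h1 : ∀ w, HasDerivAt (fun w => Complex.exp (p * w ^ 2 + q * w + r))
      (Complex.exp (p * w ^ 2 + q * w + r) * (2 * p * w + q)) w := fun w => by
    have := ((((hasDerivAt_id w).pow 2).const_mul p).add
      ((hasDerivAt_id w).const_mul q)).add_const r
    refine (this.cexp).congr_deriv ?_
    simp
    ring
  have h2 : deriv (fun w => Complex.exp (p * w ^ 2 + q * w + r)) =
      fun w => Complex.exp (p * w ^ 2 + q * w + r) * (2 * p * w + q) :=
    funext fun w => (h1 w).deriv
  rw [h2]
  have h3 := (h1 x).mul (((hasDerivAt_id x).const_mul (2 * p)).add_const q)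
  have h4 := h3.deriv
  simp only [id] at h4
  refine Eq.trans ?_ (h4.trans ?_)
  · rfl
  · ring

/-- Poisson summation for the function `(x² - 1 / 2πa) exp(-π a x²)`, with a character. The
function is a multiple of the second derivative of a Gaussian, so that the frequency zero
contributes `(i b)²` only. -/
theorem hasSum_gaussian_shift_sq {a : ℂ} (ha : 0 < a.re) (b t : ℂ) :
    Summable (fun n : ℤ => (n + Complex.I * b) ^ 2 * Complex.exp (2 * Real.pi * Complex.I * n * t +
        -Real.pi / a * (n + Complex.I * b) ^ 2)) ∧
    HasSum (fun n : ℤ => ((n + t) ^ 2 - 1 / (2 * Real.pi * a)) *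
        Complex.exp (-Real.pi * a * (n + t) ^ 2 + 2 * Real.pi * b * (n + t)))
      (-(1 / a ^ (1 / 2 : ℂ)) / a ^ 2 * ∑' n : ℤ, (n + Complex.I * b) ^ 2 *
        Complex.exp (2 * Real.pi * Complex.I * n * t +
        -Real.pi / a * (n + Complex.I * b) ^ 2)) := by
  have ha0 : a ≠ 0 := fun h => by simp [h] at ha
  have hpi : (Real.pi : ℂ) ≠ 0 := by exact_mod_cast Real.pi_ne_zero
  have hI := Complex.I_sq
  -- both sides as functions of `b`
  set F : ℤ → ℂ → ℂ := fun n w =>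
    Complex.exp (-Real.pi * a * (n + t) ^ 2 + 2 * Real.pi * w * (n + t)) with hF
  set G : ℤ → ℂ → ℂ := fun n w => Complex.exp (2 * Real.pi * Complex.I * n * t +
    -Real.pi / a * (n + Complex.I * w) ^ 2) with hG
  have hFd : ∀ n, Differentiable ℂ (F n) := fun n => by simp only [hF]; fun_prop
  have hGd : ∀ n, Differentiable ℂ (G n) := fun n => by simp only [hG]; fun_prop
  have hFb : ∀ R : ℝ, ∃ u : ℤ → ℝ, Summable u ∧ ∀ i w, ‖w‖ < R → ‖F i w‖ ≤ u i := by
    intro R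
    refine ⟨_, summable_exp_quadratic (A := Real.pi * a.re) (mul_pos Real.pi_pos ha)
      (2 * Real.pi * ‖a‖ * ‖t‖ + 2 * Real.pi * R)
      (Real.pi * ‖a‖ * ‖t‖ ^ 2 + 2 * Real.pi * R * ‖t‖), fun n w hw => ?_⟩
    have e1 : F n w = Complex.exp ((-Real.pi * a) * n ^ 2 +
        (-2 * Real.pi * a * t + 2 * Real.pi * w) * n +
        (-Real.pi * a * t ^ 2 + 2 * Real.pi * w * t)) := by
      simp only [hF]; congr 1; ring
    rw [e1]
    refine norm_exp_quadratic_le (by simp) ?_ ?_ n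
    · refine (norm_add_le _ _).trans ?_
      simp only [norm_mul, norm_neg, Complex.norm_real, Real.norm_eq_abs, abs_of_pos Real.pi_pos,
        Complex.norm_ofNat]
      gcongr
    · refine (norm_add_le _ _).trans ?_
      simp only [norm_mul, norm_neg, Complex.norm_real, Real.norm_eq_abs, abs_of_pos Real.pi_pos,
        Complex.norm_ofNat, norm_pow]
      gcongr
  have hGb : ∀ R : ℝ, ∃ u : ℤ → ℝ, Summable u ∧ ∀ i w, ‖w‖ < R → ‖G i w‖ ≤ u i := by
    intro R
    refine ⟨_, summable_exp_quadratic (A := -(-(Real.pi : ℂ) / a).re)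
      (neg_pos.mpr (re_neg_pi_div_neg ha))
      (2 * Real.pi * ‖t‖ + 2 * Real.pi / ‖a‖ * R) (Real.pi / ‖a‖ * R ^ 2), fun n w hw => ?_⟩
    have e1 : G n w = Complex.exp ((-Real.pi / a) * n ^ 2 +
        (2 * Real.pi * Complex.I * t + -(2 * Real.pi / a * w * Complex.I)) * n +
        (Real.pi / a * w ^ 2)) := by
      simp only [hG]; congr 1
      linear_combination (-Real.pi / a * w ^ 2) * hI
    rw [e1]
    refine norm_exp_quadratic_le (by simp) ?_ ?_ n
    · refine (norm_add_le _ _).trans ?_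
      simp only [norm_mul, norm_neg, norm_div, Complex.norm_real, Real.norm_eq_abs,
        abs_of_pos Real.pi_pos, Complex.norm_ofNat, Complex.norm_I, mul_one]
      gcongr
    · simp only [norm_mul, norm_div, Complex.norm_real, Real.norm_eq_abs,
        abs_of_pos Real.pi_pos, norm_pow]
      gcongr
  have hFG : (fun w => ∑' n, F n w) = fun w => 1 / a ^ (1 / 2 : ℂ) * ∑' n, G n w :=
    funext fun w => tsum_gaussian_shift ha w t
  have hFs := hasSum_deriv_deriv hFd hFb b
  have hGs := hasSum_deriv_deriv hGd hGb b
  have hFG' : deriv (deriv fun w => ∑' n, F n w) b =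
      1 / a ^ (1 / 2 : ℂ) * deriv (deriv fun w => ∑' n, G n w) b := by
    rw [hFG]
    have : deriv (fun w => 1 / a ^ (1 / 2 : ℂ) * ∑' n, G n w) =
        fun w => 1 / a ^ (1 / 2 : ℂ) * deriv (fun w => ∑' n, G n w) w := by
      funext w
      exact deriv_const_mul_field _
    rw [this]
    exact deriv_const_mul_field _
  have eF : ∀ n : ℤ, deriv (deriv (F n)) b = (2 * Real.pi * (n + t)) ^ 2 * F n b := by
    intro n
    have : F n = fun w => Complex.exp (0 * w ^ 2 + (2 * Real.pi * (n + t)) * w +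
        -Real.pi * a * (n + t) ^ 2) := by
      funext w; simp only [hF]; congr 1; ring
    rw [this, deriv_deriv_exp_quadratic]
    ring
  have eG : ∀ n : ℤ, deriv (deriv (G n)) b =
      (2 * Real.pi / a - (2 * Real.pi / a) ^ 2 * (n + Complex.I * b) ^ 2) * G n b := by
    intro n
    have : G n = fun w => Complex.exp (Real.pi / a * w ^ 2 +
        (-2 * Real.pi * Complex.I / a * n) * w +
        (2 * Real.pi * Complex.I * n * t + -Real.pi / a * n ^ 2)) := by
      funext w; simp only [hG]; congr 1
      linear_combination (-Real.pi / a * w ^ 2) * hI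
    rw [this, deriv_deriv_exp_quadratic]
    congr 1
    linear_combination ((2 * Real.pi / a) ^ 2 * (n ^ 2 + b ^ 2)) * hI
  simp_rw [eF] at hFs
  simp_rw [eG] at hGs
  rw [hFG'] at hFs
  -- solve the two differentiated series for the sums with the factors `(n + t)²`, `(n + i b)²`
  have sF : Summable fun n => F n b := by
    obtain ⟨u, hu, hu'⟩ := hFb (‖b‖ + 1)
    exact Summable.of_norm_bounded hu fun n => hu' n b (by linarith)
  have sG : Summable fun n => G n b := by
    obtain ⟨u, hu, hu'⟩ := hGb (‖b‖ + 1)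
    exact Summable.of_norm_bounded hu fun n => hu' n b (by linarith)
  have hc : (2 * Real.pi / a : ℂ) ≠ 0 := by
    refine div_ne_zero (mul_ne_zero two_ne_zero hpi) ha0
  have hG2 : HasSum (fun n : ℤ => (n + Complex.I * b) ^ 2 * G n b)
      (((2 * Real.pi / a : ℂ) ^ 2)⁻¹ * (2 * Real.pi / a * (∑' n, G n b) -
        deriv (deriv fun w => ∑' n, G n w) b)) := by
    refine hasSum_of_eq (((sG.hasSum.mul_left (2 * Real.pi / a : ℂ)).sub hGs).mul_left
      (((2 * Real.pi / a : ℂ) ^ 2)⁻¹)) (fun n => ?_) rfl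
    rw [eq_inv_mul_iff_mul_eq₀ (pow_ne_zero 2 hc)]
    ring
  refine ⟨hG2.summable, ?_⟩
  have hF2 := (hFs.mul_left (((2 * Real.pi : ℂ) ^ 2)⁻¹)).sub
    (sF.hasSum.mul_left (1 / (2 * Real.pi * a)))
  have e := hG2.tsum_eq
  have e' := congrFun hFG b
  refine hasSum_of_eq hF2 (fun n => ?_) ?_
  · change _ * F n b = _
    field_simp
  · change _ * ∑' n : ℤ, (n + Complex.I * b) ^ 2 * G n b = _
    rw [e, e']
    field_simp
    ring

/-- Shifted Gaussian sums are bounded uniformly in the shift. -/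
theorem exists_tsum_gaussian_le {A : ℝ} (hA : 0 < A) :
    ∃ C : ℝ, 0 < C ∧ ∀ t : ℝ, Summable (fun l : ℤ => Real.exp (-A * (l + t) ^ 2)) ∧
      ∑' l : ℤ, Real.exp (-A * (l + t) ^ 2) ≤ C := by
  have hs : Summable fun l : ℤ => Real.exp (-(A / 4) * (l : ℝ) ^ 2) := by
    simpa using summable_exp_quadratic (A := A / 4) (by positivity) 0 0
  refine ⟨∑' l : ℤ, Real.exp (-(A / 4) * (l : ℝ) ^ 2), ?_, fun t => ?_⟩
  · exact hs.tsum_pos (fun _ => (Real.exp_pos _).le) 0 (Real.exp_pos _)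
  -- translate the shift into `[-1/2, 1/2]`, where `|l + t| ≥ |l| / 2`
  set m : ℤ := round t
  set u : ℝ := t - m with hu
  have hu1 : |u| ≤ 1 / 2 := abs_sub_round t
  have key : ∀ l : ℤ, Real.exp (-A * (l + u) ^ 2) ≤ Real.exp (-(A / 4) * (l : ℝ) ^ 2) := by
    intro l
    rw [Real.exp_le_exp]
    have : (l : ℝ) ^ 2 ≤ 4 * (l + u) ^ 2 := by
      rcases eq_or_ne l 0 with rfl | hl
      · simp; positivity
      · have h1 : (1 : ℝ) ≤ |(l : ℝ)| := by
          exact_mod_cast Int.one_le_abs hl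
        have h2 : |(l : ℝ)| ≤ |2 * (l + u)| := by
          have h3 : |(l : ℝ)| ≤ |(l : ℝ) + u| + |u| := by
            have := abs_sub (l + u : ℝ) u
            simpa using this
          rw [abs_mul, abs_two]
          linarith
        have := sq_le_sq.mpr h2
        linarith [this]
    nlinarith
  have hsu : Summable fun l : ℤ => Real.exp (-A * (l + u) ^ 2) :=
    Summable.of_nonneg_of_le (fun _ => (Real.exp_pos _).le) key hs
  have e : (fun l : ℤ => Real.exp (-A * (l + t) ^ 2)) =
      (fun l : ℤ => Real.exp (-A * (l + u) ^ 2)) ∘ (Equiv.addRight m) := by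
    funext l
    simp [hu]
  rw [e]
  refine ⟨(Equiv.addRight m).summable_iff.mpr hsu, ?_⟩
  have := (Equiv.addRight m).tsum_eq (fun l : ℤ => Real.exp (-A * (l + u) ^ 2))
  refine (le_of_eq this).trans (hsu.tsum_le_tsum key hs)

/-- A double series is summable if its rows are dominated by summable multiples of series with
bounded sums. -/
theorem summable_prod_of_bounded {ι κ : Type*} {F : ι × κ → ℝ} {u : ι → ℝ} {w : ι → κ → ℝ}
    {C : ℝ} (hu : Summable u) (hu0 : ∀ i, 0 ≤ u i) (hF0 : ∀ p, 0 ≤ F p)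
    (hF : ∀ i j, F (i, j) ≤ u i * w i j) (hw : ∀ i, Summable (w i))
    (hwC : ∀ i, ∑' j, w i j ≤ C) :
    Summable F ∧ ∀ i, ∑' j, F (i, j) ≤ C * u i := by
  have h1 : ∀ i, Summable fun j => F (i, j) := fun i =>
    Summable.of_nonneg_of_le (fun _ => hF0 _) (hF i) ((hw i).mul_left _)
  have h2 : ∀ i, ∑' j, F (i, j) ≤ C * u i := fun i => by
    refine ((h1 i).tsum_le_tsum (hF i) ((hw i).mul_left _)).trans ?_
    rw [tsum_mul_left, mul_comm]
    exact mul_le_mul_of_nonneg_right (hwC i) (hu0 i)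
  refine ⟨(summable_prod_of_nonneg hF0).mpr ⟨h1, ?_⟩, h2⟩
  exact Summable.of_nonneg_of_le (fun i => tsum_nonneg fun _ => hF0 _) h2 (hu.mul_left C)

end

section

/-! ### The Weil representation, realized on Jacobi theta functions -/

theorem e_add (x y : ℂ) : e (x + y) = e x * e y := by
  rw [e, e, e, ← Complex.exp_add]; congr 1; ring

theorem e_zero : e 0 = 1 := by simp [e]

theorem e_neg (x : ℂ) : e (-x) = (e x)⁻¹ := by
  rw [e, e, ← Complex.exp_neg]; congr 1; ring

theorem e_ne_zero (x : ℂ) : e x ≠ 0 := Complex.exp_ne_zero _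

theorem e_int (n : ℤ) : e n = 1 := by
  rw [e, Complex.exp_eq_one_iff]; exact ⟨n, by ring⟩

theorem e_add_int (x : ℂ) (n : ℤ) : e (x + n) = e x := by rw [e_add, e_int, mul_one]

theorem conj_e (x : ℂ) : (starRingEnd ℂ) (e x) = e (-(starRingEnd ℂ) x) := by
  rw [e, ← Complex.exp_conj, e]; congr 1; simp [Complex.conj_ofNat]

theorem norm_e_real {x : ℂ} (hx : x.im = 0) : ‖e x‖ = 1 := by
  rw [e, Complex.norm_exp]; simp [hx]

theorem norm_e (x : ℂ) : ‖e x‖ = Real.exp (-2 * Real.pi * x.im) := by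
  rw [e, Complex.norm_exp]; congr 1; simp

/-- Division with remainder by `n`, with the remainder as a residue class. -/
def intProdZMod (n : ℕ) [NeZero n] : ℤ × ZMod n ≃ ℤ where
  toFun p := n * p.1 + (p.2.val : ℤ)
  invFun m := (m / n, (m : ZMod n))
  left_inv p := by
    obtain ⟨l, r⟩ := p
    have h1 : (0 : ℤ) < n := by exact_mod_cast Nat.pos_of_ne_zero (NeZero.ne n)
    have h2 : (r.val : ℤ) < n := by exact_mod_cast r.val_lt
    ext1
    · simp only
      rw [add_comm, Int.add_mul_ediv_left _ _ h1.ne', Int.ediv_eq_zero_of_lt (by positivity) h2]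
      simp
    · simp
  right_inv m := by
    simp only [ZMod.val_intCast]
    exact Int.mul_ediv_add_emod m n

theorem intProdZMod_apply (n : ℕ) [NeZero n] (l : ℤ) (r : ZMod n) :
    intProdZMod n (l, r) = n * l + (r.val : ℤ) := rfl

/-- The summation over `ℤ` splits into residue classes. -/
theorem tsum_int_eq_sum_zmod (n : ℕ) [NeZero n] {f : ℤ → ℂ} (hf : Summable f) :
    ∑' m, f m = ∑ r : ZMod n, ∑' l : ℤ, f (n * l + (r.val : ℤ)) := by
  have h := (intProdZMod n).summable_iff.mpr hf
  rw [← (intProdZMod n).tsum_eq f, ← (Equiv.prodComm _ _).tsum_eq]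
  have h' := (Equiv.prodComm (ZMod n) ℤ).summable_iff.mpr h
  refine (h'.tsum_prod).trans ?_
  rw [tsum_fintype]
  rfl

variable (N : ℕ) [NeZero N]

/-- The Jacobi theta function `∑ e(N b² τ + 2 N b z)`, summed over `b ∈ r / 2N + ℤ`. -/
def jacobiVec (r : ZMod (2 * N)) (τ : ℍ) (z : ℂ) : ℂ :=
  ∑' l : ℤ, e (N * (l + r.val / (2 * N)) ^ 2 * τ + 2 * N * (l + r.val / (2 * N)) * z)

theorem natCast_pos : (0 : ℝ) < N := by exact_mod_cast Nat.pos_of_ne_zero (NeZero.ne N)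

theorem natCast_ne_zero : (N : ℂ) ≠ 0 := by exact_mod_cast NeZero.ne N

theorem summable_jacobiVec (t : ℂ) (τ : ℍ) (z : ℂ) :
    Summable fun l : ℤ => e (N * (l + t) ^ 2 * τ + 2 * N * (l + t) * z) := by
  refine Summable.of_norm_bounded (summable_exp_quadratic (A := 2 * Real.pi * N * τ.im)
    (by have := natCast_pos N; have := τ.im_pos; have := Real.pi_pos; positivity)
    ‖2 * Real.pi * Complex.I * (2 * N * t * τ + 2 * N * z)‖
    ‖2 * Real.pi * Complex.I * (N * t ^ 2 * τ + 2 * N * t * z)‖) fun n => ?_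
  rw [e, show 2 * Real.pi * Complex.I * (N * (n + t) ^ 2 * τ + 2 * N * (n + t) * z) =
    (2 * Real.pi * Complex.I * N * τ) * n ^ 2 +
      (2 * Real.pi * Complex.I * (2 * N * t * τ + 2 * N * z)) * n +
      2 * Real.pi * Complex.I * (N * t ^ 2 * τ + 2 * N * t * z) by ring]
  refine norm_exp_quadratic_le ?_ le_rfl le_rfl n
  simp

/-- The terms of the Jacobi theta function, written with an integer `m ≡ r` modulo `2N`. -/
theorem jacobi_term (l : ℤ) (r : ZMod (2 * N)) (τ : ℍ) (z : ℂ) :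
    e (N * (l + r.val / (2 * N)) ^ 2 * τ + 2 * N * (l + r.val / (2 * N)) * z) =
      e ((((2 * N : ℕ) * l + (r.val : ℤ) : ℤ) : ℂ) ^ 2 * τ / (4 * N) +
        (((2 * N : ℕ) * l + (r.val : ℤ) : ℤ) : ℂ) * z) := by
  have := natCast_ne_zero N
  congr 1
  push_cast
  field_simp
  ring

/-- The Fourier coefficients of the Jacobi theta functions. -/
theorem integral_jacobiVec (r r' : ZMod (2 * N)) (τ : ℍ) :
    ∫ x in (0 : ℝ)..1, jacobiVec N r τ x * e (-(r'.val * x)) =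
      if r = r' then e ((r.val : ℂ) ^ 2 * τ / (4 * N)) else 0 := by
  set c : ℤ → ℂ := fun l => e ((((2 * N : ℕ) * l + (r.val : ℤ) : ℤ) : ℂ) ^ 2 * τ / (4 * N)) with hc
  set k : ℤ → ℤ := fun l => ((2 * N : ℕ) * l + (r.val : ℤ) : ℤ) - (r'.val : ℤ) with hk
  set f : ℤ → C(ℝ, ℂ) := fun l => ⟨fun x => c l * e (k l * x), by
    unfold e; fun_prop⟩ with hf
  have hfe : ∀ x : ℝ, jacobiVec N r τ x * e (-(r'.val * x)) = ∑' l, f l x := by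
    intro x
    rw [jacobiVec, ← tsum_mul_right]
    congr 1
    funext l
    rw [jacobi_term, ← e_add, hf]
    simp only [ContinuousMap.coe_mk, hc, hk]
    rw [← e_add]
    congr 1
    push_cast
    ring
  have hcs : Summable fun l => ‖c l‖ := by
    have := (summable_jacobiVec N (r.val / (2 * N)) τ 0).norm
    refine this.congr fun l => ?_
    rw [jacobi_term, hc]
    simp
  have hbound : ∀ l, ‖(f l).restrict (⟨Set.uIcc (0 : ℝ) 1, isCompact_uIcc⟩ :
      TopologicalSpace.Compacts ℝ)‖ ≤ ‖c l‖ := by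
    intro l
    rw [ContinuousMap.norm_le _ (norm_nonneg _)]
    intro x
    simp only [ContinuousMap.restrict_apply, hf, ContinuousMap.coe_mk, norm_mul]
    rw [norm_e_real (x := (k l : ℂ) * _) (by simp), mul_one]
  have h := intervalIntegral.hasSum_intervalIntegral_of_summable_norm (a := 0) (b := 1) (f := f)
    (Summable.of_nonneg_of_le (fun _ => norm_nonneg _) hbound hcs)
  simp_rw [hfe]
  rw [← h.tsum_eq]
  -- only the exponent zero contributes
  have hint : ∀ l, ∫ x in (0 : ℝ)..1, f l x = if k l = 0 then c l else 0 := by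
    intro l
    simp only [hf, ContinuousMap.coe_mk]
    rw [intervalIntegral.integral_const_mul]
    split_ifs with h0
    · simp [h0, e_zero]
    · have h0' : (k l : ℂ) ≠ 0 := by exact_mod_cast h0
      have hne : 2 * Real.pi * Complex.I * (k l : ℂ) ≠ 0 :=
        mul_ne_zero Complex.two_pi_I_ne_zero h0'
      have : (fun x : ℝ => e (k l * x)) =
          fun x : ℝ => Complex.exp ((2 * Real.pi * Complex.I * (k l : ℂ)) * x) := by
        funext x; rw [e]; congr 1; ring
      rw [this, integral_exp_mul_complex hne]
      have h1 : Complex.exp (2 * Real.pi * Complex.I * (k l : ℂ)) = 1 := e_int (k l)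
      simp [h1]
  simp_rw [hint]
  have hn : (0 : ℤ) < (2 * N : ℕ) := by
    exact_mod_cast Nat.pos_of_ne_zero (NeZero.ne (2 * N))
  have hk0 : ∀ l, k l = 0 ↔ (l = 0 ∧ r = r') := by
    intro l
    have e1 : k l = intProdZMod (2 * N) (l, r) - intProdZMod (2 * N) (0, r') := by
      simp [hk, intProdZMod_apply]
    rw [e1, sub_eq_zero, (intProdZMod (2 * N)).injective.eq_iff, Prod.mk.injEq]
  simp_rw [hk0]
  split_ifs with hr
  · rw [tsum_eq_single 0 (fun l hl => by simp [hl])]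
    simp [hr, hc]
  · simp [hr]

theorem continuous_jacobiVec (r : ZMod (2 * N)) (τ : ℍ) :
    Continuous fun x : ℝ => jacobiVec N r τ x := by
  unfold jacobiVec
  refine continuous_tsum (u := fun l : ℤ => ‖e (N * (l + r.val / (2 * N)) ^ 2 * τ +
    2 * N * (l + r.val / (2 * N)) * 0)‖) (fun l => by unfold e; fun_prop)
    (summable_jacobiVec N _ τ 0).norm fun l x => ?_
  have him : (2 * N * (l + r.val / (2 * N)) * (x : ℂ)).im = 0 := by
    have : (2 * N * (l + r.val / (2 * N)) * (x : ℂ)) =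
      ((2 * N * (l + r.val / (2 * N)) * x : ℝ) : ℂ) := by push_cast; rfl
    rw [this, Complex.ofReal_im]
  rw [e_add, e_add, norm_mul, norm_mul, norm_e_real him, mul_zero, e_zero, norm_one]

/-- The Jacobi theta functions are linearly independent, for each `τ`. -/
theorem jacobiVec_linearIndependent {c : ZMod (2 * N) → ℂ} (τ : ℍ)
    (h : ∀ x : ℝ, ∑ r, c r * jacobiVec N r τ x = 0) (r : ZMod (2 * N)) : c r = 0 := by
  have h1 : ∫ x in (0 : ℝ)..1, (∑ r', c r' * jacobiVec N r' τ x) * e (-(r.val * x)) = 0 := by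
    simp [h]
  simp_rw [Finset.sum_mul, mul_assoc] at h1
  rw [intervalIntegral.integral_finsetSum] at h1
  · simp_rw [intervalIntegral.integral_const_mul, integral_jacobiVec] at h1
    simpa [e_ne_zero] using h1
  · intro i _
    refine Continuous.intervalIntegrable ?_ _ _
    refine continuous_const.mul ((continuous_jacobiVec N i τ).mul ?_)
    unfold e; fun_prop

/-- The weight `1/2`, index `N` action of `Γ'` on functions on `ℍ × ℂ`; it is an action from the
right (`jacobiSlash_mul`). -/
def jacobiSlash (N : ℕ) (g : Mp2Z) (F : ℍ → ℂ → ℂ) (τ : ℍ) (z : ℂ) : ℂ :=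
  (g.root τ)⁻¹ * e (-(N * (g.mat 1 0) * z ^ 2 / ((g.mat 1 0 : ℂ) * τ + (g.mat 1 1 : ℂ)))) *
    F (g.mat • τ) (z / ((g.mat 1 0 : ℂ) * τ + (g.mat 1 1 : ℂ)))

theorem jacobiSlash_mul (N : ℕ) (g h : Mp2Z) (F : ℍ → ℂ → ℂ) (τ : ℍ) (z : ℂ) :
    jacobiSlash N (g * h) F τ z = jacobiSlash N h (jacobiSlash N g F) τ z := by
  have hj := Mp2Z.denom_mul g.mat h.mat τ
  have h1 := Mp2Z.denom_ne_zero h.mat τ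
  have h2 := Mp2Z.denom_ne_zero g.mat (h.mat • τ)
  have hc : ((g.mat * h.mat) 1 0 : ℂ) =
      (h.mat 1 0 : ℂ) * ((g.mat 1 0 : ℂ) * (h.mat • τ : ℍ) + (g.mat 1 1 : ℂ)) +
      (g.mat 1 0 : ℂ) / ((h.mat 1 0 : ℂ) * τ + (h.mat 1 1 : ℂ)) := by
    have hdet := h.mat.det_coe
    rw [Matrix.det_fin_two] at hdet
    have hdet' : (h.mat 0 0 : ℂ) * h.mat 1 1 - (h.mat 0 1 : ℂ) * h.mat 1 0 = 1 := by
      exact_mod_cast hdet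
    have h3 : ((g.mat * h.mat) 1 0 : ℂ) =
        (g.mat 1 0 : ℂ) * h.mat 0 0 + (g.mat 1 1 : ℂ) * h.mat 1 0 := by
      simp [Matrix.SpecialLinearGroup.coe_mul, Matrix.mul_apply, Fin.sum_univ_two]
    rw [h3, Mp2Z.coe_smul]
    field_simp
    linear_combination (g.mat 1 0 : ℂ) * hdet'
  simp only [jacobiSlash, Mp2Z.mul_mat, Mp2Z.mul_root, hj, mul_inv, mul_smul]
  rw [div_div, mul_comm ((h.mat 1 0 : ℂ) * τ + (h.mat 1 1 : ℂ))]
  have he : e (-(N * ((g.mat * h.mat) 1 0 : ℂ) * z ^ 2 /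
      (((g.mat 1 0 : ℂ) * (h.mat • τ : ℍ) + (g.mat 1 1 : ℂ)) *
        ((h.mat 1 0 : ℂ) * τ + (h.mat 1 1 : ℂ))))) =
      e (-(N * (h.mat 1 0) * z ^ 2 / ((h.mat 1 0 : ℂ) * τ + (h.mat 1 1 : ℂ)))) *
      e (-(N * (g.mat 1 0) * (z / ((h.mat 1 0 : ℂ) * τ + (h.mat 1 1 : ℂ))) ^ 2 /
        ((g.mat 1 0 : ℂ) * (h.mat • τ : ℍ) + (g.mat 1 1 : ℂ)))) := by
    rw [← e_add, hc]
    congr 1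
    field_simp
    ring
  rw [he]
  ring

theorem jacobiSlash_one (N : ℕ) (F : ℍ → ℂ → ℂ) (τ : ℍ) (z : ℂ) :
    jacobiSlash N 1 F τ z = F τ z := by
  simp [jacobiSlash, e_zero]

/-- The matrix of `T` on the vector of Jacobi theta functions. -/
def thetaMatrixT : Matrix (ZMod (2 * N)) (ZMod (2 * N)) ℂ :=
  Matrix.diagonal fun r => e ((r.val : ℂ) ^ 2 / (4 * N))

/-- The matrix of `S` on the vector of Jacobi theta functions. -/
def thetaMatrixS : Matrix (ZMod (2 * N)) (ZMod (2 * N)) ℂ :=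
  Matrix.of fun r r' => e (-1 / 8) / (Real.sqrt (2 * N) : ℂ) *
    e (-((r.val : ℂ) * r'.val / (2 * N)))

/-- The relation `θ | g = A θ` for the vector `θ` of Jacobi theta functions. Although the action is
from the right, the matrices multiply in the order of the group (`ActsBy.mul`). -/
def ActsBy (g : Mp2Z) (A : Matrix (ZMod (2 * N)) (ZMod (2 * N)) ℂ) : Prop :=
  ∀ r τ z, jacobiSlash N g (jacobiVec N r) τ z = ∑ r', A r r' * jacobiVec N r' τ z

theorem actsBy_T : ActsBy N Mp2Z.T (thetaMatrixT N) := by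
  intro r τ z
  have hN := natCast_ne_zero N
  simp only [thetaMatrixT, Matrix.diagonal_apply, ite_mul, zero_mul, Finset.sum_ite_eq,
    Finset.mem_univ, if_true]
  have h1 : ((ModularGroup.T • τ : ℍ) : ℂ) = τ + 1 := by
    simpa using ModularGroup.coe_T_zpow_smul_eq (z := τ) (n := 1)
  simp only [jacobiSlash, Mp2Z.T, jacobiVec, h1]
  simp only [ModularGroup.T, Matrix.SpecialLinearGroup.coe_mk, Matrix.of_apply, Matrix.cons_val',
    Matrix.cons_val_zero, Matrix.cons_val_one, Matrix.cons_val_fin_one, Int.cast_zero,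
    Int.cast_one, zero_mul, mul_zero, zero_add, div_one, neg_zero, e_zero, inv_one,
    one_mul]
  rw [← tsum_mul_left]
  congr 1
  funext l
  rw [← e_add, ← e_add_int _ (-(N * l ^ 2 + l * r.val))]
  congr 1
  push_cast
  field_simp
  ring

/-- The principal branches of the two square roots are compatible, as `0 < arg τ < π`. -/
theorem cpow_half_mul (τ : ℍ) :
    ((2 * N * Complex.I / τ : ℂ) ^ (1 / 2 : ℂ)) * (τ : ℂ) ^ (1 / 2 : ℂ) =
      e (1 / 8) * (Real.sqrt (2 * N) : ℂ) := by
  have hτ := τ.ne_zero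
  have hN := natCast_pos N
  have h1 : (2 * N * Complex.I / τ : ℂ) = ((2 * N : ℝ) : ℂ) * (Complex.I / τ) := by
    push_cast; ring
  have h2 : Complex.log (Complex.I / τ) = Complex.log Complex.I - Complex.log τ := by
    have harg : 0 < (τ : ℂ).arg ∧ (τ : ℂ).arg < Real.pi := by
      constructor
      · refine lt_of_le_of_ne (Complex.arg_nonneg_iff.mpr τ.im_pos.le) fun h => ?_
        have := (Complex.arg_eq_zero_iff.mp h.symm).2
        exact τ.im_ne_zero this
      · refine lt_of_le_of_ne (Complex.arg_le_pi _) fun h => ?_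
        have := (Complex.arg_eq_pi_iff.mp h).2
        exact τ.im_ne_zero this
    rw [← Complex.exp_log (div_ne_zero Complex.I_ne_zero hτ)] 
    have : Complex.exp (Complex.log (Complex.I / τ)) =
        Complex.exp (Complex.log Complex.I - Complex.log τ) := by
      rw [Complex.exp_sub, Complex.exp_log Complex.I_ne_zero, Complex.exp_log hτ,
        Complex.exp_log (div_ne_zero Complex.I_ne_zero hτ)]
    rw [this, Complex.log_exp]
    · rw [Complex.sub_im, Complex.log_im, Complex.log_im, Complex.arg_I]
      linarith [harg.2]
    · rw [Complex.sub_im, Complex.log_im, Complex.log_im, Complex.arg_I]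
      linarith [harg.1, Real.pi_pos]
  have hpos : (0 : ℝ) < 2 * N := by positivity
  have hq := div_ne_zero Complex.I_ne_zero hτ
  have hs : (Real.sqrt (2 * N) : ℂ) = Complex.exp (Real.log (2 * N) / 2) := by
    rw [Real.sqrt_eq_rpow, Real.rpow_def_of_pos hpos]
    push_cast
    congr 1
    ring
  rw [h1, Complex.cpow_def_of_ne_zero (mul_ne_zero (by exact_mod_cast hpos.ne') hq),
    Complex.log_ofReal_mul hpos hq, Complex.cpow_def_of_ne_zero hτ, ← Complex.exp_add, h2,
    Complex.log_I, hs, e, ← Complex.exp_add]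
  congr 1
  ring

theorem actsBy_S : ActsBy N Mp2Z.S (thetaMatrixS N) := by
  intro r τ z
  have hN := natCast_ne_zero N
  have hNp := natCast_pos N
  have hτ := τ.ne_zero
  have hI := Complex.I_sq
  have h1 : ((ModularGroup.S • τ : ℍ) : ℂ) = -1 / τ := by
    rw [UpperHalfPlane.modular_S_smul]; simp [neg_div, inv_neg]
  have hsq : (Real.sqrt (2 * N) : ℂ) ≠ 0 := by
    have : Real.sqrt (2 * N) ≠ 0 := (Real.sqrt_pos.mpr (by positivity)).ne'
    exact_mod_cast this
  have hroot : (τ : ℂ) ^ (1 / 2 : ℂ) ≠ 0 := by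
    rw [Ne, Complex.cpow_eq_zero_iff]; tauto
  set t : ℂ := r.val / (2 * N) with ht
  have ha : 0 < (2 * N * Complex.I / τ : ℂ).re := by
    have : (2 * N * Complex.I / τ : ℂ) = ((2 * N : ℝ) : ℂ) * (Complex.I * (τ : ℂ)⁻¹) := by
      push_cast; ring
    rw [this, Complex.re_ofReal_mul, Complex.I_mul_re, Complex.inv_im]
    have := Complex.normSq_pos.mpr hτ
    have := τ.im_pos
    simp only [UpperHalfPlane.coe_im, neg_div, neg_neg]
    positivity
  have ha0 : (2 * N * Complex.I / τ : ℂ) ≠ 0 := fun h => by simp [h] at ha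
  have hP := tsum_gaussian_shift ha (2 * N * Complex.I * z / τ) t
  have hcoef := cpow_half_mul N τ
  have hac : (2 * N * Complex.I / τ : ℂ) ^ (1 / 2 : ℂ) ≠ 0 := by
    rw [Ne, Complex.cpow_eq_zero_iff]; tauto
  simp only [jacobiSlash, Mp2Z.S, jacobiVec, h1]
  simp only [ModularGroup.S, Matrix.SpecialLinearGroup.coe_mk, Matrix.of_apply, Matrix.cons_val',
    Matrix.cons_val_zero, Matrix.cons_val_one, Matrix.cons_val_fin_one, Int.cast_zero,
    Int.cast_one, one_mul, add_zero]
  -- Poisson summation on the left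
  have hL : ∑' l : ℤ, e (N * (l + r.val / (2 * N)) ^ 2 * (-1 / τ) +
      2 * N * (l + r.val / (2 * N)) * (z / τ)) =
      1 / (2 * N * Complex.I / τ : ℂ) ^ (1 / 2 : ℂ) * (e (N * z ^ 2 / τ) *
        ∑' n : ℤ, e ((n : ℂ) ^ 2 * τ / (4 * N) + n * (z - t))) := by
    refine Eq.trans ?_ (hP.trans ?_)
    · congr 1
      funext l
      rw [e]
      congr 1
      simp only [← ht]
      field_simp
    · congr 1
      rw [← tsum_mul_left, ← (Equiv.neg ℤ).tsum_eq]
      congr 1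
      funext n
      rw [← e_add, e]
      congr 1
      simp only [Equiv.neg_apply, Int.cast_neg]
      field_simp
      ring_nf
      have hI4 : Complex.I ^ 4 = 1 := by rw [show 4 = 2 * 2 by rfl, pow_mul, hI]; ring
      simp only [Complex.I_sq, hI4]
      ring
  rw [hL]
  have hsum : Summable fun n : ℤ => e ((n : ℂ) ^ 2 * τ / (4 * N) + n * (z - t)) := by
    have := summable_jacobiVec N 0 ⟨τ / (4 * N ^ 2 : ℝ), by
      rw [Complex.div_ofReal_im]; have := τ.im_pos; simp only [UpperHalfPlane.coe_im]
      positivity⟩ ((z - t) / (2 * N))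
    refine this.congr fun n => ?_
    congr 1
    push_cast
    field_simp
    try ring
  -- split the dual sum into the residue classes modulo `2N`, one for each theta function
  rw [tsum_int_eq_sum_zmod (2 * N) hsum]
  have hterm : ∀ (r' : ZMod (2 * N)) (l : ℤ),
      e ((((2 * N : ℕ) * l + (r'.val : ℤ) : ℤ) : ℂ) ^ 2 * τ / (4 * N) +
        (((2 * N : ℕ) * l + (r'.val : ℤ) : ℤ) : ℂ) * (z - t)) =
      e (-((r.val : ℂ) * r'.val / (2 * N))) *
        e (N * (l + r'.val / (2 * N)) ^ 2 * τ + 2 * N * (l + r'.val / (2 * N)) * z) := by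
    intro r' l
    rw [jacobi_term, ← e_add, ← e_add_int _ (l * r.val)]
    congr 1
    simp only [ht]
    push_cast
    field_simp
    ring
  simp_rw [hterm, tsum_mul_left]
  rw [Finset.mul_sum, Finset.mul_sum, Finset.mul_sum]
  refine Finset.sum_congr rfl fun r' _ => ?_
  simp only [thetaMatrixS, Matrix.of_apply]
  have h8 : e (-1 / 8) = (e (1 / 8))⁻¹ := by rw [← e_neg]; congr 1; ring
  have hz : e (-(N * z ^ 2 / τ)) * e (N * z ^ 2 / τ) = 1 := by
    rw [← e_add, neg_add_cancel, e_zero]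
  have hc : ((τ : ℂ) ^ (1 / 2 : ℂ))⁻¹ * (1 / (2 * N * Complex.I / τ : ℂ) ^ (1 / 2 : ℂ)) =
      e (-1 / 8) / (Real.sqrt (2 * N) : ℂ) := by
    have aux : ∀ A B X Y : ℂ, A * B = X * Y → B⁻¹ * (1 / A) = X⁻¹ / Y := fun A B X Y h => by
      rw [one_div, ← mul_inv, mul_comm, h, mul_inv]
      rfl
    rw [h8]
    exact aux _ _ _ _ hcoef
  rw [← hc]
  simp only [mul_one]
  linear_combination (((τ : ℂ) ^ (1 / 2 : ℂ))⁻¹ *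
    (1 / (2 * N * Complex.I / τ : ℂ) ^ (1 / 2 : ℂ)) * e (-((r.val : ℂ) * r'.val / (2 * N))) *
    ∑' l : ℤ, e (N * (l + r'.val / (2 * N)) ^ 2 * τ + 2 * N * (l + r'.val / (2 * N)) * z)) * hz

theorem e_val_mul_val (r r' : ZMod (2 * N)) :
    e (-((r.val : ℂ) * r'.val / (2 * N))) = ZMod.stdAddChar (-(r * r')) := by
  have h := ZMod.stdAddChar_coe (N := 2 * N) (-((r.val : ℤ) * (r'.val : ℤ)))
  have h2 : ((-((r.val : ℤ) * (r'.val : ℤ)) : ℤ) : ZMod (2 * N)) = -(r * r') := by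
    push_cast
    rw [ZMod.natCast_zmod_val, ZMod.natCast_zmod_val]
  rw [h2] at h
  rw [h, e]
  congr 1
  push_cast
  ring

theorem thetaMatrixS_mem_unitary :
    thetaMatrixS N ∈ Matrix.unitaryGroup (ZMod (2 * N)) ℂ := by
  rw [Matrix.mem_unitaryGroup_iff]
  have hNp := natCast_pos N
  have hc : (e (-1 / 8) / (Real.sqrt (2 * N) : ℂ)) *
      (starRingEnd ℂ) (e (-1 / 8) / (Real.sqrt (2 * N) : ℂ)) = 1 / (2 * N) := by
    rw [Complex.mul_conj, Complex.normSq_eq_norm_sq, norm_div,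
      norm_e_real (by simp)]
    rw [Complex.norm_real, Real.norm_eq_abs, abs_of_nonneg (Real.sqrt_nonneg _), div_pow,
      Real.sq_sqrt (by positivity)]
    push_cast
    simp
  ext r r''
  have h1 : ∀ r' : ZMod (2 * N), thetaMatrixS N r r' * star (thetaMatrixS N) r' r'' =
      1 / (2 * N) * ZMod.stdAddChar (r' * (r'' - r)) := by
    intro r'
    rw [Matrix.star_apply, thetaMatrixS, Matrix.of_apply, Matrix.of_apply, RCLike.star_def,
      map_mul, mul_mul_mul_comm, hc, conj_e]
    congr 1
    have h2 : e (-(starRingEnd ℂ) (-((r''.val : ℂ) * r'.val / (2 * N)))) =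
        (ZMod.stdAddChar (-(r'' * r')))⁻¹ := by
      rw [← e_val_mul_val, ← e_neg]
      simp [Complex.conj_ofNat, -ZMod.natCast_val]
    rw [h2, e_val_mul_val, ← AddChar.map_neg_eq_inv, ← AddChar.map_add_eq_mul]
    congr 1
    ring
  rw [Matrix.mul_apply]
  simp_rw [h1]
  rw [← Finset.mul_sum, AddChar.sum_mulShift _ (ZMod.isPrimitive_stdAddChar (2 * N)),
    Matrix.one_apply]
  have := natCast_ne_zero N
  by_cases h : r = r''
  · simp [h, ZMod.card, sub_self]
    field_simp
  · rw [if_neg (fun h' => h (sub_eq_zero.mp h').symm), if_neg h]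
    simp

theorem thetaMatrixT_mem_unitary :
    thetaMatrixT N ∈ Matrix.unitaryGroup (ZMod (2 * N)) ℂ := by
  rw [Matrix.mem_unitaryGroup_iff, thetaMatrixT, Matrix.star_eq_conjTranspose,
    Matrix.diagonal_conjTranspose, Matrix.diagonal_mul_diagonal, ← Matrix.diagonal_one]
  congr 1
  funext r
  have him : ((r.val : ℂ) ^ 2 / (4 * N)).im = 0 := by
    have : ((r.val : ℂ) ^ 2 / (4 * N)) = ((r.val ^ 2 / (4 * N) : ℝ) : ℂ) := by push_cast; rfl
    rw [this, Complex.ofReal_im]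
  simp only [Pi.star_apply, RCLike.star_def]
  rw [Complex.mul_conj, Complex.normSq_eq_norm_sq, norm_e_real him]
  simp

/-- `S⁴ = (1, -1)`, and more generally every element over `±1` is a power of `S`. Together with
the generators of `SL₂(ℤ)` this shows that `S` and `T` generate `Γ'`. -/
theorem Mp2Z.closure_S_T : Subgroup.closure {Mp2Z.S, Mp2Z.T} = ⊤ := by
  rw [eq_top_iff]
  intro g _
  set H := Subgroup.closure {Mp2Z.S, Mp2Z.T} with hH
  have hmap : H.map Mp2Z.proj = ⊤ := by
    rw [hH, MonoidHom.map_closure, Set.image_pair]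
    exact SpecialLinearGroup.SL2Z_generators
  obtain ⟨g', hg', he⟩ : g.mat ∈ H.map Mp2Z.proj := hmap ▸ Subgroup.mem_top _
  have hmat : (g * g'⁻¹).mat = 1 := by
    have : g'.mat = g.mat := he
    simp [this]
  -- the root of an element over `1` is constant, `1` or `-1`
  set k := g * g'⁻¹ with hk
  have hsq : ∀ τ, k.root τ ^ 2 = 1 := fun τ => by rw [k.sq, hmat]; simp
  have hcont : Continuous k.root := k.holomorphic.continuous
  have hpre : IsPreconnected (Set.univ : Set ℍ) := isPreconnected_univ
  have hconst := hpre.eq_or_eq_neg_of_sq_eq (f := k.root) (g := fun _ => (1 : ℂ))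
    hcont.continuousOn continuousOn_const (fun τ _ => by simp [hsq τ]) (fun _ => one_ne_zero)
  have hkH : k ∈ H := by
    rcases hconst with h | h
    · have : k = 1 := Mp2Z.ext_iff' hmat fun τ => h (Set.mem_univ τ)
      rw [this]; exact one_mem _
    · have : k = Mp2Z.S ^ 4 := by
        refine Mp2Z.ext_iff' ?_ fun τ => ?_
        · rw [hmat]
          have : (Mp2Z.S ^ 4).mat = ModularGroup.S ^ 4 := map_pow Mp2Z.proj Mp2Z.S 4
          rw [this]
          decide
        · rw [show k.root τ = -1 from h (Set.mem_univ τ)]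
          -- `√(-1 / τ) √τ = i` for the principal branches
          have hI : ∀ τ : ℍ, (Mp2Z.S * Mp2Z.S).root τ = Complex.I := by
            intro τ
            have h1 := cpow_half_mul 1 τ
            have h2 : ((ModularGroup.S • τ : ℍ) : ℂ) = -1 / τ := by
              rw [UpperHalfPlane.modular_S_smul]; simp [neg_div, inv_neg]
            change ((ModularGroup.S • τ : ℍ) : ℂ) ^ (1 / 2 : ℂ) * (τ : ℂ) ^ (1 / 2 : ℂ) = _
            have harg : 0 < (τ : ℂ).arg := by
              refine lt_of_le_of_ne (Complex.arg_nonneg_iff.mpr τ.im_pos.le) fun h => ?_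
              exact τ.im_ne_zero (Complex.arg_eq_zero_iff.mp h.symm).2
            have hτ := τ.ne_zero
            have hlog : Complex.log (-1 / τ) = Real.pi * Complex.I - Complex.log τ := by
              have e1 : (-1 / τ : ℂ) = Complex.exp (Real.pi * Complex.I - Complex.log τ) := by
                rw [Complex.exp_sub, Complex.exp_pi_mul_I, Complex.exp_log hτ]
              have e2 : (Real.pi * Complex.I - Complex.log τ).im = Real.pi - (τ : ℂ).arg := by
                simp [Complex.log_im]
              rw [e1, Complex.log_exp]
              · rw [e2]; linarith [Complex.arg_le_pi (τ : ℂ), Real.pi_pos]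
              · rw [e2]; linarith
            rw [h2, Complex.cpow_def_of_ne_zero (div_ne_zero (by simp) hτ),
              Complex.cpow_def_of_ne_zero hτ, ← Complex.exp_add, hlog]
            refine Eq.trans ?_ Complex.exp_pi_div_two_mul_I
            congr 1
            ring
          have : Mp2Z.S ^ 4 = (Mp2Z.S * Mp2Z.S) * (Mp2Z.S * Mp2Z.S) := by
            rw [← pow_two, ← pow_two, ← pow_mul]
          rw [this, Mp2Z.mul_root, hI, hI, Complex.I_mul_I]
      rw [this]
      exact pow_mem (Subgroup.subset_closure (by simp)) 4
  have : g = k * g' := by simp [hk]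
  rw [this]
  exact mul_mem hkH hg'

variable {N}

theorem ActsBy.mul {g h : Mp2Z} {A B : Matrix (ZMod (2 * N)) (ZMod (2 * N)) ℂ}
    (hg : ActsBy N g A) (hh : ActsBy N h B) : ActsBy N (g * h) (A * B) := by
  intro r τ z
  rw [jacobiSlash_mul]
  have h1 : jacobiSlash N g (jacobiVec N r) = fun τ z => ∑ r', A r r' * jacobiVec N r' τ z := by
    funext τ z; exact hg r τ z
  rw [h1]
  have h2 : jacobiSlash N h (fun τ z => ∑ r', A r r' * jacobiVec N r' τ z) τ z =
      ∑ r', A r r' * jacobiSlash N h (jacobiVec N r') τ z := by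
    simp only [jacobiSlash]
    rw [Finset.mul_sum]
    exact Finset.sum_congr rfl fun _ _ => by ring
  rw [h2]
  simp_rw [hh _ τ z, Matrix.mul_apply, Finset.mul_sum, Finset.sum_mul]
  rw [Finset.sum_comm]
  exact Finset.sum_congr rfl fun _ _ => Finset.sum_congr rfl fun _ _ => by ring

theorem ActsBy.one : ActsBy N 1 (1 : Matrix (ZMod (2 * N)) (ZMod (2 * N)) ℂ) := by
  intro r τ z
  rw [jacobiSlash_one]
  simp [Matrix.one_apply]

theorem ActsBy.unique {g : Mp2Z} {A B : Matrix (ZMod (2 * N)) (ZMod (2 * N)) ℂ}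
    (hA : ActsBy N g A) (hB : ActsBy N g B) : A = B := by
  ext r r'
  have h := jacobiVec_linearIndependent N (c := fun r' => A r r' - B r r') UpperHalfPlane.I
    (fun x => by
      simp_rw [sub_mul, Finset.sum_sub_distrib]
      rw [← hA r, ← hB r, sub_self]) r'
  exact sub_eq_zero.mp h

/-- A theta function is recovered from its image under `g`, which gives the matrix of `g⁻¹`. -/
theorem ActsBy.inv {g : Mp2Z} {A : Matrix (ZMod (2 * N)) (ZMod (2 * N)) ℂ}
    (hg : ActsBy N g A) (hA : A ∈ Matrix.unitaryGroup (ZMod (2 * N)) ℂ) :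
    ActsBy N g⁻¹ (star A) := by
  intro r τ z
  have h1 : ∀ r'', jacobiVec N r'' τ z =
      ∑ r', A r'' r' * jacobiSlash N g⁻¹ (jacobiVec N r') τ z := by
    intro r''
    have h2 : jacobiSlash N g⁻¹ (jacobiSlash N g (jacobiVec N r'')) τ z =
        jacobiVec N r'' τ z := by
      rw [← jacobiSlash_mul, mul_inv_cancel, jacobiSlash_one]
    rw [← h2]
    have h3 : jacobiSlash N g (jacobiVec N r'') =
        fun τ z => ∑ r', A r'' r' * jacobiVec N r' τ z := by
      funext τ z; exact hg r'' τ z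
    rw [h3]
    simp only [jacobiSlash]
    rw [Finset.mul_sum]
    exact Finset.sum_congr rfl fun _ _ => by ring
  have h4 : star A * A = 1 := Matrix.mem_unitaryGroup_iff'.mp hA
  simp_rw [h1, Finset.mul_sum, ← mul_assoc]
  rw [Finset.sum_comm]
  simp_rw [← Finset.sum_mul, ← Matrix.mul_apply, h4]
  simp [Matrix.one_apply]

variable (N)

theorem exists_actsBy (g : Mp2Z) :
    ∃ A ∈ Matrix.unitaryGroup (ZMod (2 * N)) ℂ, ActsBy N g A := by
  have hg : g ∈ Subgroup.closure {Mp2Z.S, Mp2Z.T} := Mp2Z.closure_S_T ▸ Subgroup.mem_top g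
  induction hg using Subgroup.closure_induction with
  | mem x hx =>
    rcases hx with rfl | rfl
    · exact ⟨_, thetaMatrixS_mem_unitary N, actsBy_S N⟩
    · exact ⟨_, thetaMatrixT_mem_unitary N, actsBy_T N⟩
  | one => exact ⟨1, one_mem _, ActsBy.one⟩
  | mul x y _ _ hx hy =>
    obtain ⟨A, hA, hA'⟩ := hx
    obtain ⟨B, hB, hB'⟩ := hy
    exact ⟨A * B, mul_mem hA hB, hA'.mul hB'⟩
  | inv x _ hx =>
    obtain ⟨A, hA, hA'⟩ := hx
    exact ⟨star A, Unitary.star_mem hA, hA'.inv hA⟩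

/-- The unitary matrix by which `g ∈ Γ'` acts on the vector of Jacobi theta functions. -/
def thetaMatrix (g : Mp2Z) : Matrix (ZMod (2 * N)) (ZMod (2 * N)) ℂ := (exists_actsBy N g).choose

theorem thetaMatrix_mem_unitary (g : Mp2Z) :
    thetaMatrix N g ∈ Matrix.unitaryGroup (ZMod (2 * N)) ℂ := (exists_actsBy N g).choose_spec.1

theorem actsBy_thetaMatrix (g : Mp2Z) : ActsBy N g (thetaMatrix N g) :=
  (exists_actsBy N g).choose_spec.2

theorem thetaMatrix_mul (g h : Mp2Z) : thetaMatrix N (g * h) = thetaMatrix N g * thetaMatrix N h :=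
  (actsBy_thetaMatrix N _).unique ((actsBy_thetaMatrix N g).mul (actsBy_thetaMatrix N h))

theorem thetaMatrix_one : thetaMatrix N 1 = 1 := (actsBy_thetaMatrix N _).unique ActsBy.one

/-- The Weil representation of the lattice of signature `(1, 2)`: the complex conjugate of the
action on Jacobi theta functions. -/
def conjTheta : Mp2Z →* Module.End ℂ (ZMod (2 * N) → ℂ) where
  toFun g := Matrix.toLin' ((thetaMatrix N g).map (starRingEnd ℂ))
  map_one' := by
    rw [thetaMatrix_one, Matrix.map_one _ (map_zero _) (map_one _), Matrix.toLin'_one]; rfl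
  map_mul' g h := by
    rw [thetaMatrix_mul, Matrix.map_mul, Matrix.toLin'_mul]; rfl

theorem conjTheta_basisVec (g : Mp2Z) (r r' : ZMod (2 * N)) :
    conjTheta N g (basisVec N r) r' = (starRingEnd ℂ) (thetaMatrix N g r' r) := by
  change Matrix.toLin' ((thetaMatrix N g).map (starRingEnd ℂ)) (Pi.single r 1) r' = _
  rw [Matrix.toLin'_apply, Matrix.mulVec_single_one]
  rfl

theorem isWeilRepresentation_conjTheta : IsWeilRepresentation N (conjTheta N) := by
  have hN := natCast_ne_zero N
  constructor
  · intro r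
    funext r'
    rw [conjTheta_basisVec, (actsBy_thetaMatrix N _).unique (actsBy_T N), thetaMatrixT,
      Matrix.diagonal_apply, Pi.smul_apply, basisVec, smul_eq_mul]
    by_cases h : r' = r
    · subst h
      rw [if_pos rfl, Pi.single_eq_same, mul_one, conj_e]
      congr 1
      simp [Q, mu, Matrix.det_fin_two, Complex.conj_ofNat, -ZMod.natCast_val]
      field_simp
      norm_num
    · rw [if_neg h, Pi.single_eq_of_ne h]
      simp
  · intro r
    funext r'
    rw [conjTheta_basisVec, (actsBy_thetaMatrix N _).unique (actsBy_S N), thetaMatrixS,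
      Matrix.of_apply, Pi.smul_apply, Finset.sum_apply, smul_eq_mul]
    simp_rw [Pi.smul_apply, basisVec, Pi.single_apply, smul_eq_mul, mul_ite, mul_one, mul_zero]
    rw [Finset.sum_ite_eq Finset.univ r', if_pos (Finset.mem_univ _), map_mul, map_div₀, conj_e,
      conj_e, Complex.conj_ofReal]
    congr 2
    · congr 1
      simp [Complex.conj_ofNat, neg_div]
    · congr 1
      simp [bil_eq, mu, Complex.conj_ofNat, -ZMod.natCast_val]
      field_simp
      norm_num

theorem isWeilRepresentation_weilRepresentation :
    IsWeilRepresentation N (weilRepresentation N) := by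
  have h : ∃ ρ, IsWeilRepresentation N ρ := ⟨_, isWeilRepresentation_conjTheta N⟩
  rw [weilRepresentation, dif_pos h]
  exact h.choose_spec

theorem IsWeilRepresentation.unique {ρ ρ' : Mp2Z →* Module.End ℂ (ZMod (2 * N) → ℂ)}
    (h : IsWeilRepresentation N ρ) (h' : IsWeilRepresentation N ρ') : ρ = ρ' := by
  refine MonoidHom.eq_of_eqOn_dense Mp2Z.closure_S_T ?_
  intro g hg
  refine LinearMap.pi_ext' fun r => LinearMap.ext_ring ?_
  rcases hg with rfl | rfl
  · exact (h.2 r).trans (h'.2 r).symm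
  · exact (h.1 r).trans (h'.1 r).symm

theorem weilRepresentation_apply (g : Mp2Z) (r : ZMod (2 * N)) :
    weilRepresentation N g⁻¹ (basisVec N 0) r = (starRingEnd ℂ) (thetaMatrix N g⁻¹ r 0) := by
  rw [IsWeilRepresentation.unique N (isWeilRepresentation_weilRepresentation N)
    (isWeilRepresentation_conjTheta N), conjTheta_basisVec]

theorem norm_weilRepresentation_le (g : Mp2Z) (r : ZMod (2 * N)) :
    ‖weilRepresentation N g⁻¹ (basisVec N 0) r‖ ≤ 1 := by
  rw [weilRepresentation_apply, RCLike.norm_conj]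
  exact entry_norm_bound_of_unitary (thetaMatrix_mem_unitary N _) r 0

/-- The Weil representation, applied to `e_0`, as an integral of Jacobi theta functions. Along the
line through `c τ + d` these functions are combinations of theta functions at `g τ`, restricted to
the real line, and the integral takes the constant Fourier coefficient. -/
theorem integral_jacobiVec_denom (g : Mp2Z) (r : ZMod (2 * N)) (τ : ℍ) :
    ∫ x in (0 : ℝ)..1, (starRingEnd ℂ)
        (e (N * (g.mat 1 0) * x ^ 2 * ((g.mat 1 0 : ℂ) * τ + (g.mat 1 1 : ℂ))) *
          jacobiVec N r τ (x * ((g.mat 1 0 : ℂ) * τ + (g.mat 1 1 : ℂ)))) =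
      ((starRingEnd ℂ) (g.root τ))⁻¹ * weilRepresentation N g⁻¹ (basisVec N 0) r := by
  set j : ℂ := (g.mat 1 0 : ℂ) * τ + (g.mat 1 1 : ℂ) with hj
  have hj0 : j ≠ 0 := Mp2Z.denom_ne_zero g.mat τ
  have hpt : ∀ x : ℝ, e (N * (g.mat 1 0) * x ^ 2 * j) * jacobiVec N r τ (x * j) =
      (g.root τ)⁻¹ * ∑ r', thetaMatrix N g⁻¹ r r' * jacobiVec N r' (g.mat • τ) x := by
    intro x
    have h1 : ∀ r', jacobiVec N r' (g.mat • τ) x = g.root τ * (e (N * (g.mat 1 0) * x ^ 2 * j) *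
        ∑ r'', thetaMatrix N g r' r'' * jacobiVec N r'' τ (x * j)) := by
      intro r'
      rw [← actsBy_thetaMatrix N g r' τ, jacobiSlash, ← hj, mul_div_cancel_right₀ _ hj0]
      have h2 : e (N * (g.mat 1 0) * x ^ 2 * j) *
          e (-(N * (g.mat 1 0) * (x * j) ^ 2 / j)) = 1 := by
        rw [← e_add, ← e_zero]
        congr 1
        field_simp
        ring
      have h3 := Mp2Z.root_ne_zero g τ
      have h3' := mul_inv_cancel₀ h3
      linear_combination (-jacobiVec N r' (g.mat • τ) x * (g.root τ * (g.root τ)⁻¹)) * h2 -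
        jacobiVec N r' (g.mat • τ) x * h3'
    have h4 : thetaMatrix N g⁻¹ * thetaMatrix N g = 1 := by
      rw [← thetaMatrix_mul, inv_mul_cancel, thetaMatrix_one]
    have h5 : ∑ r', thetaMatrix N g⁻¹ r r' *
        ∑ r'', thetaMatrix N g r' r'' * jacobiVec N r'' τ (x * j) = jacobiVec N r τ (x * j) := by
      simp_rw [Finset.mul_sum, ← mul_assoc]
      rw [Finset.sum_comm]
      simp_rw [← Finset.sum_mul, ← Matrix.mul_apply, h4]
      simp [Matrix.one_apply]
    have h6 : ∑ r', thetaMatrix N g⁻¹ r r' * jacobiVec N r' (g.mat • τ) x =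
        g.root τ * (e (N * (g.mat 1 0) * x ^ 2 * j) * jacobiVec N r τ (x * j)) := by
      rw [← h5, Finset.mul_sum, Finset.mul_sum]
      refine Finset.sum_congr rfl fun r' _ => ?_
      rw [h1 r']
      ring
    rw [h6, inv_mul_cancel_left₀ (Mp2Z.root_ne_zero g τ)]
  simp_rw [hpt]
  have hint : ∫ x in (0 : ℝ)..1, ((g.root τ)⁻¹ *
      ∑ r', thetaMatrix N g⁻¹ r r' * jacobiVec N r' (g.mat • τ) x) =
      (g.root τ)⁻¹ * thetaMatrix N g⁻¹ r 0 := by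
    rw [intervalIntegral.integral_const_mul, intervalIntegral.integral_finsetSum]
    · congr 1
      have h0 : ∀ r', ∫ x in (0 : ℝ)..1, jacobiVec N r' (g.mat • τ) x =
          if r' = 0 then 1 else 0 := by
        intro r'
        have := integral_jacobiVec N r' 0 (g.mat • τ)
        simp only [ZMod.val_zero, Nat.cast_zero, zero_mul, neg_zero, e_zero, mul_one] at this
        rw [this]
        split_ifs with h
        · simp [h, e_zero]
        · rfl
      simp_rw [intervalIntegral.integral_const_mul, h0]
      simp
    · intro i _
      exact (continuous_const.mul (continuous_jacobiVec N i _)).intervalIntegrable _ _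
  rw [weilRepresentation_apply, ← map_inv₀, ← map_mul, ← hint]
  rw [intervalIntegral.integral_of_le zero_le_one, intervalIntegral.integral_of_le zero_le_one,
    integral_conj]

end

section

/-! ### The theta kernel in coordinates -/

/-- The trace zero matrix with coordinates `(a, b, c)`; it lies in `L` if these are integers. -/
def latMat (N : ℕ) (a b c : ℝ) : Matrix (Fin 2) (Fin 2) ℝ := !![b, -a / N; c, -b]

/-- The linear form `a - 2 N b x + N c |z|²`, proportional to `(w, w(z))`. -/
def linForm (N : ℕ) (z : ℍ) (a b c : ℝ) : ℝ :=
  a - 2 * N * b * z.re + N * c * (z.re ^ 2 + z.im ^ 2)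

/-- The square `v / N y²` of the frequency of the theta kernel in the variable `a`. -/
def freq (N : ℕ) (τ z : ℍ) : ℝ := τ.im / (N * z.im ^ 2)

variable (N : ℕ) [NeZero N]

theorem bil_latMat_vec_sq (z : ℍ) (a b c : ℝ) :
    bil N (latMat N a b c) (vec N z) ^ 2 = linForm N z a b c ^ 2 / (N * z.im ^ 2) := by
  have hN := natCast_pos N
  have hs : Real.sqrt N ≠ 0 := (Real.sqrt_pos.mpr hN).ne'
  have hs2 : Real.sqrt N ^ 2 = N := Real.sq_sqrt hN.le
  have hy := z.im_ne_zero
  have h : bil N (latMat N a b c) (vec N z) = -(linForm N z a b c / (Real.sqrt N * z.im)) := by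
    simp [bil_eq, vec, latMat, linForm, Complex.normSq_apply]
    field_simp
    ring
  rw [h, neg_sq, div_pow, mul_pow, hs2]

theorem Q_latMat (a b c : ℝ) : Q N (latMat N a b c) = a * c - N * b ^ 2 := by
  have hN := (natCast_pos N).ne'
  simp [Q, latMat, Matrix.det_fin_two]
  field_simp
  ring

theorem freq_pos (τ z : ℍ) : 0 < freq N τ z := by
  have hN := natCast_pos N
  have := τ.im_pos
  have := z.im_pos
  unfold freq
  positivity

theorem mul_cexp_mul_cexp (A x y : ℂ) :
    A * Complex.exp x * Complex.exp y = A * Complex.exp (x + y) := by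
  rw [mul_assoc, ← Complex.exp_add]

/-- The Gaussian of `φ⁰` contains the factor `exp(4 π v Q(w))`, which turns `e(Q(w) τ)` into
`e(Q(w) τ̄)` and leaves a Gaussian in the linear form alone. -/
theorem phi_latMat (τ z : ℍ) (a b c : ℝ) :
    phi N (latMat N a b c) τ z =
      ((freq N τ z * linForm N z a b c ^ 2 - 1 / (2 * Real.pi) : ℝ) : ℂ) *
        Complex.exp (-Real.pi * freq N τ z * linForm N z a b c ^ 2) *
        e ((a * c - N * b ^ 2 : ℝ) * (starRingEnd ℂ) (τ : ℂ)) := by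
  have hv := τ.im_pos
  have h1 : ∀ w, bil N (Real.sqrt τ.im • w) (vec N z) ^ 2 = τ.im * bil N w (vec N z) ^ 2 := by
    intro w
    have : bil N (Real.sqrt τ.im • w) (vec N z) = Real.sqrt τ.im * bil N w (vec N z) := by
      simp only [bil_eq, Matrix.smul_apply, smul_eq_mul]; ring
    rw [this, mul_pow, Real.sq_sqrt hv.le]
  have h2 : ∀ w, bil N (Real.sqrt τ.im • w) (Real.sqrt τ.im • w) = τ.im * (2 * Q N w) := by
    intro w
    have h3 : Real.sqrt τ.im ^ 2 = τ.im := Real.sq_sqrt hv.le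
    simp only [bil_eq, Q, Matrix.det_fin_two, Matrix.smul_apply, smul_eq_mul]
    linear_combination (2 * N * (w 0 0 * w 1 1 - w 0 1 * w 1 0)) * h3
  have h3 : τ.im * (linForm N z a b c ^ 2 / (N * z.im ^ 2)) =
      freq N τ z * linForm N z a b c ^ 2 := by
    unfold freq; ring
  rw [phi, phi0, R_eq, h1, h2, bil_latMat_vec_sq, Q_latMat, h3]
  have hconj : (starRingEnd ℂ) (τ : ℂ) = τ - 2 * Complex.I * τ.im := by
    apply Complex.ext <;> simp
    ring
  rw [hconj, e, e]
  push_cast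
  rw [mul_left_comm, ← Complex.exp_add, mul_cexp_mul_cexp]
  congr 2
  have hI := Complex.I_sq
  linear_combination (4 * Real.pi * τ.im * (a * c - N * b ^ 2)) * hI

/-- A Gaussian bound from the positive definite majorant of the quadratic form. The three squares
are triangular in the coordinates, so that one can sum over `a`, then over `b`, then over `c`. -/
theorem norm_phi_latMat_le (τ z : ℍ) (a b c : ℝ) :
    ‖phi N (latMat N a b c) τ z‖ ≤
      2 * (Real.exp (-(Real.pi / 2 * τ.im * N * z.im ^ 2) * c ^ 2) *
        (Real.exp (-(2 * Real.pi * τ.im * N) * (b - c * z.re) ^ 2) *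
        Real.exp (-(Real.pi / 2 * freq N τ z) *
          (a - 2 * N * b * z.re + N * c * z.re ^ 2) ^ 2))) := by
  have hN := natCast_pos N
  have hv := τ.im_pos
  have hy := z.im_pos
  have hpi := Real.pi_gt_three
  have hf := freq_pos N τ z
  set a' : ℝ := a - 2 * N * b * z.re + N * c * z.re ^ 2 with ha'
  set X : ℝ := freq N τ z * a' ^ 2 + τ.im * N * z.im ^ 2 * c ^ 2 with hX
  set Y : ℝ := 2 * τ.im * N * (b - c * z.re) ^ 2 with hY
  have hX0 : 0 ≤ X := by positivity
  have hY0 : 0 ≤ Y := by positivity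
  have hlin : linForm N z a b c = a' + N * c * z.im ^ 2 := by
    simp only [linForm, ha']; ring
  have hfy : freq N τ z * (N * z.im ^ 2) = τ.im := by
    unfold freq; field_simp
  have hsq : freq N τ z * linForm N z a b c ^ 2 =
      X + 2 * τ.im * (a * c - N * b ^ 2) + Y := by
    rw [hlin, hX, hY]
    have : a * c - N * b ^ 2 = a' * c - N * (b - c * z.re) ^ 2 := by rw [ha']; ring
    rw [this]
    linear_combination (2 * a' * c + N * c ^ 2 * z.im ^ 2) * hfy
  have hle : freq N τ z * linForm N z a b c ^ 2 ≤ 2 * X := by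
    have : 2 * X - freq N τ z * linForm N z a b c ^ 2 =
        freq N τ z * (a' - N * c * z.im ^ 2) ^ 2 := by
      rw [hlin, hX]
      linear_combination (-2 * N * c ^ 2 * z.im ^ 2) * hfy
    have h0 : 0 ≤ freq N τ z * (a' - N * c * z.im ^ 2) ^ 2 := by positivity
    linarith
  have hnn : 0 ≤ freq N τ z * linForm N z a b c ^ 2 := by positivity
  rw [phi_latMat, norm_mul, norm_mul, Complex.norm_real, Complex.norm_exp, norm_e, mul_assoc,
    ← Real.exp_add]
  have e1 : (-(Real.pi : ℂ) * freq N τ z * linForm N z a b c ^ 2).re =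
      -Real.pi * (freq N τ z * linForm N z a b c ^ 2) := by
    rw [← Complex.ofReal_pow, ← Complex.ofReal_neg, ← Complex.ofReal_mul, ← Complex.ofReal_mul,
      Complex.ofReal_re]
    ring
  have e2 : (((a * c - N * b ^ 2 : ℝ) : ℂ) * (starRingEnd ℂ) (τ : ℂ)).im =
      -(a * c - N * b ^ 2) * τ.im := by
    rw [Complex.im_ofReal_mul]; simp; ring
  rw [e1, e2, hsq, ← Real.exp_add, ← Real.exp_add]
  -- half of the decay in `X` absorbs the polynomial factor
  have hpre : ‖(X + 2 * τ.im * (a * c - N * b ^ 2) + Y - 1 / (2 * Real.pi))‖ ≤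
      2 * Real.exp (Real.pi / 2 * X) := by
    rw [← hsq, Real.norm_eq_abs]
    have h4 : X + 1 ≤ Real.exp X := Real.add_one_le_exp X
    have h5 : Real.exp X ≤ Real.exp (Real.pi / 2 * X) := by
      rw [Real.exp_le_exp]; nlinarith
    have h6 : 1 / (2 * Real.pi) ≤ 1 := by
      rw [div_le_one (by positivity)]; linarith
    have h7 : 0 < 1 / (2 * Real.pi) := by positivity
    rw [abs_le]
    constructor <;> linarith
  refine (mul_le_mul_of_nonneg_right hpre (Real.exp_pos _).le).trans (le_of_eq ?_)
  rw [mul_assoc, ← Real.exp_add]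
  congr 2
  rw [hX, hY]
  ring

/-- Absolute convergence of the theta kernel over the lattice and its translates in the
coordinate `b`. -/
theorem summable_phi_latMat (τ z : ℍ) (b₀ : ℝ) :
    Summable fun p : ℤ × ℤ × ℤ => phi N (latMat N p.2.2 (p.2.1 + b₀) p.1) τ z := by
  have hN := natCast_pos N
  have hv := τ.im_pos
  have hy := z.im_pos
  have hpi := Real.pi_pos
  have hf := freq_pos N τ z
  refine Summable.of_norm ?_
  set P := Real.pi / 2 * τ.im * N * z.im ^ 2
  set P' := 2 * Real.pi * τ.im * N
  set P'' := Real.pi / 2 * freq N τ z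
  obtain ⟨C', hC', hb⟩ := exists_tsum_gaussian_le (A := P') (by positivity)
  obtain ⟨C'', hC'', ha⟩ := exists_tsum_gaussian_le (A := P'') (by positivity)
  have hw : ∀ c : ℤ, Summable (fun q : ℤ × ℤ =>
      Real.exp (-P' * ((q.1 + b₀) - c * z.re) ^ 2) *
        Real.exp (-P'' * (q.2 - 2 * N * (q.1 + b₀) * z.re + N * c * z.re ^ 2) ^ 2)) ∧
      ∑' q : ℤ × ℤ, Real.exp (-P' * ((q.1 + b₀) - c * z.re) ^ 2) *
        Real.exp (-P'' * (q.2 - 2 * N * (q.1 + b₀) * z.re + N * c * z.re ^ 2) ^ 2) ≤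
          C'' * C' := by
    intro c
    obtain ⟨hs, hle⟩ := hb (b₀ - c * z.re)
    have h := summable_prod_of_bounded (F := fun q : ℤ × ℤ =>
      Real.exp (-P' * ((q.1 + b₀) - c * z.re) ^ 2) *
        Real.exp (-P'' * (q.2 - 2 * N * (q.1 + b₀) * z.re + N * c * z.re ^ 2) ^ 2))
      (w := fun i j : ℤ =>
        Real.exp (-P'' * (j + (-(2 * N * (i + b₀) * z.re) + N * c * z.re ^ 2)) ^ 2))
      (C := C'') hs (fun _ => (Real.exp_pos _).le)
      (fun _ => mul_nonneg (Real.exp_pos _).le (Real.exp_pos _).le)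
      (fun i j => by
        refine le_of_eq ?_
        simp only
        congr 2 <;> ring)
      (fun i => (ha _).1) (fun i => (ha _).2)
    refine ⟨h.1, ?_⟩
    rw [h.1.tsum_prod]
    refine (Summable.tsum_le_tsum h.2 ?_ (hs.mul_left _)).trans ?_
    · exact Summable.of_nonneg_of_le (fun i => tsum_nonneg fun _ =>
        mul_nonneg (Real.exp_pos _).le (Real.exp_pos _).le) h.2 (hs.mul_left _)
    · rw [tsum_mul_left]
      gcongr
  have hc : Summable fun c : ℤ => 2 * Real.exp (-P * (c : ℝ) ^ 2) := by
    have := summable_exp_quadratic (A := P) (by positivity) 0 0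
    simpa using this.mul_left 2
  refine (summable_prod_of_bounded hc (fun _ => by positivity) (fun _ => norm_nonneg _)
    (fun c q => ?_) (fun c => (hw c).1) (fun c => (hw c).2)).1
  refine (norm_phi_latMat_le N τ z _ _ _).trans (le_of_eq ?_)
  ring

/-! ### Poisson summation in the theta kernel -/

/-- The terms of the theta kernel after Poisson summation in the coordinate `a`, up to the factor
`-freq ^ (-3/2)`. They are Gaussians in `|c τ + n|`, with the factor `(c τ̄ + n)²`. -/
def dualTerm (N : ℕ) (τ z : ℍ) (b c : ℝ) (n : ℤ) : ℂ :=
  (c * (starRingEnd ℂ) (τ : ℂ) + n) ^ 2 *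
    Real.exp (-(Real.pi * ‖(c * τ + n : ℂ)‖ ^ 2 / freq N τ z)) *
    e (-N * b ^ 2 * (starRingEnd ℂ) (τ : ℂ) +
      (2 * N * b * z.re - N * c * z.re ^ 2) * (c * (starRingEnd ℂ) (τ : ℂ) + n))

theorem norm_dualTerm (N : ℕ) (τ z : ℍ) (b c : ℝ) (n : ℤ) :
    ‖dualTerm N τ z b c n‖ = ‖(c * τ + n : ℂ)‖ ^ 2 *
      Real.exp (-(Real.pi * ‖(c * τ + n : ℂ)‖ ^ 2 / freq N τ z)) *
      Real.exp (-(2 * Real.pi * N * τ.im) * (b - c * z.re) ^ 2) := by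
  have h1 : (c * (starRingEnd ℂ) (τ : ℂ) + n : ℂ) = (starRingEnd ℂ) (c * τ + n : ℂ) := by simp
  rw [dualTerm, norm_mul, norm_mul, norm_pow, h1, RCLike.norm_conj, Complex.norm_real,
    Real.norm_eq_abs, abs_of_pos (Real.exp_pos _), norm_e]
  congr 2
  have : (-N * b ^ 2 * (starRingEnd ℂ) (τ : ℂ) +
      (2 * N * b * z.re - N * c * z.re ^ 2) * (starRingEnd ℂ) (c * τ + n : ℂ) : ℂ).im =
      N * τ.im * (b - c * z.re) ^ 2 := by
    have e1 : (-N * b ^ 2 : ℂ) = ((-N * b ^ 2 : ℝ) : ℂ) := by push_cast; rfl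
    have e2 : (2 * N * b * z.re - N * c * z.re ^ 2 : ℂ) =
      ((2 * N * b * z.re - N * c * z.re ^ 2 : ℝ) : ℂ) := by push_cast; rfl
    rw [e1, e2, Complex.add_im, Complex.im_ofReal_mul, Complex.im_ofReal_mul]
    simp
    ring
  rw [this]
  ring

theorem hasSum_phi_latMat (τ z : ℍ) (β b c : ℝ) :
    Summable (fun n : ℤ => dualTerm N τ z b c n) ∧
    HasSum (fun l : ℤ => phi N (latMat N (l + β) b c) τ z)
      (-((freq N τ z * Real.sqrt (freq N τ z) : ℝ) : ℂ)⁻¹ *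
        ∑' n : ℤ, e (-n * β) * dualTerm N τ z b c n) := by
  have hf := freq_pos N τ z
  have hv := τ.im_ne_zero
  have hy := z.im_ne_zero
  have hN := (natCast_pos N).ne'
  set κ := freq N τ z with hκ
  set α : ℝ := linForm N z 0 b c with hα
  set σ : ℂ := (starRingEnd ℂ) (τ : ℂ) with hσ
  have hI := Complex.I_sq
  have hκ0 : (κ : ℂ) ≠ 0 := by exact_mod_cast hf.ne'
  have hpi : (Real.pi : ℂ) ≠ 0 := by exact_mod_cast Real.pi_ne_zero
  have hlin : ∀ a, linForm N z a b c = a + α := by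
    intro a; simp only [hα, linForm]; ring
  obtain ⟨hs, hS⟩ := hasSum_gaussian_shift_sq (a := κ) (by simpa using hf) (Complex.I * c * σ)
    (β + α)
  -- the summands on both sides
  have hdual : ∀ n : ℤ, ((((-n : ℤ) : ℂ) + Complex.I * (Complex.I * c * σ)) ^ 2 *
      Complex.exp (2 * Real.pi * Complex.I * ((-n : ℤ) : ℂ) * (β + α) +
        -Real.pi / κ * (((-n : ℤ) : ℂ) + Complex.I * (Complex.I * c * σ)) ^ 2)) *
      e (-(α * c * σ) - N * b ^ 2 * σ) = e (-n * β) * dualTerm N τ z b c n := by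
    intro n
    have h1 : (((-n : ℤ) : ℂ) + Complex.I * (Complex.I * c * σ)) = -(c * σ + n) := by
      push_cast
      linear_combination (c * σ) * hI
    have hnorm : ((‖(c * τ + n : ℂ)‖ ^ 2 : ℝ) : ℂ) = (c * τ + n) * (c * σ + n) := by
      rw [← Complex.normSq_eq_norm_sq, ← Complex.mul_conj]
      simp [hσ]
    have hστ : (τ : ℂ) = σ + 2 * Complex.I * τ.im := by
      apply Complex.ext <;> simp [hσ]
      ring
    rw [h1, neg_sq, dualTerm, ← hσ, ← hκ, e, e, e, Complex.ofReal_exp,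
      mul_cexp_mul_cexp, mul_cexp_mul_cexp, mul_left_comm, ← Complex.exp_add]
    congr 2
    have hα' : (α : ℂ) = -2 * N * b * z.re + N * c * (z.re ^ 2 + z.im ^ 2) := by
      rw [hα, linForm]; push_cast; ring
    have hκy : (τ.im : ℂ) / κ = N * z.im ^ 2 := by
      rw [hκ, freq]
      have hv' : (τ.im : ℂ) ≠ 0 := by exact_mod_cast hv
      have hy' : (z.im : ℂ) ≠ 0 := by exact_mod_cast hy
      have hN' := natCast_ne_zero N
      push_cast
      field_simp
    have hpush : ((-(Real.pi * ‖(c * τ + n : ℂ)‖ ^ 2 / κ) : ℝ) : ℂ) =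
        -(Real.pi * ((c * τ + n) * (c * σ + n)) / κ) := by
      rw [← hnorm]; push_cast; rfl
    rw [hpush, hα', hστ]
    push_cast
    have hk2 : ∀ X : ℂ, Real.pi * X / κ = Real.pi * X * (1 / κ) := fun X => by ring
    have hk3 : (τ.im : ℂ) * (1 / κ) = N * z.im ^ 2 := by rw [← hκy]; ring
    linear_combination (2 * Real.pi * Complex.I * c * (c * σ + n)) * hk3
  have hdsum : Summable fun n : ℤ => e (-n * β) * dualTerm N τ z b c n := by
    have := ((Equiv.neg ℤ).summable_iff.mpr hs).mul_right (e (-(α * c * σ) - N * b ^ 2 * σ))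
    refine this.congr fun n => ?_
    exact hdual n
  refine ⟨?_, ?_⟩
  · refine Summable.of_norm (hdsum.norm.congr fun n => ?_)
    rw [norm_mul, norm_e_real (by simp), one_mul]
  · refine hasSum_of_eq ((hS.mul_left (κ : ℂ)).mul_right (e (-(α * c * σ) - N * b ^ 2 * σ)))
      (fun l => ?_) ?_
    · rw [phi_latMat, hlin, ← hκ, ← hσ, e, e, mul_cexp_mul_cexp, ← mul_assoc (κ : ℂ),
        mul_cexp_mul_cexp]
      congr 1
      · push_cast
        field_simp
        ring
      · congr 1
        push_cast
        ring
    · have hneg := (Equiv.neg ℤ).tsum_eq (fun n : ℤ =>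
        ((n : ℂ) + Complex.I * (Complex.I * c * σ)) ^ 2 *
          Complex.exp (2 * Real.pi * Complex.I * (n : ℂ) * (β + α) +
          -Real.pi / κ * ((n : ℂ) + Complex.I * (Complex.I * c * σ)) ^ 2))
      simp only [Equiv.neg_apply] at hneg
      simp_rw [← hdual]
      rw [tsum_mul_right, hneg, ← mul_assoc, ← mul_assoc (κ : ℂ)]
      congr 2
      have hsq : (κ : ℂ) ^ (1 / 2 : ℂ) = (Real.sqrt κ : ℂ) := by
        rw [Real.sqrt_eq_rpow, Complex.ofReal_cpow hf.le]; push_cast; rfl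
      have hs0 : (Real.sqrt κ : ℂ) ≠ 0 := by exact_mod_cast (Real.sqrt_pos.mpr hf).ne'
      rw [hsq]
      push_cast
      field_simp

/-! ### Transformation behaviour of the theta kernel in `z` -/

theorem vec_smul {g : GL (Fin 2) ℝ} (hg : 0 < g.det.val) (z : ℍ) :
    vec N (g • z) = g.val * vec N z * (g⁻¹).val := by
  have hN := natCast_pos N
  have hs : Real.sqrt N ≠ 0 := (Real.sqrt_pos.mpr hN).ne'
  have hy := z.im_ne_zero
  have hdet : g.det.val = g 0 0 * g 1 1 - g 0 1 * g 1 0 := by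
    rw [Matrix.GeneralLinearGroup.val_det_apply, Matrix.det_fin_two]
  have hj := UpperHalfPlane.denom_ne_zero g z
  have hcoe := UpperHalfPlane.coe_smul_of_det_pos hg z
  set J := Complex.normSq (UpperHalfPlane.denom g z) with hJ
  have hJ0 : J ≠ 0 := fun h => hj (Complex.normSq_eq_zero.mp h)
  have hJe : J = (g 1 0 * z.re + g 1 1) ^ 2 + (g 1 0 * z.im) ^ 2 := by
    rw [hJ, UpperHalfPlane.denom, Complex.normSq_apply]; simp; ring
  have him : (g • z).im = g.det.val * z.im / J := by
    rw [UpperHalfPlane.im_smul_eq_div_normSq, abs_of_pos hg]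
  have hre : (g • z).re = ((g 0 0 * z.re + g 0 1) * (g 1 0 * z.re + g 1 1) +
      g 0 0 * g 1 0 * z.im ^ 2) / J := by
    rw [← UpperHalfPlane.coe_re, hcoe, Complex.div_re, ← hJ, UpperHalfPlane.num,
      UpperHalfPlane.denom]
    simp
    ring
  have hnorm : Complex.normSq (g • z : ℍ) = ((g 0 0 * z.re + g 0 1) ^ 2 +
      (g 0 0 * z.im) ^ 2) / J := by
    rw [hcoe, Complex.normSq_div, ← hJ, UpperHalfPlane.num, Complex.normSq_apply]
    simp
    ring
  have hnz : Complex.normSq (z : ℂ) = z.re ^ 2 + z.im ^ 2 := by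
    rw [Complex.normSq_apply]; simp; ring
  have hd0 := hg.ne'
  have key : vec N (g • z) * g.val = g.val * vec N z := by
    simp only [vec]
    rw [him, hre, hnorm, hnz]
    rw [hdet] at hd0 ⊢
    ext i j
    fin_cases i <;> fin_cases j <;>
      simp [Matrix.mul_apply, Fin.sum_univ_two] <;> field_simp <;> (try rw [hJe]) <;> ring
  rw [← key, mul_assoc]
  simp

theorem Q_conj (N : ℕ) (g : GL (Fin 2) ℝ) (w : Matrix (Fin 2) (Fin 2) ℝ) :
    Q N (g.val * w * (g⁻¹).val) = Q N w := by
  rw [Q, Q, Matrix.det_mul, Matrix.det_mul, mul_right_comm, ← Matrix.det_mul]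
  simp

theorem bil_conj (N : ℕ) (g : GL (Fin 2) ℝ) (w w' : Matrix (Fin 2) (Fin 2) ℝ) :
    bil N (g.val * w * (g⁻¹).val) (g.val * w' * (g⁻¹).val) = bil N w w' := by
  rw [bil, ← Matrix.add_mul, ← Matrix.mul_add, Q_conj, Q_conj, Q_conj, bil]

theorem phi_conj {g : GL (Fin 2) ℝ} (hg : 0 < g.det.val) (w : Matrix (Fin 2) (Fin 2) ℝ)
    (τ z : ℍ) : phi N (g.val * w * (g⁻¹).val) τ (g • z) = phi N w τ z := by
  have h1 : Real.sqrt τ.im • (g.val * w * (g⁻¹).val) =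
      g.val * (Real.sqrt τ.im • w) * (g⁻¹).val := by
    rw [Matrix.mul_smul, Matrix.smul_mul]
  rw [phi, phi, Q_conj, phi0, phi0, R_eq, R_eq, h1, vec_smul N hg, bil_conj, bil_conj]

theorem phi_neg (w : Matrix (Fin 2) (Fin 2) ℝ) (τ z : ℍ) : phi N (-w) τ z = phi N w τ z := by
  have h1 : ∀ w w', bil N (-w) w' = -bil N w w' := fun w w' => by
    simp only [bil_eq, Matrix.neg_apply]; ring
  have h2 : ∀ w w', bil N w (-w') = -bil N w w' := fun w w' => by
    simp only [bil_eq, Matrix.neg_apply]; ring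
  have h3 : Q N (-w) = Q N w := by
    simp only [Q, Matrix.det_fin_two, Matrix.neg_apply]; ring
  rw [phi, phi, phi0, phi0, R_eq, R_eq, smul_neg, h1, h1, h2, h3]
  simp

/-- Scaling the lattice vector amounts to scaling `τ`. -/
theorem phi_smul (N : ℕ) {t : ℝ} (ht : 0 < t) (w : Matrix (Fin 2) (Fin 2) ℝ) {τ τ' : ℍ}
    (hτ : (τ' : ℂ) = t ^ 2 * τ) (z : ℍ) : phi N (t • w) τ z = phi N w τ' z := by
  have him : τ'.im = t ^ 2 * τ.im := by
    have := congrArg Complex.im hτ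
    rw [← Complex.ofReal_pow, Complex.im_ofReal_mul] at this
    simpa using this
  have h1 : Real.sqrt τ'.im = Real.sqrt τ.im * t := by
    rw [him, Real.sqrt_mul (by positivity), Real.sqrt_sq ht.le, mul_comm]
  have h2 : Q N (t • w) = t ^ 2 * Q N w := by
    simp only [Q, Matrix.det_fin_two, Matrix.smul_apply, smul_eq_mul]; ring
  rw [phi, phi, h1, h2, hτ, smul_smul]
  congr 2
  push_cast
  ring

theorem mem_coset_iff (r : ZMod (2 * N)) (w : Matrix (Fin 2) (Fin 2) ℝ) :
    w ∈ coset N r ↔ ∃ a b c : ℤ, w = latMat N a (b + r.val / (2 * N)) c := by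
  have hN := (natCast_pos N).ne'
  constructor
  · rintro ⟨a, b, c, h⟩
    refine ⟨a, b, c, ?_⟩
    rw [sub_eq_iff_eq_add] at h
    rw [h]
    ext i j; fin_cases i <;> fin_cases j <;> simp [latMat, mu, -ZMod.natCast_val]
    ring
  · rintro ⟨a, b, c, rfl⟩
    refine ⟨a, b, c, ?_⟩
    ext i j; fin_cases i <;> fin_cases j <;> simp [latMat, mu, -ZMod.natCast_val]

theorem latMat_injective {a b c a' b' c' : ℝ} (h : latMat N a b c = latMat N a' b' c') :
    a = a' ∧ b = b' ∧ c = c' := by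
  have hN := (natCast_pos N).ne'
  have h0 := congrFun (congrFun h 0) 0
  have h1 := congrFun (congrFun h 0) 1
  have h2 := congrFun (congrFun h 1) 0
  simp [latMat] at h0 h1 h2
  refine ⟨?_, h0, h2⟩
  field_simp at h1
  linarith

/-- The coordinates of the coset `μ_r + L`. -/
def cosetEquiv (r : ZMod (2 * N)) : ℤ × ℤ × ℤ ≃ coset N r :=
  Equiv.ofBijective (fun p => ⟨latMat N p.2.2 (p.2.1 + r.val / (2 * N)) p.1,
    (mem_coset_iff N r _).mpr ⟨_, _, _, rfl⟩⟩) (by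
      constructor
      · rintro ⟨c, b, a⟩ ⟨c', b', a'⟩ h
        obtain ⟨h1, h2, h3⟩ := latMat_injective N (Subtype.ext_iff.mp h)
        simp only [add_left_inj, Int.cast_inj] at h1 h2 h3
        rw [h1, h2, h3]
      · rintro ⟨w, hw⟩
        obtain ⟨a, b, c, rfl⟩ := (mem_coset_iff N r w).mp hw
        exact ⟨(c, b, a), rfl⟩)

theorem summable_phi (τ z : ℍ) (r : ZMod (2 * N)) :
    Summable (fun w : coset N r => phi N (w : Matrix (Fin 2) (Fin 2) ℝ) τ z) :=
  (cosetEquiv N r).summable_iff.mp (summable_phi_latMat N τ z (r.val / (2 * N)))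

theorem theta_eq_tsum (τ z : ℍ) (r : ZMod (2 * N)) :
    theta N τ z r = ∑' p : ℤ × ℤ × ℤ, phi N (latMat N p.2.2 (p.2.1 + r.val / (2 * N)) p.1) τ z :=
  ((cosetEquiv N r).tsum_eq fun w : coset N r =>
    phi N (w : Matrix (Fin 2) (Fin 2) ℝ) τ z).symm

theorem theta_smul {g : GL (Fin 2) ℝ} (hg : 0 < g.det.val) (τ z : ℍ) (r : ZMod (2 * N)) :
    theta N τ (g • z) r = ∑' w : coset N r, phi N ((g⁻¹).val * w.val * g.val) τ z := by
  rw [theta]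
  congr 1
  funext w
  rw [← phi_conj N hg ((g⁻¹).val * w.val * g.val)]
  congr 1
  have hgg : g.val * (g⁻¹).val = 1 := by simp
  calc w.val = (g.val * (g⁻¹).val) * w.val * (g.val * (g⁻¹).val) := by
        rw [hgg, one_mul, mul_one]
    _ = _ := by simp only [mul_assoc]

/-- The theta kernel is invariant under substitutions which preserve the coset up to sign. -/
theorem theta_smul_of_mem {g : GL (Fin 2) ℝ} (hg : 0 < g.det.val) (τ z : ℍ) (r : ZMod (2 * N))
    {ε : ℝ} (hε : ε = 1 ∨ ε = -1)
    (h1 : ∀ w ∈ coset N r, ε • ((g⁻¹).val * w * g.val) ∈ coset N r)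
    (h2 : ∀ w ∈ coset N r, ε • (g.val * w * (g⁻¹).val) ∈ coset N r) :
    theta N τ (g • z) r = theta N τ z r := by
  have hεε : ε * ε = 1 := by rcases hε with rfl | rfl <;> norm_num
  have hgg : g.val * (g⁻¹).val = 1 := by simp
  have hgg' : (g⁻¹).val * g.val = 1 := by simp
  let E : coset N r ≃ coset N r :=
    { toFun := fun w => ⟨_, h1 w w.2⟩
      invFun := fun w => ⟨_, h2 w w.2⟩
      left_inv := fun w => Subtype.ext (by
        simp only [Matrix.mul_smul, Matrix.smul_mul, smul_smul, hεε, one_smul]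
        calc g.val * ((g⁻¹).val * w.val * g.val) * (g⁻¹).val
            = (g.val * (g⁻¹).val) * w.val * (g.val * (g⁻¹).val) := by simp only [mul_assoc]
          _ = w.val := by rw [hgg, one_mul, mul_one])
      right_inv := fun w => Subtype.ext (by
        simp only [Matrix.mul_smul, Matrix.smul_mul, smul_smul, hεε, one_smul]
        calc (g⁻¹).val * (g.val * w.val * (g⁻¹).val) * g.val
            = ((g⁻¹).val * g.val) * w.val * ((g⁻¹).val * g.val) := by simp only [mul_assoc]
          _ = w.val := by rw [hgg', one_mul, mul_one]) }
  rw [theta_smul N hg, theta, ← E.tsum_eq (fun w : coset N r => phi N w.val τ z)]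
  congr 1
  funext w
  rcases hε with h | h
  · simp [E, h]
  · simp only [E, h, Equiv.coe_fn_mk, neg_smul, one_smul]
    rw [phi_neg]

theorem SL_det_pos (γ : SL(2, ℤ)) : 0 < (γ : GL (Fin 2) ℝ).det.val := by
  simp

/-- `Γ₀(N)` acts trivially on `L♯ / L`. -/
theorem coset_conj_mem {γ : SL(2, ℤ)} (hγ : γ ∈ CongruenceSubgroup.Gamma0 N) (r : ZMod (2 * N))
    {w : Matrix (Fin 2) (Fin 2) ℝ} (hw : w ∈ coset N r) :
    (γ : GL (Fin 2) ℝ).val * w * ((γ : GL (Fin 2) ℝ)⁻¹).val ∈ coset N r := by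
  have hN := (natCast_pos N).ne'
  rw [mem_coset_iff] at hw ⊢
  obtain ⟨a, b, c, rfl⟩ := hw
  rw [CongruenceSubgroup.Gamma0_mem] at hγ
  obtain ⟨s, hs⟩ := (ZMod.intCast_zmod_eq_zero_iff_dvd _ N).mp hγ
  have hdet := γ.det_coe
  rw [Matrix.det_fin_two, hs] at hdet
  have hdet' : (γ 0 0 : ℝ) * γ 1 1 - (γ 0 1 : ℝ) * (N * s) = 1 := by exact_mod_cast hdet
  set p : ℝ := ((γ 0 0 : ℤ) : ℝ)
  set q : ℝ := ((γ 0 1 : ℤ) : ℝ)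
  set t : ℝ := ((γ 1 1 : ℤ) : ℝ)
  have hval : (γ : GL (Fin 2) ℝ).val = !![p, q; (N * s : ℝ), t] := by
    ext i j
    fin_cases i <;> fin_cases j <;> simp [p, q, t, hs]
  have hinv : ((γ : GL (Fin 2) ℝ)⁻¹).val = !![t, -q; -(N * s : ℝ), p] := by
    rw [Matrix.coe_units_inv, hval]
    refine Matrix.inv_eq_right_inv ?_
    ext i j
    fin_cases i <;> fin_cases j <;> simp [Matrix.mul_apply, Fin.sum_univ_two] <;>
      first | ring1 | linear_combination hdet'
  refine ⟨γ 0 0 ^ 2 * a + γ 0 0 * γ 0 1 * (2 * N * b + r.val) + N * γ 0 1 ^ 2 * c,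
    b + γ 0 1 * s * (2 * N * b + r.val) + γ 0 1 * c * γ 1 1 + γ 0 0 * a * s,
    s * γ 1 1 * (2 * N * b + r.val) + γ 1 1 ^ 2 * c + N * s ^ 2 * a, ?_⟩
  rw [hinv, hval]
  push_cast
  ext i j
  fin_cases i <;> fin_cases j <;>
    simp [latMat, Matrix.mul_apply, Fin.sum_univ_two, -ZMod.natCast_val, -Matrix.cons_mul] <;>
    field_simp
  all_goals simp only [p, q, t] at hdet' ⊢
  · linear_combination (2 * N * b + r.val) * hdet'
  · ring
  · ring
  · linear_combination (-(2 * N * b + r.val)) * hdet'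

theorem theta_gamma0 {γ : SL(2, ℤ)} (hγ : γ ∈ CongruenceSubgroup.Gamma0 N) (τ z : ℍ)
    (r : ZMod (2 * N)) : theta N τ (γ • z) r = theta N τ z r := by
  have h : ∀ γ ∈ CongruenceSubgroup.Gamma0 N, ∀ w ∈ coset N r, (1 : ℝ) •
      ((γ : GL (Fin 2) ℝ).val * w * ((γ : GL (Fin 2) ℝ)⁻¹).val) ∈ coset N r := fun γ hγ w hw => by
    rw [one_smul]; exact coset_conj_mem N hγ r hw
  refine theta_smul_of_mem N (SL_det_pos γ) τ z r (Or.inl rfl) (fun w hw => ?_) (h γ hγ)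
  have := h γ⁻¹ (inv_mem hγ) w hw
  simpa using this

theorem fricke_det_pos : 0 < (fricke N).det.val := by
  have := natCast_pos N
  rw [Matrix.GeneralLinearGroup.val_det_apply]
  simpa [fricke, Matrix.det_fin_two] using this

theorem fricke_val : (fricke N).val = !![0, -1; (N : ℝ), 0] := rfl

theorem fricke_inv_val : ((fricke N)⁻¹).val = !![0, 1 / (N : ℝ); -1, 0] := by
  have hN := (natCast_pos N).ne'
  rw [Matrix.coe_units_inv, fricke_val]
  refine Matrix.inv_eq_right_inv ?_
  ext i j
  fin_cases i <;> fin_cases j <;> simp [Matrix.mul_apply, Fin.sum_univ_two, hN]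

/-- The Fricke involution acts on `L♯ / L` by `-1`, and the kernel is even. -/
theorem theta_fricke (τ z : ℍ) (r : ZMod (2 * N)) :
    theta N τ (fricke N • z) r = theta N τ z r := by
  have hN := (natCast_pos N).ne'
  refine theta_smul_of_mem N (fricke_det_pos N) τ z r (Or.inr rfl) (fun w hw => ?_)
    (fun w hw => ?_)
  all_goals
    rw [mem_coset_iff] at hw ⊢
    obtain ⟨a, b, c, rfl⟩ := hw
    refine ⟨-c, b, -a, ?_⟩
    rw [fricke_val, fricke_inv_val]
    ext i j
    fin_cases i <;> fin_cases j <;>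
      (simp [latMat, -ZMod.natCast_val]; try field_simp) <;> (try ring)

/-! ### Decay of the theta kernel at the cusps -/

/-- After Poisson summation, the term with `c τ + n = 0` vanishes and the others are
exponentially small for large `y`; a power of `y` is enough here. -/
theorem exists_norm_tsum_dualTerm_le (τ : ℍ) {δ : ℝ} (hδ : 0 < δ) (m : ℕ) (hm : 3 ≤ m) :
    ∃ C : ℝ, 0 < C ∧ ∀ z : ℍ,
      Summable (fun p : (ℤ × ℤ) × ℤ => ‖dualTerm N τ z (δ * p.1.1) (δ * p.1.2) p.2‖) ∧
      ∑' p : (ℤ × ℤ) × ℤ, ‖dualTerm N τ z (δ * p.1.1) (δ * p.1.2) p.2‖ ≤ C * freq N τ z ^ m := by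
  obtain ⟨C, hC0, hC⟩ := exists_tsum_gaussian_le (A := 2 * Real.pi * N * τ.im * δ ^ 2)
    (by have := natCast_pos N; have := τ.im_pos; positivity)
  let τ' : ℍ := ⟨δ * τ, by simpa using mul_pos hδ τ.im_pos⟩
  let X : ℤ × ℤ → ℝ := fun i => ‖((δ * i.1 : ℝ) : ℂ) * τ + i.2‖
  -- an Eisenstein series of weight `2 m - 2` at the point `δ τ`
  have hX : Summable fun i => X i ^ 2 * ((X i ^ 2) ^ m)⁻¹ := by
    have h := (finTwoArrowEquiv ℤ).symm.summable_iff.mpr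
      (EisensteinSeries.summable_norm_eisSummand (k := 2 * m - 2) (by omega) τ')
    refine h.congr fun i => ?_
    have e1 : ‖(i.1 : ℂ) * (τ' : ℂ) + i.2‖ = X i := by
      simp only [X]; congr 2; simp only [τ']; push_cast; ring
    simp only [Function.comp, EisensteinSeries.eisSummand, finTwoArrowEquiv_symm_apply,
      Matrix.cons_val_zero, Matrix.cons_val_one, norm_zpow, e1]
    rcases eq_or_ne (X i) 0 with h0 | h0
    · rw [h0, zero_zpow _ (by omega)]; simp
    · rw [show -(2 * (m : ℤ) - 2) = ((2 : ℕ) : ℤ) - ((2 * m : ℕ) : ℤ) by push_cast; ring,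
        zpow_sub₀ h0, zpow_natCast, zpow_natCast, pow_mul, div_eq_mul_inv]
  refine ⟨C * (m.factorial * (1 + ∑' i, X i ^ 2 * ((X i ^ 2) ^ m)⁻¹)), by
    have : 0 ≤ ∑' i, X i ^ 2 * ((X i ^ 2) ^ m)⁻¹ := tsum_nonneg fun i => by positivity
    positivity, fun z => ?_⟩
  have hF := freq_pos N τ z
  have key := summable_prod_of_bounded
    (u := fun i => m.factorial * freq N τ z ^ m * (X i ^ 2 * ((X i ^ 2) ^ m)⁻¹))
    (F := fun p : (ℤ × ℤ) × ℤ => ‖dualTerm N τ z (δ * p.2) (δ * p.1.1) p.1.2‖)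
    (w := fun i j => Real.exp (-(2 * Real.pi * N * τ.im * δ ^ 2) * (j + -(i.1 * z.re)) ^ 2))
    (hX.mul_left _) (fun i => by positivity) (fun p => norm_nonneg _) (fun i j => ?_)
    (C := C) (fun i => (hC _).1) (fun i => (hC _).2)
  · let σ : (ℤ × ℤ) × ℤ ≃ (ℤ × ℤ) × ℤ :=
      { toFun := fun p => ((p.1.2, p.2), p.1.1)
        invFun := fun p => ((p.2, p.1.1), p.1.2)
        left_inv := fun _ => rfl
        right_inv := fun _ => rfl }
    refine ⟨σ.summable_iff.mpr key.1, ?_⟩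
    have h1 := σ.tsum_eq (fun p : (ℤ × ℤ) × ℤ => ‖dualTerm N τ z (δ * p.2) (δ * p.1.1) p.1.2‖)
    refine h1.le.trans ?_
    rw [key.1.tsum_prod]
    refine (key.1.prod.tsum_le_tsum key.2 (((hX.mul_left _)).mul_left _)).trans ?_
    rw [tsum_mul_left, tsum_mul_left]
    have : C * (m.factorial * freq N τ z ^ m * ∑' i, X i ^ 2 * ((X i ^ 2) ^ m)⁻¹) =
      C * (m.factorial * ∑' i, X i ^ 2 * ((X i ^ 2) ^ m)⁻¹) * freq N τ z ^ m := by ring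
    rw [this]
    gcongr
    linarith
  · simp only [norm_dualTerm]
    have e2 : Real.exp (-(2 * Real.pi * N * τ.im) * (δ * j - δ * i.1 * z.re) ^ 2) =
        Real.exp (-(2 * Real.pi * N * τ.im * δ ^ 2) * (j + -(i.1 * z.re)) ^ 2) := by
      congr 1; ring
    rw [e2]
    refine mul_le_mul_of_nonneg_right ?_ (Real.exp_nonneg _)
    change X i ^ 2 * Real.exp (-(Real.pi * X i ^ 2 / freq N τ z)) ≤ _
    rcases eq_or_ne (X i) 0 with h0 | h0
    · simp [h0]
    · have hX0 : 0 < X i := lt_of_le_of_ne (norm_nonneg _) (Ne.symm h0)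
      -- `exp(-x) ≤ m! / x ^ m`
      have h1 : Real.exp (-(Real.pi * X i ^ 2 / freq N τ z)) ≤
          m.factorial * freq N τ z ^ m * ((X i ^ 2) ^ m)⁻¹ := by
        have h2 : Real.exp (-(Real.pi * X i ^ 2 / freq N τ z)) ≤
            Real.exp (-(X i ^ 2 / freq N τ z)) := by
          rw [Real.exp_le_exp, neg_le_neg_iff]
          gcongr
          nlinarith [Real.pi_gt_three, sq_nonneg (X i)]
        have h3 := Real.pow_div_factorial_le_exp (X i ^ 2 / freq N τ z) (by positivity) m
        refine h2.trans ?_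
        rw [Real.exp_neg]
        refine (inv_anti₀ (by positivity) h3).trans (le_of_eq ?_)
        rw [div_pow]
        field_simp
      calc _ ≤ X i ^ 2 * (m.factorial * freq N τ z ^ m * ((X i ^ 2) ^ m)⁻¹) := by gcongr
        _ = _ := by ring

theorem SL_val (h : SL(2, ℤ)) : (h : GL (Fin 2) ℝ).val =
    !![((h 0 0 : ℤ) : ℝ), ((h 0 1 : ℤ) : ℝ); ((h 1 0 : ℤ) : ℝ), ((h 1 1 : ℤ) : ℝ)] := by
  ext i j
  fin_cases i <;> fin_cases j <;> simp

theorem SL_inv_val (h : SL(2, ℤ)) : ((h : GL (Fin 2) ℝ)⁻¹).val =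
    !![((h 1 1 : ℤ) : ℝ), -((h 0 1 : ℤ) : ℝ); -((h 1 0 : ℤ) : ℝ), ((h 0 0 : ℤ) : ℝ)] := by
  have hdet := h.det_coe
  rw [Matrix.det_fin_two] at hdet
  have hdet' : ((h 0 0 : ℤ) : ℝ) * (h 1 1 : ℤ) - ((h 0 1 : ℤ) : ℝ) * (h 1 0 : ℤ) = 1 := by
    exact_mod_cast hdet
  rw [Matrix.coe_units_inv, SL_val]
  refine Matrix.inv_eq_right_inv ?_
  ext i j
  fin_cases i <;> fin_cases j <;> simp [Matrix.mul_apply, Fin.sum_univ_two] <;>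
    first | ring1 | linear_combination hdet'

theorem inv_conj_conj (g : GL (Fin 2) ℝ) (M : Matrix (Fin 2) (Fin 2) ℝ) :
    (g⁻¹).val * (g.val * M * (g⁻¹).val) * g.val = M := by
  calc _ = ((g⁻¹).val * g.val) * M * ((g⁻¹).val * g.val) := by simp only [mul_assoc]
    _ = M := by rw [Units.inv_mul, one_mul, mul_one]

theorem conj_eq_of_inv_conj_eq {g : GL (Fin 2) ℝ} {W M : Matrix (Fin 2) (Fin 2) ℝ}
    (h : (g⁻¹).val * W * g.val = M) : g.val * M * (g⁻¹).val = W := by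
  rw [← h]
  have := inv_conj_conj g⁻¹ W
  rwa [inv_inv] at this

instance (N : ℕ) [NeZero N] : NeZero (2 * N ^ 2) :=
  ⟨by have := NeZero.ne N; positivity⟩

/-- A parametrization by `ℤ³` of a lattice that contains the cosets of `L`, in coordinates adapted
to the cusp `h ∞` for `h ∈ SL₂(ℤ)`: the first coordinate is unipotent at this cusp, and steps of
`2 N²` in it are translations by `L` (`conjLatMat_add_mem_coset_iff`). -/
def conjLatMat (h : SL(2, ℤ)) (p : ℤ × ℤ × ℤ) :
    Matrix (Fin 2) (Fin 2) ℝ :=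
  (h : GL (Fin 2) ℝ).val *
    ((N : ℝ) • latMat N (p.1 / (2 * N ^ 2 : ℕ)) (p.2.1 / (2 * N ^ 2 : ℕ))
      (p.2.2 / (2 * N ^ 2 : ℕ))) * ((h : GL (Fin 2) ℝ)⁻¹).val

theorem conjLatMat_injective (h : SL(2, ℤ)) : Function.Injective (conjLatMat N h) := by
  have hN := (natCast_pos N).ne'
  intro p q hpq
  rw [conjLatMat, conjLatMat] at hpq
  have h3 := congrArg (fun M => ((h : GL (Fin 2) ℝ)⁻¹).val * M * (h : GL (Fin 2) ℝ).val) hpq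
  simp only [inv_conj_conj] at h3
  obtain ⟨e1, e2, e3⟩ := latMat_injective N (smul_right_injective _ hN h3)
  have hP : ((2 * N ^ 2 : ℕ) : ℝ) ≠ 0 := by exact_mod_cast NeZero.ne (2 * N ^ 2)
  rw [div_left_inj' hP] at e1 e2 e3
  exact Prod.ext (by exact_mod_cast e1) (Prod.ext (by exact_mod_cast e2) (by exact_mod_cast e3))

theorem coset_subset_range_conjLatMat (h : SL(2, ℤ)) (r : ZMod (2 * N)) :
    coset N r ⊆ Set.range (conjLatMat N h) := by
  have hN := (natCast_pos N).ne'
  intro w hw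
  rw [mem_coset_iff] at hw
  obtain ⟨a, b, c, rfl⟩ := hw
  set B : ℤ := 2 * N * b + r.val with hB
  refine ⟨(-(2 * N * B * h 0 1 * h 1 1 - 2 * N * a * h 1 1 ^ 2 - 2 * N ^ 2 * c * h 0 1 ^ 2),
    B * (h 1 1 * h 0 0 + h 0 1 * h 1 0) - 2 * a * h 1 1 * h 1 0 - 2 * N * c * h 0 0 * h 0 1,
    -(2 * B * h 0 0 * h 1 0) + 2 * a * h 1 0 ^ 2 + 2 * N * c * h 0 0 ^ 2), ?_⟩
  refine conj_eq_of_inv_conj_eq ?_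
  have hb : (b : ℝ) + r.val / (2 * N) = B / (2 * N) := by
    rw [hB]; push_cast; field_simp
  rw [SL_val, SL_inv_val]
  simp only [hb]
  ext i j
  fin_cases i <;> fin_cases j <;>
    simp [latMat, Matrix.mul_apply, Fin.sum_univ_two] <;> field_simp <;> ring

theorem conjLatMat_add_mem_coset_iff (h : SL(2, ℤ)) (r : ZMod (2 * N)) (i l : ℤ) (q : ℤ × ℤ) :
    conjLatMat N h ((2 * N ^ 2 : ℕ) * l + i, q) ∈ coset N r ↔
      conjLatMat N h (i, q) ∈ coset N r := by
  have hN := (natCast_pos N).ne'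
  have h1 : conjLatMat N h ((2 * N ^ 2 : ℕ) * l + i, q) = conjLatMat N h (i, q) +
      (h : GL (Fin 2) ℝ).val * !![0, -(l : ℝ); 0, 0] * ((h : GL (Fin 2) ℝ)⁻¹).val := by
    rw [conjLatMat, conjLatMat, ← Matrix.add_mul, ← Matrix.mul_add]
    congr 2
    ext i j
    fin_cases i <;> fin_cases j <;> simp [latMat] <;> field_simp <;> ring
  have h2 : (h : GL (Fin 2) ℝ).val * !![0, -(l : ℝ); 0, 0] * ((h : GL (Fin 2) ℝ)⁻¹).val ∈
      lattice N := by
    refine ⟨N * (l * h 0 0 ^ 2), l * h 0 0 * h 1 0, l * h 1 0 ^ 2, ?_⟩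
    rw [SL_val, SL_inv_val]
    ext i j
    fin_cases i <;> fin_cases j <;>
      simp [Matrix.mul_apply, Fin.sum_univ_two, -mul_eq_mul_right_iff, -mul_eq_mul_left_iff,
        -neg_inj] <;> (try field_simp)
  rw [coset, Set.mem_ofPred_eq, Set.mem_ofPred_eq, h1, add_sub_right_comm]
  exact AddSubgroup.add_mem_cancel_right _ h2

/-- The theta kernel decreases faster than every power of `y` at each cusp: the conjugate of
`μ + L` is periodic in the direction of the cusp, and Poisson summation in that direction leaves
only terms that decrease rapidly. -/
theorem exists_norm_theta_le (τ : ℍ) (h : SL(2, ℤ)) (K : ℕ) (r : ZMod (2 * N)) :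
    ∃ C : ℝ, 0 < C ∧ ∀ z : ℍ, 1 / 2 ≤ z.im → ‖theta N τ (h • z) r‖ ≤ C * (z.im ^ K)⁻¹ := by
  classical
  have hN := natCast_pos N
  have hP : (0 : ℝ) < (2 * N ^ 2 : ℕ) := natCast_pos _
  -- the factor `N` in `conjLatMat` is moved into `τ`
  let τ' : ℍ := ⟨N ^ 2 * τ, by
    have := mul_pos (pow_pos hN 2) τ.im_pos
    have e : ((N : ℂ) ^ 2 * τ).im = N ^ 2 * τ.im := by
      rw [← Complex.ofReal_natCast, ← Complex.ofReal_pow, Complex.im_ofReal_mul,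
        UpperHalfPlane.coe_im]
    rw [e]; exact this⟩
  have hτ' : (τ' : ℂ) = ((N : ℝ) : ℂ) ^ 2 * τ := by simp [τ']
  clear_value τ'
  obtain ⟨C, hC0, hC⟩ := exists_norm_tsum_dualTerm_le N τ' (inv_pos.mpr hP) (K + 3) (by omega)
  set κ : ℝ := τ'.im / N with hκ
  have hκ0 : 0 < κ := div_pos τ'.im_pos hN
  refine ⟨(2 * N ^ 2 : ℕ) * ((κ * √κ)⁻¹ * (C * κ ^ (K + 3)) * 2 ^ (K + 3)), by positivity,
    fun z hz => ?_⟩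
  have hy := z.im_pos
  obtain ⟨hCs, hCb⟩ := hC z
  -- the sum over the coset as a sum over `ℤ³` with an indicator function
  let f : Matrix (Fin 2) (Fin 2) ℝ → ℂ := fun w => phi N w τ (h • z)
  let a : ℤ × ℤ × ℤ → ℂ := fun p => (coset N r).indicator f (conjLatMat N h p)
  have hsup : Function.support ((coset N r).indicator f) ⊆ Set.range (conjLatMat N h) :=
    (Set.support_indicator_subset).trans (coset_subset_range_conjLatMat N h r)
  have ht : theta N τ (h • z) r = ∑' p, a p := by
    rw [theta, tsum_subtype (coset N r) f]
    exact ((conjLatMat_injective N h).tsum_eq hsup).symm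
  have hs : Summable a :=
    ((conjLatMat_injective N h).summable_iff fun x hx => Function.notMem_support.mp
      fun hx' => hx (hsup hx')).mpr
      (summable_subtype_iff_indicator.mp (summable_phi N τ (h • z) r))
  have hphi : ∀ p, f (conjLatMat N h p) = phi N (latMat N (p.1 / (2 * N ^ 2 : ℕ))
      (p.2.1 / (2 * N ^ 2 : ℕ)) (p.2.2 / (2 * N ^ 2 : ℕ))) τ' z := fun p => by
    simp only [f]
    have e : (h • z : ℍ) = (h : GL (Fin 2) ℝ) • z := rfl
    rw [conjLatMat, e, phi_conj N (SL_det_pos h)]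
    exact phi_smul N hN _ hτ' z
  -- split the first coordinate into residue classes; in each of them the indicator is constant
  let E : ZMod (2 * N ^ 2) × (ℤ × ℤ) × ℤ ≃ ℤ × ℤ × ℤ :=
    { toFun := fun p => (intProdZMod (2 * N ^ 2) (p.2.2, p.1), p.2.1)
      invFun := fun p => (((intProdZMod (2 * N ^ 2)).symm p.1).2,
        p.2, ((intProdZMod (2 * N ^ 2)).symm p.1).1)
      left_inv := fun p => by simp
      right_inv := fun p => by simp }
  have hsE : Summable (a ∘ E) := E.summable_iff.mpr hs
  have hin : ∀ (i : ZMod (2 * N ^ 2)) (q : ℤ × ℤ), ‖∑' l : ℤ, (a ∘ E) (i, q, l)‖ ≤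
      (freq N τ' z * √(freq N τ' z))⁻¹ *
        ∑' n : ℤ, ‖dualTerm N τ' z (((2 * N ^ 2 : ℕ) : ℝ)⁻¹ * q.1)
          (((2 * N ^ 2 : ℕ) : ℝ)⁻¹ * q.2) n‖ := by
    intro i q
    have hF := freq_pos N τ' z
    have haE : ∀ l : ℤ, (a ∘ E) (i, q, l) = if conjLatMat N h (i.val, q) ∈ coset N r then
        phi N (latMat N (l + (i.val : ℝ) / (2 * N ^ 2 : ℕ)) (((2 * N ^ 2 : ℕ) : ℝ)⁻¹ * q.1)
          (((2 * N ^ 2 : ℕ) : ℝ)⁻¹ * q.2)) τ' z else 0 := by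
      intro l
      simp only [Function.comp, E, a, Equiv.coe_fn_mk, intProdZMod_apply, Set.indicator_apply, hphi]
      rw [if_congr (by exact_mod_cast conjLatMat_add_mem_coset_iff N h r i.val l q) ?_ rfl]
      congr 2 <;> field_simp
      push_cast
      ring
    simp only [haE]
    split_ifs with hi
    · obtain ⟨h1, h2⟩ := hasSum_phi_latMat N τ' z ((i.val : ℝ) / (2 * N ^ 2 : ℕ))
        (((2 * N ^ 2 : ℕ) : ℝ)⁻¹ * q.1) (((2 * N ^ 2 : ℕ) : ℝ)⁻¹ * q.2)
      rw [h2.tsum_eq, norm_mul, norm_neg, norm_inv, Complex.norm_real,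
        Real.norm_of_nonneg (by positivity)]
      refine mul_le_mul_of_nonneg_left ?_ (by positivity)
      refine tsum_of_norm_bounded h1.norm.hasSum fun n => ?_
      rw [norm_mul, norm_e_real (by
        rw [← Complex.ofReal_intCast, ← Complex.ofReal_neg, ← Complex.ofReal_mul,
          Complex.ofReal_im]),
        one_mul]
    · rw [tsum_zero, norm_zero]
      have := tsum_nonneg (L := .unconditional ℤ) (fun n : ℤ => norm_nonneg
        (dualTerm N τ' z (((2 * N ^ 2 : ℕ) : ℝ)⁻¹ * q.1) (((2 * N ^ 2 : ℕ) : ℝ)⁻¹ * q.2) n))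
      positivity
  rw [ht, ← E.tsum_eq]
  change ‖∑' p, (a ∘ E) p‖ ≤ _
  rw [hsE.tsum_prod, tsum_fintype]
  refine (norm_sum_le _ _).trans ?_
  have hb : ∀ i : ZMod (2 * N ^ 2), ‖∑' q : (ℤ × ℤ) × ℤ, (a ∘ E) (i, q)‖ ≤
      (freq N τ' z * √(freq N τ' z))⁻¹ * (C * freq N τ' z ^ (K + 3)) := by
    intro i
    rw [(hsE.prod_factor i).tsum_prod]
    refine (tsum_of_norm_bounded ((hCs.prod.mul_left _).hasSum) (hin i)).trans ?_
    rw [tsum_mul_left, ← hCs.tsum_prod]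
    have hF := freq_pos N τ' z
    exact mul_le_mul_of_nonneg_left hCb (by positivity)
  refine (Finset.sum_le_sum fun i _ => hb i).trans ?_
  rw [Finset.sum_const, nsmul_eq_mul, Finset.card_univ, ZMod.card, mul_assoc]
  refine mul_le_mul_of_nonneg_left ?_ hP.le
  have hfr : freq N τ' z = κ / z.im ^ 2 := by rw [freq, hκ]; field_simp
  have hsq : √(freq N τ' z) = √κ / z.im := by
    rw [hfr, Real.sqrt_div hκ0.le, Real.sqrt_sq hy.le]
  have hz1 : (z.im ^ (K + 3))⁻¹ ≤ 2 ^ (K + 3) := by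
    rw [← inv_pow]
    refine pow_le_pow_left₀ (by positivity) ?_ _
    rw [inv_le_comm₀ hy (by norm_num)]
    linarith
  rw [hsq, hfr]
  calc _ = (κ * √κ)⁻¹ * (C * κ ^ (K + 3)) * (z.im ^ (K + 3))⁻¹ * (z.im ^ K)⁻¹ := by
        have : 0 < √κ := Real.sqrt_pos.mpr hκ0
        have hp : (z.im ^ 2) ^ (K + 3) = z.im ^ (K + 3) * z.im ^ K * z.im ^ 3 := by ring
        rw [div_pow, hp]
        field_simp
    _ ≤ _ := by gcongr

theorem continuous_phi (w : Matrix (Fin 2) (Fin 2) ℝ) (τ : ℍ) :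
    Continuous fun z => phi N w τ z := by
  have hs : √(N : ℝ) ≠ 0 := (Real.sqrt_pos.mpr (natCast_pos N)).ne'
  have h1 : ∀ w, Continuous fun z => bil N w (vec N z) := fun w => by
    have hy : Continuous fun z : ℍ => 1 / (√(N : ℝ) * z.im) :=
      continuous_const.div (continuous_const.mul UpperHalfPlane.continuous_im)
        fun z => mul_ne_zero hs z.im_ne_zero
    have hr := UpperHalfPlane.continuous_re
    have hn : Continuous fun z : ℍ => Complex.normSq (z : ℂ) :=
      Complex.continuous_normSq.comp UpperHalfPlane.continuous_coe
    simp only [bil_eq, vec, Matrix.smul_apply, smul_eq_mul, Matrix.of_apply, Matrix.cons_val',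
      Matrix.cons_val_zero, Matrix.cons_val_one, Matrix.cons_val_fin_one]
    fun_prop
  simp only [phi, phi0, R_eq]
  have := h1 (√τ.im • w)
  fun_prop

theorem measurable_theta (τ : ℍ) (r : ZMod (2 * N)) : Measurable fun z => theta N τ z r := by
  have hc : Countable (coset N r) := (cosetEquiv N r).symm.injective.countable
  refine measurable_of_tendsto_metrizable' (u := Filter.atTop)
    (f := fun (t : Finset (coset N r)) z => ∑ w ∈ t, phi N w.val τ z) (fun t => ?_) ?_
  · exact (continuous_finsetSum _ fun w _ => continuous_phi N w.val τ).measurable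
  · rw [tendsto_pi_nhds]
    exact fun z => (summable_phi N τ z r).hasSum

end

section

variable (N : ℕ) [NeZero N]

/-! ### The fundamental domain and unfolding -/

open scoped Pointwise

theorem volume_eq_zero_of_subset_preimage {s : Set ℍ} {t : Set ℂ} (ht : volume t = 0)
    (hs : s ⊆ UpperHalfPlane.coe ⁻¹' t) : volume s = 0 := by
  rw [UpperHalfPlane.volume_eq_lintegral]
  refine setLIntegral_measure_zero _ _ (measure_mono_null ?_ ht)
  rintro _ ⟨z, hz, rfl⟩
  exact hs hz

theorem volume_setOf_re_eq (a : ℝ) : volume {z : ℂ | z.re = a} = 0 := by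
  have h := Complex.volume_preserving_equiv_real_prod.measure_preimage_equiv
    ({a} ×ˢ (Set.univ : Set ℝ))
  rw [Measure.volume_eq_prod, Measure.prod_prod] at h
  simp only [Real.volume_singleton, zero_mul] at h
  convert h using 2
  ext z
  simp [Complex.measurableEquivRealProd_apply]

theorem volume_fd_diff_fdo : volume (ModularGroup.fd \ ModularGroup.fdo : Set ℍ) = 0 := by
  refine volume_eq_zero_of_subset_preimage (t := {z : ℂ | z.re = 1 / 2} ∪ {z : ℂ | z.re = -1 / 2} ∪
    Metric.sphere 0 1) ?_ ?_
  · rw [measure_union_null_iff, measure_union_null_iff]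
    exact ⟨⟨volume_setOf_re_eq _, volume_setOf_re_eq _⟩, Measure.addHaar_sphere _ _ _⟩
  · rintro z ⟨⟨h1, h2⟩, h3⟩
    simp only [ModularGroup.fdo, Set.mem_ofPred_eq, not_and_or, not_lt] at h3
    rcases h3 with h3 | h3
    · right
      have h4 : Complex.normSq (z : ℂ) = 1 := le_antisymm h3 h1
      change (z : ℂ) ∈ Metric.sphere 0 1
      rw [mem_sphere_zero_iff_norm]
      rw [Complex.normSq_eq_norm_sq] at h4
      nlinarith [norm_nonneg (z : ℂ)]
    · left
      have h4 : |z.re| = 1 / 2 := le_antisymm h2 h3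
      rcases eq_or_eq_neg_of_abs_eq h4 with h | h
      · left; simpa using h
      · right
        simp only [Set.mem_ofPred_eq, UpperHalfPlane.coe_re, h]
        norm_num

/-- The image of `Γ₀(N)` in the group of all permutations of the upper half plane. It acts
faithfully, unlike `Γ₀(N)` itself. -/
def gammaBar (N : ℕ) : Subgroup (Equiv.Perm ℍ) :=
  (CongruenceSubgroup.Gamma0 N).map (MulAction.toPermHom SL(2, ℤ) ℍ)

theorem mem_gammaBar (N : ℕ) {γ : SL(2, ℤ)} (hγ : γ ∈ CongruenceSubgroup.Gamma0 N) :
    MulAction.toPermHom SL(2, ℤ) ℍ γ ∈ gammaBar N := ⟨γ, hγ, rfl⟩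

/-- The transformation of the upper half plane attached to an element of `Γ₀(N)`. -/
def toGammaBar (γ : CongruenceSubgroup.Gamma0 N) : gammaBar N := ⟨_, mem_gammaBar N γ.2⟩

theorem toGammaBar_smul (N : ℕ) (γ : CongruenceSubgroup.Gamma0 N) (z : ℍ) :
    toGammaBar N γ • z = (γ : SL(2, ℤ)) • z := rfl

theorem toGammaBar_surjective (N : ℕ) : Function.Surjective (toGammaBar N) := by
  rintro ⟨_, γ, hγ, rfl⟩
  exact ⟨⟨γ, hγ⟩, rfl⟩

theorem neg_one_mem_Gamma0 (N : ℕ) : (-1 : SL(2, ℤ)) ∈ CongruenceSubgroup.Gamma0 N := by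
  rw [CongruenceSubgroup.Gamma0_mem]
  simp

instance : Countable SL(2, ℤ) :=
  Function.Injective.countable (f := fun (g : SL(2, ℤ)) (i j : Fin 2) => g.val i j)
    fun _ _ h => Subtype.ext h

instance : Countable (gammaBar N) := (toGammaBar_surjective N).countable

theorem measurable_SL_smul (γ : SL(2, ℤ)) : Measurable fun z : ℍ => γ • z :=
  measurable_const_smul (γ : GL (Fin 2) ℝ)

theorem measurePreserving_SL_smul (γ : SL(2, ℤ)) :
    MeasurePreserving (fun z : ℍ => γ • z) volume volume :=
  measurePreserving_smul (γ : GL (Fin 2) ℝ) volume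

instance : MeasurableConstSMul (gammaBar N) ℍ where
  measurable_const_smul g := by
    obtain ⟨γ, rfl⟩ := toGammaBar_surjective N g
    exact measurable_SL_smul γ.1

instance : SMulInvariantMeasure (gammaBar N) ℍ volume where
  measure_preimage_smul g s hs := by
    obtain ⟨γ, rfl⟩ := toGammaBar_surjective N g
    exact (measurePreserving_SL_smul γ.1).measure_preimage hs.nullMeasurableSet

theorem measure_smul_image_fd_diff_fdo (γ : SL(2, ℤ)) :
    volume ((fun z : ℍ => γ • z) '' (ModularGroup.fd \ ModularGroup.fdo)) = 0 := by
  have : (fun z : ℍ => γ • z) '' (ModularGroup.fd \ ModularGroup.fdo) =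
      (fun z : ℍ => γ⁻¹ • z) ⁻¹' (ModularGroup.fd \ ModularGroup.fdo) := by
    ext z
    constructor
    · rintro ⟨w, hw, rfl⟩
      simpa using hw
    · intro hz
      exact ⟨_, hz, by simp⟩
  rw [this]
  exact (measurePreserving_SL_smul γ⁻¹).quasiMeasurePreserving.preimage_null volume_fd_diff_fdo

theorem image_inv_smul_fd (γ : SL(2, ℤ)) :
    (fun z : ℍ => γ⁻¹ • z) '' ModularGroup.fd = (fun z : ℍ => γ • z) ⁻¹' ModularGroup.fd := by
  ext z
  constructor
  · rintro ⟨w, hw, rfl⟩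
    simpa using hw
  · intro hz
    exact ⟨_, hz, by simp⟩

/-- Two translates of the domain can only meet in images of the boundary of the standard domain of
`SL₂(ℤ)`, because `fundamentalDomain N` uses one representative for each coset. -/
theorem isFundamentalDomain_fundamentalDomain :
    IsFundamentalDomain (gammaBar N) (fundamentalDomain N) (volume : Measure ℍ) where
  nullMeasurableSet := by
    refine MeasurableSet.nullMeasurableSet (MeasurableSet.iUnion fun q => ?_)
    rw [image_inv_smul_fd]
    exact measurable_SL_smul _ ModularGroup.isClosed_fd.measurableSet
  ae_covers := by
    refine Filter.Eventually.of_forall fun z => ?_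
    obtain ⟨σ, hσ⟩ := ModularGroup.exists_smul_mem_fd z
    obtain ⟨γ, hγ⟩ := QuotientGroup.mk_out_eq_mul (CongruenceSubgroup.Gamma0 N) σ
    refine ⟨toGammaBar N γ⁻¹, Set.mem_iUnion.mpr ⟨(σ : SL(2, ℤ) ⧸ CongruenceSubgroup.Gamma0 N),
      σ • z, hσ, ?_⟩⟩
    simp only [toGammaBar_smul]
    rw [hγ, mul_inv_rev, mul_smul, inv_smul_smul]
    rfl
  aedisjoint := by
    have key : ∀ g : gammaBar N, g ≠ 1 →
        volume (fundamentalDomain N ∩ g • fundamentalDomain N) = 0 := by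
      intro g hg
      obtain ⟨γ, rfl⟩ := toGammaBar_surjective N g
      refine measure_mono_null (t := ⋃ q : SL(2, ℤ) ⧸ CongruenceSubgroup.Gamma0 N,
        (fun z : ℍ => (γ.1 * (Quotient.out q)⁻¹) • z) ''
          (ModularGroup.fd \ ModularGroup.fdo)) ?_
        (measure_iUnion_null fun q => measure_smul_image_fd_diff_fdo _)
      rintro z ⟨hz1, hz2⟩
      obtain ⟨q1, w1, hw1, rfl⟩ := Set.mem_iUnion.mp hz1
      obtain ⟨w', hw', he⟩ := hz2
      obtain ⟨q2, w2, hw2, rfl⟩ := Set.mem_iUnion.mp hw'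
      simp only [toGammaBar_smul] at he
      refine Set.mem_iUnion.mpr ⟨q2, w2, ⟨hw2, fun hw2' => hg ?_⟩, by
        simp only [mul_smul]; exact he⟩
      have h1 : (Quotient.out q1 * γ.1 * (Quotient.out q2)⁻¹) • w2 ∈ ModularGroup.fd := by
        rw [mul_smul, mul_smul, he, smul_inv_smul]
        exact hw1
      obtain ⟨ε, hε, hε', hε''⟩ : ∃ ε : SL(2, ℤ), ε ∈ CongruenceSubgroup.Gamma0 N ∧
          Quotient.out q1 * γ.1 * (Quotient.out q2)⁻¹ = ε ∧ (∀ g, g * ε = ε * g) ∧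
          ∀ z : ℍ, ε • z = z := by
        rcases ModularGroup.eq_one_or_neg_one_of_mem_fdo_mem_fd hw2' h1 with h | h
        · exact ⟨1, one_mem _, h, by simp, by simp⟩
        · exact ⟨-1, neg_one_mem_Gamma0 N, h, by simp, by simp⟩
      have h2 : Quotient.out q1 * γ.1 = Quotient.out q2 * ε := by
        rw [hε''.1, ← hε']; group
      have h3 : q1 = q2 := by
        rw [← QuotientGroup.out_eq' q1, ← QuotientGroup.out_eq' q2]
        have e1 := QuotientGroup.mk_mul_of_mem (Quotient.out q1) γ.2
        have e2 := QuotientGroup.mk_mul_of_mem (Quotient.out q2) hε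
        exact e1.symm.trans ((congrArg _ h2).trans e2)
      rw [h3] at h2
      have h4 := mul_left_cancel h2
      refine Subtype.ext (Equiv.ext fun z => ?_)
      change γ.1 • z = z
      rw [h4, hε''.2]
    intro g h hgh
    have h1 := key (g⁻¹ * h) (fun e => hgh (inv_mul_eq_one.mp e))
    have h2 : g • fundamentalDomain N ∩ h • fundamentalDomain N =
        g • (fundamentalDomain N ∩ (g⁻¹ * h) • fundamentalDomain N) := by
      rw [Set.smul_set_inter, smul_smul, mul_inv_cancel_left]
    rw [Function.onFun, AEDisjoint, h2, measure_smul]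
    exact h1

/-! ### Coordinates on the upper half plane -/

theorem measurableEmbedding_re_im : MeasurableEmbedding (fun z : ℍ => (z.re, z.im)) :=
  Complex.measurableEquivRealProd.measurableEmbedding.comp UpperHalfPlane.measurableEmbedding_coe

theorem map_re_im : (volume : Measure ℍ).map (fun z => (z.re, z.im)) =
    (volume.restrict (Set.univ ×ˢ Set.Ioi 0)).withDensity
      fun p : ℝ × ℝ => ENNReal.ofReal ((p.2 ^ 2)⁻¹) := by
  ext s hs
  have hd : Measurable fun p : ℝ × ℝ => ENNReal.ofReal ((p.2 ^ 2)⁻¹) := by fun_prop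
  rw [measurableEmbedding_re_im.map_apply, withDensity_apply _ hs,
    Measure.restrict_restrict hs, UpperHalfPlane.volume_eq_lintegral]
  have h1 : UpperHalfPlane.coe '' ((fun z : ℍ => (z.re, z.im)) ⁻¹' s) =
      Complex.measurableEquivRealProd ⁻¹' (s ∩ Set.univ ×ˢ Set.Ioi 0) := by
    ext z
    simp only [Set.mem_image, Set.mem_preimage, Complex.measurableEquivRealProd_apply,
      Set.mem_inter_iff, Set.mem_prod, Set.mem_univ, true_and, Set.mem_Ioi]
    constructor
    · rintro ⟨w, hw, rfl⟩
      exact ⟨hw, w.im_pos⟩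
    · rintro ⟨h1, h2⟩
      exact ⟨⟨z, h2⟩, h1, rfl⟩
  rw [h1, ← Complex.volume_preserving_equiv_real_prod.setLIntegral_comp_preimage_emb
    Complex.measurableEquivRealProd.measurableEmbedding]
  refine lintegral_congr fun z => ?_
  rw [Complex.measurableEquivRealProd_apply, ← ENNReal.ofReal_coe_nnreal]
  congr 1
  simp

/-- The half strip `0 < x ≤ 1`, a fundamental domain for the translations. -/
def strip : Set ℍ := {z | z.re ∈ Set.Ioc (0 : ℝ) 1}

theorem measurableSet_strip : MeasurableSet strip :=
  UpperHalfPlane.continuous_re.measurable measurableSet_Ioc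

theorem map_re_im_restrict_strip :
    ((volume : Measure ℍ).restrict strip).map (fun z => (z.re, z.im)) =
      ((volume.restrict (Set.Ioc (0 : ℝ) 1)).prod (volume.restrict (Set.Ioi (0 : ℝ)))).withDensity
        fun p : ℝ × ℝ => ENNReal.ofReal ((p.2 ^ 2)⁻¹) := by
  have hm : MeasurableSet (Set.Ioc (0 : ℝ) 1 ×ˢ (Set.univ : Set ℝ)) :=
    measurableSet_Ioc.prod MeasurableSet.univ
  have h0 : strip = (fun z : ℍ => (z.re, z.im)) ⁻¹' (Set.Ioc (0 : ℝ) 1 ×ˢ Set.univ) := by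
    ext z; simp [strip]
  rw [h0, ← measurableEmbedding_re_im.restrict_map, map_re_im, restrict_withDensity hm,
    Measure.restrict_restrict hm, Set.prod_inter_prod, Set.inter_univ, Set.univ_inter,
    Measure.volume_eq_prod, Measure.prod_restrict]

theorem lintegral_strip {f : ℝ × ℝ → ENNReal} (hf : Measurable f) :
    ∫⁻ z in strip, f (z.re, z.im) =
      ∫⁻ y in Set.Ioi (0 : ℝ), ∫⁻ x in Set.Ioc (0 : ℝ) 1,
        ENNReal.ofReal ((y ^ 2)⁻¹) * f (x, y) := by
  have hd : Measurable fun p : ℝ × ℝ => ENNReal.ofReal ((p.2 ^ 2)⁻¹) := by fun_prop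
  have h := lintegral_map (μ := (volume : Measure ℍ).restrict strip) hf
    measurableEmbedding_re_im.measurable
  rw [← h, map_re_im_restrict_strip, lintegral_withDensity_eq_lintegral_mul _ hd hf,
    lintegral_prod_symm' _ (hd.mul hf)]
  rfl

theorem integral_strip {f : ℝ × ℝ → ℂ}
    (hf : IntegrableOn (fun z : ℍ => f (z.re, z.im)) strip) :
    ∫ z in strip, f (z.re, z.im) =
      ∫ y in Set.Ioi (0 : ℝ), ∫ x in Set.Ioc (0 : ℝ) 1, ((y ^ 2)⁻¹ : ℝ) • f (x, y) := by
  have hd : Measurable fun p : ℝ × ℝ => ENNReal.ofReal ((p.2 ^ 2)⁻¹) := by fun_prop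
  have hfin : ∀ᵐ p : ℝ × ℝ ∂((volume.restrict (Set.Ioc (0 : ℝ) 1)).prod
      (volume.restrict (Set.Ioi (0 : ℝ)))), ENNReal.ofReal ((p.2 ^ 2)⁻¹) < ⊤ :=
    Filter.Eventually.of_forall fun _ => ENNReal.ofReal_lt_top
  have hr : ∀ p : ℝ × ℝ, (ENNReal.ofReal ((p.2 ^ 2)⁻¹)).toReal = (p.2 ^ 2)⁻¹ := fun p =>
    ENNReal.toReal_ofReal (by positivity)
  have h1 : Integrable f (((volume : Measure ℍ).restrict strip).map
      (fun z => (z.re, z.im))) := measurableEmbedding_re_im.integrable_map_iff.mpr hf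
  rw [← measurableEmbedding_re_im.integral_map]
  rw [map_re_im_restrict_strip] at h1 ⊢
  rw [integrable_withDensity_iff_integrable_smul' hd hfin] at h1
  rw [integral_withDensity_eq_integral_toReal_smul hd hfin]
  simp only [hr] at h1 ⊢
  exact integral_prod_symm _ h1

theorem volume_fd_lt_top : volume (ModularGroup.fd : Set ℍ) < ⊤ := by
  have h1 : (ModularGroup.fd : Set ℍ) ⊆ (fun z : ℍ => (z.re, z.im)) ⁻¹'
      (Set.Icc (-1 / 2 : ℝ) (1 / 2) ×ˢ Set.Ioi (1 / 4 : ℝ)) := by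
    intro z hz
    have h2 := abs_le.mp hz.2
    have h3 := ModularGroup.three_le_four_mul_im_sq_of_mem_fd hz
    refine ⟨⟨by linarith [h2.1], h2.2⟩, ?_⟩
    change 1 / 4 < z.im
    nlinarith [z.im_pos]
  have hm : MeasurableSet (Set.Icc (-1 / 2 : ℝ) (1 / 2) ×ˢ Set.Ioi (1 / 4 : ℝ)) :=
    measurableSet_Icc.prod measurableSet_Ioi
  refine (measure_mono h1).trans_lt ?_
  have hd : Measurable fun p : ℝ × ℝ => ENNReal.ofReal ((p.2 ^ 2)⁻¹) := by fun_prop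
  rw [← measurableEmbedding_re_im.map_apply, map_re_im, withDensity_apply _ hm,
    Measure.restrict_restrict hm, Set.prod_inter_prod, Set.inter_univ,
    Measure.volume_eq_prod, ← Measure.prod_restrict, lintegral_prod _ hd.aemeasurable]
  simp only [lintegral_const, Measure.restrict_apply MeasurableSet.univ, Set.univ_inter,
    Real.volume_Icc]
  refine ENNReal.mul_lt_top ?_ ENNReal.ofReal_lt_top
  have h4 : Set.Ioi (1 / 4 : ℝ) ∩ Set.Ioi 0 = Set.Ioi (1 / 4) := by
    rw [Set.Ioi_inter_Ioi]; norm_num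
  rw [h4]
  have h5 := (integrableOn_Ioi_rpow_of_lt (by norm_num : (-2 : ℝ) < -1)
    (by norm_num : (0 : ℝ) < 1 / 4)).lintegral_lt_top
  refine lt_of_le_of_lt (le_of_eq ?_) h5
  refine setLIntegral_congr_fun measurableSet_Ioi fun y hy => ?_
  have hy0 : (0 : ℝ) < y := lt_trans (by norm_num) hy
  rw [Real.rpow_neg hy0.le, Real.rpow_two]

/-- Integrability over the fundamental domain follows from boundedness at every cusp, as the
volume is finite. -/
theorem integrableOn_fundamentalDomain {f : ℍ → ℂ} (hf : Measurable f)
    (hb : ∀ σ : SL(2, ℤ), ∃ C : ℝ, ∀ z ∈ ModularGroup.fd, ‖f (σ • z)‖ ≤ C) :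
    IntegrableOn f (fundamentalDomain N) := by
  refine (integrableOn_finite_iUnion).mpr fun q => ?_
  obtain ⟨C, hC⟩ := hb (Quotient.out q)⁻¹
  have hvol : volume ((fun z : ℍ => (Quotient.out q)⁻¹ • z) '' ModularGroup.fd) < ⊤ := by
    rw [image_inv_smul_fd, (measurePreserving_SL_smul _).measure_preimage
      ModularGroup.isClosed_fd.measurableSet.nullMeasurableSet]
    exact volume_fd_lt_top
  have hms : MeasurableSet ((fun z : ℍ => (Quotient.out q)⁻¹ • z) '' ModularGroup.fd) := by
    rw [image_inv_smul_fd]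
    exact measurable_SL_smul _ ModularGroup.isClosed_fd.measurableSet
  refine Measure.integrableOn_of_bounded (M := C) hvol.ne hf.aestronglyMeasurable ?_
  refine (ae_restrict_iff' hms).mpr (Filter.Eventually.of_forall ?_)
  rintro _ ⟨z, hz, rfl⟩
  exact hC z hz

/-! ### Unfolding -/

theorem T_zpow_mem_stabInfty (n : ℤ) : ModularGroup.T ^ n ∈ stabInfty :=
  zpow_mem (show ModularGroup.T 1 0 = 0 by simp [ModularGroup.T]) n

/-- Matrices that act in the same way differ by `±1`. -/
theorem exists_eq_mul_of_smul_eq {A B : SL(2, ℤ)} (h : ∀ w : ℍ, A • w = B • w) :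
    ∃ ε ∈ stabInfty, A = ε * B := by
  let w : ℍ := ⟨2 * Complex.I, by simp⟩
  have hw : w ∈ ModularGroup.fdo := by
    constructor
    · norm_num [w]
    · change |(2 * Complex.I).re| < 1 / 2
      simp
  have hw' : (B⁻¹ * A) • w ∈ ModularGroup.fd := by
    rw [mul_smul, h, inv_smul_smul]
    exact ModularGroup.fdo_subset_fd hw
  rcases ModularGroup.eq_one_or_neg_one_of_mem_fdo_mem_fd hw hw' with h1 | h1
  · exact ⟨1, one_mem _, by rw [one_mul]; exact (inv_mul_eq_one.mp h1).symm⟩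
  · refine ⟨-1, ?_, ?_⟩
    · change (-1 : SL(2, ℤ)) 1 0 = 0
      simp
    · rw [← mul_inv_cancel_left B A, h1]
      simp

/-- Unfolding of the Eisenstein series against a function invariant under `Γ₀(N)`. -/
theorem setIntegral_eisensteinSeries_mul {θ : ℍ → ℂ}
    (hθ : ∀ γ ∈ CongruenceSubgroup.Gamma0 N, ∀ z : ℍ, θ (γ • z) = θ z) {s : ℂ}
    (hint : IntegrableOn (fun z : ℍ => (z.im : ℂ) ^ s * θ z) strip) :
    ∫ z in fundamentalDomain N, eisensteinSeries N z s * θ z =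
      ∫ z in strip, (z.im : ℂ) ^ s * θ z := by
  classical
  set f : ℍ → ℂ := strip.indicator fun z : ℍ => (z.im : ℂ) ^ s * θ z with hf
  have hfi : Integrable f := (integrable_indicator_iff measurableSet_strip).mpr hint
  have hF := isFundamentalDomain_fundamentalDomain N
  have hpt : ∀ z : ℍ, ∑' g : gammaBar N, f (g • z) = eisensteinSeries N z s * θ z := by
    intro z
    -- each coset contributes the one transformation that moves `z` into the strip
    have hj : ∀ w : ℍ, ∃ j : ℤ, ModularGroup.T ^ j • w ∈ strip ∧
        ∀ j' : ℤ, ModularGroup.T ^ j' • w ∈ strip → j' = j := fun w => by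
      obtain ⟨j, hj, hu⟩ := existsUnique_add_zsmul_mem_Ioc (zero_lt_one' ℝ) w.re 0
      have hst : ∀ n : ℤ, ModularGroup.T ^ n • w ∈ strip ↔
          w.re + n • (1 : ℝ) ∈ Set.Ioc 0 (0 + 1) := fun n => by
          rw [strip, Set.mem_ofPred_eq, ModularGroup.re_T_zpow_smul, zsmul_one, zero_add]
      exact ⟨j, (hst j).mpr hj, fun j' hj' => hu j' ((hst j').mp hj')⟩
    choose j hjs hju using hj
    have hT : ∀ n : ℤ, ModularGroup.T ^ n ∈ CongruenceSubgroup.Gamma0 N := fun n =>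
      zpow_mem (by rw [CongruenceSubgroup.Gamma0_mem]; simp [ModularGroup.T]) n
    let ι : Cosets N → gammaBar N := fun q => toGammaBar N
      (⟨ModularGroup.T ^ j ((Quotient.out q).1 • z), hT _⟩ * Quotient.out q)
    have hι : ∀ q, ι q • z = ModularGroup.T ^ j ((Quotient.out q).1 • z) •
        ((Quotient.out q).1 • z) := fun q => by
      simp only [ι, toGammaBar_smul, Subgroup.coe_mul, mul_smul]
    have hinj : Function.Injective ι := by
      intro q q' hqq
      have h1 : ∀ w : ℍ, (ModularGroup.T ^ j ((Quotient.out q).1 • z) * (Quotient.out q).1) • w =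
          (ModularGroup.T ^ j ((Quotient.out q').1 • z) * (Quotient.out q').1) • w := fun w =>
        congrArg (fun g : gammaBar N => g • w) hqq
      refine Quotient.out_equiv_out.mp (QuotientGroup.rightRel_apply.mpr ?_)
      rw [Subgroup.mem_subgroupOf]
      obtain ⟨ε, hε, hεe⟩ := exists_eq_mul_of_smul_eq h1
      have h2 : (Quotient.out q').1 * ((Quotient.out q).1)⁻¹ =
          (ModularGroup.T ^ j ((Quotient.out q').1 • z))⁻¹ * ε⁻¹ *
            ModularGroup.T ^ j ((Quotient.out q).1 • z) := by
        rw [eq_mul_inv_of_mul_eq hεe.symm]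
        group
      change (Quotient.out q').1 * ((Quotient.out q).1)⁻¹ ∈ stabInfty
      rw [h2]
      exact mul_mem (mul_mem (inv_mem (T_zpow_mem_stabInfty _)) (inv_mem hε))
        (T_zpow_mem_stabInfty _)
    have hsupp : Function.support (fun g : gammaBar N => f (g • z)) ⊆ Set.range ι := by
      intro g hg
      obtain ⟨γ, rfl⟩ := toGammaBar_surjective N g
      have hγ : γ.1 • z ∈ strip := Set.mem_of_indicator_ne_zero hg
      refine ⟨Quotient.mk _ γ, Subtype.ext (Equiv.ext fun w => ?_)⟩
      have h1 : γ.1 * ((Quotient.out (Quotient.mk _ γ : Cosets N)).1)⁻¹ ∈ stabInfty :=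
        Subgroup.mem_subgroupOf.mp (QuotientGroup.rightRel_apply.mp
          (Quotient.mk_out (s := QuotientGroup.rightRel
            (stabInfty.subgroupOf (CongruenceSubgroup.Gamma0 N))) γ))
      obtain ⟨n, hn⟩ := ModularGroup.exists_eq_T_zpow_of_c_eq_zero h1
      have h2 : ∀ w : ℍ, γ.1 • w =
          ModularGroup.T ^ n • ((Quotient.out (Quotient.mk _ γ : Cosets N)).1 • w) := fun w => by
        rw [← hn, mul_smul, inv_smul_smul]
      have h3 : n = j ((Quotient.out (Quotient.mk _ γ : Cosets N)).1 • z) :=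
        hju _ _ (by rw [← h2]; exact hγ)
      change (_ * _ : SL(2, ℤ)) • w = γ.1 • w
      rw [h2, mul_smul, h3]
    rw [← hinj.tsum_eq hsupp, eisensteinSeries, ← tsum_mul_right]
    congr 1
    funext q
    rw [hι, hf, Set.indicator_of_mem (hjs _), hθ _ (hT _), hθ _ (Quotient.out q).2,
      ModularGroup.im_T_zpow_smul, eisensteinTerm]
  have hm : ∀ g : gammaBar N, AEStronglyMeasurable (fun z => f (g • z))
      (volume.restrict (fundamentalDomain N)) := fun g =>
    (hfi.1.comp_measurePreserving (measurePreserving_smul g volume)).restrict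
  rw [← integral_indicator measurableSet_strip, ← hf, hF.integral_eq_tsum'' f hfi,
    ← integral_tsum hm]
  · simp only [hpt]
  · rw [← hF.lintegral_eq_tsum'' fun z => ‖f z‖ₑ]
    exact hfi.2.ne

end

section

/-! ### The theta series of a binary quadratic form -/

/-- The positive definite form `|f m z + n|² / (f y)`, i.e. `|m w + n|² / Im w` for `w = f z`. -/
def qf (f : ℕ) (z : ℍ) (p : ℤ × ℤ) : ℝ := ‖(f : ℂ) * p.1 * z + p.2‖ ^ 2 / (f * z.im)

/-- The theta series of the form `qf f z`, without its constant term. -/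
def thetaQ (f : ℕ) (z : ℍ) (t : ℝ) : ℝ :=
  ∑' p : ℤ × ℤ, if p = 0 then 0 else Real.exp (-Real.pi * t * qf f z p)

variable (f : ℕ) [NeZero f]

theorem qf_nonneg (z : ℍ) (p : ℤ × ℤ) : 0 ≤ qf f z p := by
  have := natCast_pos f
  have := z.im_pos
  unfold qf; positivity

theorem qf_eq (z : ℍ) (p : ℤ × ℤ) :
    qf f z p = (p.2 + f * p.1 * z.re) ^ 2 / (f * z.im) + f * z.im * p.1 ^ 2 := by
  have := natCast_pos f
  have := z.im_pos
  rw [qf, ← Complex.normSq_eq_norm_sq, Complex.normSq_apply]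
  simp
  field_simp
  ring

/-- The substitution on pairs of integers induced by `z ↦ f (σ z)`. -/
def pairMap (σ : SL(2, ℤ)) (p : ℤ × ℤ) : ℤ × ℤ :=
  (f * p.1 * σ 0 0 + p.2 * σ 1 0, f * p.1 * σ 0 1 + p.2 * σ 1 1)

theorem pairMap_injective (σ : SL(2, ℤ)) : Function.Injective (pairMap f σ) := by
  have hf : (f : ℤ) ≠ 0 := by exact_mod_cast NeZero.ne f
  have hdet := σ.det_coe
  rw [Matrix.det_fin_two] at hdet
  rintro ⟨m, n⟩ ⟨m', n'⟩ h
  obtain ⟨h1, h2⟩ := Prod.mk.inj h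
  simp only at h1 h2
  have e1 : (f : ℤ) * m = f * m' := by
    linear_combination (σ 1 1) * h1 - (σ 1 0) * h2 - (f * m - f * m') * hdet
  have e2 : n = n' := by
    linear_combination (σ 0 0) * h2 - (σ 0 1) * h1 - (n - n') * hdet
  rw [mul_left_cancel₀ hf e1, e2]

theorem pairMap_zero (f : ℕ) (σ : SL(2, ℤ)) : pairMap f σ 0 = 0 := by
  simp [pairMap]

theorem qf_smul (σ : SL(2, ℤ)) (z : ℍ) (p : ℤ × ℤ) :
    qf f (σ • z) p = ‖((pairMap f σ p).1 : ℂ) * z + (pairMap f σ p).2‖ ^ 2 / (f * z.im) := by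
  have hf := natCast_pos f
  have hy := z.im_pos
  have hd := Mp2Z.denom_ne_zero σ z
  have him : (σ • z).im = z.im / ‖(σ 1 0 : ℂ) * z + σ 1 1‖ ^ 2 := by
    rw [ModularGroup.im_smul_eq_div_normSq, Complex.normSq_eq_norm_sq]
    simp [UpperHalfPlane.denom]
  have h1 : (f : ℂ) * p.1 * (σ • z : ℍ) + p.2 =
      (((pairMap f σ p).1 : ℂ) * z + (pairMap f σ p).2) / ((σ 1 0 : ℂ) * z + σ 1 1) := by
    rw [Mp2Z.coe_smul, pairMap, eq_div_iff hd, add_mul, mul_assoc, div_mul_cancel₀ _ hd]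
    push_cast
    ring
  have hd' : ‖(σ 1 0 : ℂ) * z + σ 1 1‖ ≠ 0 := norm_ne_zero_iff.mpr hd
  rw [qf, h1, him, norm_div]
  generalize ‖(σ 1 0 : ℂ) * z + σ 1 1‖ = D at hd' ⊢
  field_simp

/-- On the standard fundamental domain `|m z + n|²` dominates `(m² + n²) / 2`. -/
theorem norm_sq_ge_of_mem_fd {z : ℍ} (hz : z ∈ ModularGroup.fd) (p : ℤ × ℤ) :
    ((p.1 : ℝ) ^ 2 + (p.2 : ℝ) ^ 2) / 2 ≤ ‖(p.1 : ℂ) * z + p.2‖ ^ 2 := by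
  obtain ⟨h1, h2⟩ := hz
  have h3 := abs_le.mp h2
  rw [Complex.normSq_apply] at h1
  rw [← Complex.normSq_eq_norm_sq, Complex.normSq_apply]
  simp only [Complex.add_re, Complex.mul_re, Complex.intCast_re, Complex.intCast_im,
    Complex.add_im, Complex.mul_im, UpperHalfPlane.coe_re, UpperHalfPlane.coe_im] at h1 ⊢
  nlinarith [sq_nonneg ((p.1 : ℝ) + p.2), sq_nonneg ((p.1 : ℝ) - p.2),
    mul_nonneg (sq_nonneg ((p.1 : ℝ) + p.2)) (by linarith [h3.1] : 0 ≤ 1 / 2 + z.re),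
    mul_nonneg (sq_nonneg ((p.1 : ℝ) - p.2)) (by linarith [h3.2] : 0 ≤ 1 / 2 - z.re),
    mul_nonneg (sq_nonneg (p.1 : ℝ)) (by linarith : 0 ≤ z.re * z.re + z.im * z.im - 1)]

/-- A lower bound that is uniform in `σ`: the form at `σ z` is a multiple of `|m z + n|²`,
restricted to a sublattice of the pairs of integers. -/
theorem qf_smul_ge (σ : SL(2, ℤ)) {z : ℍ} (hz : z ∈ ModularGroup.fd) (p : ℤ × ℤ) :
    (((pairMap f σ p).1 : ℝ) ^ 2 + ((pairMap f σ p).2 : ℝ) ^ 2) / (2 * f * z.im) ≤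
      qf f (σ • z) p := by
  have hf := natCast_pos f
  have hy := z.im_pos
  have h := norm_sq_ge_of_mem_fd hz (pairMap f σ p)
  rw [qf_smul, div_le_div_iff₀ (by positivity) (by positivity)]
  nlinarith [mul_le_mul_of_nonneg_right h (by positivity : 0 ≤ 2 * ((f : ℝ) * z.im))]

theorem sum_sq_pos {p : ℤ × ℤ} (hp : p ≠ 0) : 0 < (p.1 : ℝ) ^ 2 + (p.2 : ℝ) ^ 2 := by
  by_contra h
  have h1 : (p.1 : ℝ) = 0 := by nlinarith [sq_nonneg (p.1 : ℝ), sq_nonneg (p.2 : ℝ)]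
  have h2 : (p.2 : ℝ) = 0 := by nlinarith [sq_nonneg (p.1 : ℝ), sq_nonneg (p.2 : ℝ)]
  exact hp (Prod.ext (by exact_mod_cast h1) (by exact_mod_cast h2))

theorem qf_pos (z : ℍ) {p : ℤ × ℤ} (hp : p ≠ 0) : 0 < qf f z p := by
  obtain ⟨σ, hσ⟩ := ModularGroup.exists_smul_mem_fd z
  have hf := natCast_pos f
  have h1 := qf_smul_ge f σ⁻¹ hσ p
  rw [inv_smul_smul] at h1
  have hp' : pairMap f σ⁻¹ p ≠ 0 := fun h => hp (pairMap_injective f σ⁻¹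
    (h.trans (pairMap_zero f σ⁻¹).symm))
  have := sum_sq_pos hp'
  have := (σ • z).im_pos
  exact lt_of_lt_of_le (by positivity) h1

theorem summable_sum_sq_rpow {a : ℝ} (ha : 1 < a) :
    Summable fun p : ℤ × ℤ => ((p.1 : ℝ) ^ 2 + (p.2 : ℝ) ^ 2) ^ (-a) := by
  have h := (finTwoArrowEquiv ℤ).symm.summable_iff.mpr
    (EisensteinSeries.summable_one_div_norm_rpow (k := 2 * a) (by linarith))
  refine Summable.of_nonneg_of_le (fun p => by positivity) (fun p => ?_) h
  rcases eq_or_ne p 0 with rfl | hp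
  · simp only [Prod.fst_zero, Prod.snd_zero, Int.cast_zero, ne_eq, OfNat.ofNat_ne_zero,
      not_false_eq_true, zero_pow, add_zero, Real.zero_rpow (by linarith : -a ≠ 0), Function.comp]
    positivity
  have h1 : ‖(finTwoArrowEquiv ℤ).symm p‖ ^ 2 ≤ (p.1 : ℝ) ^ 2 + (p.2 : ℝ) ^ 2 := by
    rw [EisensteinSeries.norm_eq_max_natAbs]
    simp only [finTwoArrowEquiv_symm_apply, Matrix.cons_val_zero, Matrix.cons_val_one]
    have e : ∀ k : ℤ, ((k.natAbs : ℕ) : ℝ) ^ 2 = (k : ℝ) ^ 2 := fun k => by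
      rw [Nat.cast_natAbs, Int.cast_abs, sq_abs]
    rcases le_total p.1.natAbs p.2.natAbs with h | h
    · rw [max_eq_right h, e]; nlinarith [sq_nonneg (p.1 : ℝ)]
    · rw [max_eq_left h, e]; nlinarith [sq_nonneg (p.2 : ℝ)]
  have h2 : 0 < ‖(finTwoArrowEquiv ℤ).symm p‖ := by
    rw [norm_pos_iff]
    intro h
    exact hp ((finTwoArrowEquiv ℤ).symm.injective (h.trans (by ext i; fin_cases i <;> rfl)))
  simp only [Function.comp]
  rw [show -(2 * a) = ((2 : ℕ) : ℝ) * (-a) by push_cast; ring, Real.rpow_mul h2.le,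
    Real.rpow_natCast]
  exact Real.rpow_le_rpow_of_nonpos (by positivity) h1 (by linarith)

theorem summable_qf_rpow (z : ℍ) {a : ℝ} (ha : 1 < a) : Summable fun p => qf f z p ^ (-a) := by
  obtain ⟨σ, hσ⟩ := ModularGroup.exists_smul_mem_fd z
  have hf := natCast_pos f
  have hy := (σ • z).im_pos
  have h := ((summable_sum_sq_rpow ha).comp_injective (pairMap_injective f σ⁻¹)).mul_left
    ((2 * f * (σ • z).im)⁻¹ ^ (-a))
  refine Summable.of_nonneg_of_le (fun p => Real.rpow_nonneg (qf_nonneg f z p) _) (fun p => ?_) h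
  have h1 := qf_smul_ge f σ⁻¹ hσ p
  rw [inv_smul_smul] at h1
  rcases eq_or_ne p 0 with rfl | hp
  · have : qf f z 0 = 0 := by simp [qf]
    rw [this, Real.zero_rpow (by linarith)]
    simp only [Function.comp]
    positivity
  have hp' : pairMap f σ⁻¹ p ≠ 0 := fun h => hp (pairMap_injective f σ⁻¹
    (h.trans (pairMap_zero f σ⁻¹).symm))
  have h3 := sum_sq_pos hp'
  simp only [Function.comp]
  rw [← Real.mul_rpow (by positivity) (by positivity), mul_comm, ← div_eq_mul_inv]
  exact Real.rpow_le_rpow_of_nonpos (by positivity) h1 (by linarith)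

/-- Rapid decay of the theta series, with polynomial dependence on the point near the cusps. -/
theorem exists_thetaQ_le (M : ℕ) (hM : 2 ≤ M) : ∃ C : ℝ, 0 < C ∧ ∀ (σ : SL(2, ℤ)),
    ∀ z ∈ ModularGroup.fd, ∀ t : ℝ, 0 < t →
      Summable (fun p : ℤ × ℤ => if p = 0 then 0 else Real.exp (-Real.pi * t * qf f (σ • z) p)) ∧
      thetaQ f (σ • z) t ≤ C * z.im ^ M * (t ^ M)⁻¹ := by
  have hf := natCast_pos f
  have hS := summable_sum_sq_rpow (a := M) (by exact_mod_cast (by omega : 1 < M))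
  set S := ∑' p : ℤ × ℤ, ((p.1 : ℝ) ^ 2 + (p.2 : ℝ) ^ 2) ^ (-(M : ℝ)) with hSdef
  have hS0 : 0 ≤ S := tsum_nonneg fun p => by positivity
  refine ⟨M.factorial * (2 * f) ^ M * (1 + S), by positivity, fun σ z hz t ht => ?_⟩
  have hy := z.im_pos
  have hle : ∀ p : ℤ × ℤ, (if p = 0 then 0 else Real.exp (-Real.pi * t * qf f (σ • z) p)) ≤
      (M.factorial * (2 * f) ^ M * z.im ^ M * (t ^ M)⁻¹) *
        (((pairMap f σ p).1 : ℝ) ^ 2 + ((pairMap f σ p).2 : ℝ) ^ 2) ^ (-(M : ℝ)) := by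
    intro p
    split_ifs with hp
    · positivity
    have hp' : pairMap f σ p ≠ 0 := fun h => hp (pairMap_injective f σ
      (h.trans (pairMap_zero f σ).symm))
    have h3 := sum_sq_pos hp'
    set X := ((pairMap f σ p).1 : ℝ) ^ 2 + ((pairMap f σ p).2 : ℝ) ^ 2
    have h1 := qf_smul_ge f σ hz p
    have h2 : Real.exp (-Real.pi * t * qf f (σ • z) p) ≤
        Real.exp (-(t * (X / (2 * f * z.im)))) := by
      rw [Real.exp_le_exp, mul_assoc, neg_mul, neg_le_neg_iff]
      have : t * (X / (2 * f * z.im)) ≤ t * qf f (σ • z) p := by gcongr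
      nlinarith [Real.pi_gt_three, mul_nonneg ht.le (qf_nonneg f (σ • z) p)]
    have h4 := Real.pow_div_factorial_le_exp (t * (X / (2 * f * z.im))) (by positivity) M
    refine h2.trans ?_
    rw [Real.exp_neg, Real.rpow_neg h3.le, Real.rpow_natCast]
    refine (inv_anti₀ (by positivity) h4).trans (le_of_eq ?_)
    rw [mul_pow, div_pow, mul_pow, mul_pow]
    field_simp
  have hs := (hS.comp_injective (pairMap_injective f σ)).mul_left
    (M.factorial * (2 * f) ^ M * z.im ^ M * (t ^ M)⁻¹ : ℝ)
  have hs1 := Summable.of_nonneg_of_le (fun p => by split_ifs <;> positivity) hle hs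
  refine ⟨hs1, (hs1.tsum_le_tsum hle hs).trans ?_⟩
  rw [tsum_mul_left]
  have h5 : ∑' p, ((fun p : ℤ × ℤ => ((p.1 : ℝ) ^ 2 + (p.2 : ℝ) ^ 2) ^ (-(M : ℝ))) ∘
      pairMap f σ) p ≤ S := tsum_comp_le_tsum_of_inj hS (fun p => by positivity)
        (pairMap_injective f σ)
  calc _ ≤ (M.factorial * (2 * f) ^ M * z.im ^ M * (t ^ M)⁻¹ : ℝ) * S := by
        refine mul_le_mul_of_nonneg_left h5 (by positivity)
    _ ≤ _ := by
        have : (M.factorial * (2 * f) ^ M * (1 + S)) * z.im ^ M * (t ^ M)⁻¹ =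
          (M.factorial * (2 * f) ^ M * z.im ^ M * (t ^ M)⁻¹ : ℝ) * (1 + S) := by ring
        rw [this]
        refine mul_le_mul_of_nonneg_left (by linarith) (by positivity)

theorem summable_thetaQ (z : ℍ) {t : ℝ} (ht : 0 < t) :
    Summable (fun p : ℤ × ℤ => if p = 0 then 0 else Real.exp (-Real.pi * t * qf f z p)) := by
  obtain ⟨σ, hσ⟩ := ModularGroup.exists_smul_mem_fd z
  obtain ⟨C, -, hC⟩ := exists_thetaQ_le f 2 le_rfl
  have := (hC σ⁻¹ _ hσ t ht).1
  rwa [inv_smul_smul] at this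

theorem thetaQ_nonneg (f : ℕ) (z : ℍ) (t : ℝ) : 0 ≤ thetaQ f z t :=
  tsum_nonneg fun p => by split_ifs <;> positivity

theorem hasSum_one_add_thetaQ (z : ℍ) {t : ℝ} (ht : 0 < t) :
    HasSum (fun p : ℤ × ℤ => Real.exp (-Real.pi * t * qf f z p)) (1 + thetaQ f z t) := by
  have h := (hasSum_ite_eq (0 : ℤ × ℤ) (1 : ℝ)).add (summable_thetaQ f z ht).hasSum
  refine hasSum_of_eq h (fun p => ?_) rfl
  split_ifs with hp
  · simp [hp, qf]
  · simp

/-- Poisson summation in the second variable. -/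
theorem one_add_thetaQ_eq (z : ℍ) {t : ℝ} (ht : 0 < t) :
    ((1 + thetaQ f z t : ℝ) : ℂ) = (√(f * z.im / t) : ℝ) *
      ∑' m : ℤ, ∑' n : ℤ, e (m * n * (f * z.re)) *
        (Real.exp (-Real.pi * (f * z.im) * (t * m ^ 2 + t⁻¹ * n ^ 2)) : ℝ) := by
  have hf := natCast_pos f
  have hy := z.im_pos
  have hfC : (f : ℂ) ≠ 0 := natCast_ne_zero f
  have hyC : (z.im : ℂ) ≠ 0 := Complex.ofReal_ne_zero.mpr hy.ne'
  have htC : (t : ℂ) ≠ 0 := Complex.ofReal_ne_zero.mpr ht.ne'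
  have h := (hasSum_one_add_thetaQ f z ht)
  have h' := Complex.hasSum_ofReal.mpr h
  rw [← h'.tsum_eq, h'.summable.tsum_prod, ← tsum_mul_left]
  congr 1
  funext m
  have hg := tsum_gaussian_shift (a := ((t / (f * z.im) : ℝ) : ℂ))
    (by rw [Complex.ofReal_re]; positivity) 0 ((f * m * z.re : ℝ) : ℂ)
  have e1 : ∀ n : ℤ, ((Real.exp (-Real.pi * t * qf f z (m, n)) : ℝ) : ℂ) =
      Complex.exp (-(Real.pi * (f * z.im) * t * m ^ 2 : ℝ)) *
      Complex.exp (-Real.pi * ((t / (f * z.im) : ℝ) : ℂ) * (n + (f * m * z.re : ℝ)) ^ 2 +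
        2 * Real.pi * 0 * (n + (f * m * z.re : ℝ))) := by
    intro n
    rw [qf_eq, Complex.ofReal_exp, ← Complex.exp_add]
    congr 1
    push_cast
    field_simp
    ring
  simp only [e1]
  rw [tsum_mul_left, hg]
  have e2 : 1 / ((t / (f * z.im) : ℝ) : ℂ) ^ (1 / 2 : ℂ) = (√(f * z.im / t) : ℝ) := by
    rw [show (1 / 2 : ℂ) = ((1 / 2 : ℝ) : ℂ) by push_cast; ring,
      ← Complex.ofReal_cpow (by positivity), ← Real.sqrt_eq_rpow, ← Complex.ofReal_one,
      ← Complex.ofReal_div, one_div, ← Real.sqrt_inv, inv_div]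
  rw [e2, mul_left_comm, ← tsum_mul_left]
  congr 2
  funext n
  rw [e, Complex.ofReal_exp, ← Complex.exp_add, ← Complex.exp_add]
  congr 1
  push_cast
  field_simp
  ring

/-- The form has discriminant `-4`, so its theta series satisfies a functional equation for
`t ↦ t⁻¹`: after Poisson summation `t` and `t⁻¹` trade the variables `m` and `n`. -/
theorem one_add_thetaQ_inv (z : ℍ) {t : ℝ} (ht : 0 < t) :
    1 + thetaQ f z t⁻¹ = t * (1 + thetaQ f z t) := by
  have hf := natCast_pos f
  have hy := z.im_pos
  have hg : ∀ u : ℝ, 0 < u →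
      Summable fun m : ℤ => Real.exp (-(Real.pi * (f * z.im) * u) * m ^ 2) :=
    fun u hu => by
      have := summable_exp_quadratic (A := Real.pi * (f * z.im) * u) (by positivity) 0 0
      simpa using this
  have hs : Summable (Function.uncurry fun m n : ℤ => e (m * n * (f * z.re)) *
      ((Real.exp (-Real.pi * (f * z.im) * (t * m ^ 2 + t⁻¹ * n ^ 2)) : ℝ) : ℂ)) := by
    refine Summable.of_norm (((hg t ht).mul_of_nonneg (hg t⁻¹ (inv_pos.mpr ht))
      (fun _ => (Real.exp_pos _).le) fun _ => (Real.exp_pos _).le).congr fun p => ?_)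
    simp only [Function.uncurry]
    rw [norm_mul, norm_e_real (by simp), one_mul, Complex.norm_real,
      Real.norm_of_nonneg (Real.exp_pos _).le, ← Real.exp_add]
    congr 1
    ring
  have h1 : ((1 + thetaQ f z t⁻¹ : ℝ) : ℂ) = ((t * (1 + thetaQ f z t) : ℝ) : ℂ) := by
    rw [Complex.ofReal_mul, one_add_thetaQ_eq f z ht, one_add_thetaQ_eq f z (inv_pos.mpr ht),
      ← mul_assoc (t : ℂ), ← hs.tsum_comm, ← Complex.ofReal_mul]
    congr 1
    · congr 1
      rw [div_inv_eq_mul, Real.sqrt_div' _ ht.le, Real.sqrt_mul' _ ht.le]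
      have := Real.mul_self_sqrt ht.le
      have h0 : √t ≠ 0 := (Real.sqrt_pos.mpr ht).ne'
      field_simp
      linear_combination this
    · congr 1; funext m; congr 1; funext n
      rw [inv_inv]
      congr 2
      · ring
      · congr 2; ring
  exact_mod_cast h1

/-! ### The completed Epstein zeta function -/

theorem measurable_qf (p : ℤ × ℤ) : Measurable fun z : ℍ => qf f z p := by
  simp only [qf_eq]
  have h1 := UpperHalfPlane.continuous_re.measurable
  have h2 := UpperHalfPlane.continuous_im.measurable
  fun_prop

theorem measurable_thetaQ : Measurable fun q : ℍ × ℝ => thetaQ f q.1 q.2 := by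
  refine Measurable.tsum fun p => ?_
  split_ifs
  · exact measurable_const
  · exact Real.measurable_exp.comp
      ((measurable_snd.const_mul _).mul ((measurable_qf f p).comp measurable_fst))

/-- Holomorphy of a parameter integral, from locally uniform integrable bounds. -/
theorem differentiable_integral_of_bounded {α : Type*} [MeasurableSpace α] {μ : Measure α}
    {G : α → ℂ → ℂ} (hm : ∀ s, AEStronglyMeasurable (fun a => G a s) μ)
    (hd : ∀ᵐ a ∂μ, Differentiable ℂ (G a))
    (hb : ∀ R : ℝ, ∃ B : α → ℝ, Integrable B μ ∧ ∀ᵐ a ∂μ, ∀ s : ℂ, ‖s‖ ≤ R → ‖G a s‖ ≤ B a) :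
    Differentiable ℂ fun s => ∫ a, G a s ∂μ := by
  intro s₀
  obtain ⟨B, hB, hle⟩ := hb (‖s₀‖ + 2)
  have hmem : ∀ s ∈ Metric.ball s₀ 1, ∀ w ∈ Metric.sphere s 1, ‖w‖ ≤ ‖s₀‖ + 2 := by
    intro s hs w hw
    rw [mem_ball_iff_norm] at hs
    rw [mem_sphere_iff_norm] at hw
    have : w = s₀ + (s - s₀) + (w - s) := by ring
    rw [this]
    exact (norm_add₃_le).trans (by linarith)
  refine (hasDerivAt_integral_of_dominated_loc_of_deriv_le (F := fun s a => G a s)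
    (F' := fun s a => deriv (G a) s) (bound := B) (Metric.ball_mem_nhds s₀ one_pos)
    (Filter.Eventually.of_forall hm) ?_ ?_ ?_ hB ?_).2.differentiableAt
  · refine hB.mono' (hm s₀) ?_
    filter_upwards [hle] with a ha
    exact ha s₀ (by linarith [norm_nonneg s₀])
  -- the derivative is a limit of difference quotients, hence measurable
  · have hc : ∀ n : ℕ, AEStronglyMeasurable
        (fun a => ((n : ℂ) + 1) * (G a (s₀ + ((n : ℂ) + 1)⁻¹) - G a s₀)) μ := fun n =>
      ((hm _).sub (hm _)).const_mul _
    refine aestronglyMeasurable_of_tendsto_ae Filter.atTop hc ?_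
    filter_upwards [hd] with a hda
    have h1 := (hda s₀).hasDerivAt.tendsto_slope_zero
    have h2 : Filter.Tendsto (fun n : ℕ => ((n : ℂ) + 1)⁻¹) Filter.atTop
        (nhdsWithin 0 {0}ᶜ) := by
      rw [tendsto_nhdsWithin_iff]
      refine ⟨?_, Filter.Eventually.of_forall fun n => ?_⟩
      · have := tendsto_one_div_add_atTop_nhds_zero_nat (𝕜 := ℂ)
        simpa using this
      · exact inv_ne_zero (Nat.cast_add_one_ne_zero n)
    refine (h1.comp h2).congr fun n => ?_
    simp [inv_inv]
  -- Cauchy's estimate on circles of radius `1`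
  · filter_upwards [hle, hd] with a ha hda s hs
    have := Complex.norm_deriv_le_of_forall_mem_sphere_norm_le (f := G a) (c := s) (C := B a)
      one_pos hda.diffContOnCl fun w hw => ha w (hmem s hs w hw)
    simpa using this
  · filter_upwards [hd] with a hda s _ using (hda s).hasDerivAt

/-- The entire part of the completed Epstein zeta function of the form `qf f z`. -/
def epsteinEntire (f : ℕ) (z : ℍ) (s : ℂ) : ℂ :=
  ∫ t in Set.Ioi (1 : ℝ), (thetaQ f z t : ℂ) * ((t : ℂ) ^ (s - 1) + (t : ℂ) ^ (-s))

theorem norm_epstein_integrand_le (f : ℕ) {z : ℍ} {t : ℝ} (ht : 1 < t) {s : ℂ} {R : ℕ}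
    (hs : ‖s‖ ≤ R) :
    ‖(thetaQ f z t : ℂ) * ((t : ℂ) ^ (s - 1) + (t : ℂ) ^ (-s))‖ ≤ thetaQ f z t * (2 * t ^ R) := by
  have ht0 : 0 < t := one_pos.trans ht
  have hs1 := (Complex.abs_re_le_norm s).trans hs
  have hs2 := abs_le.mp hs1
  rw [norm_mul, Complex.norm_real, Real.norm_of_nonneg (thetaQ_nonneg f z t)]
  refine mul_le_mul_of_nonneg_left ((norm_add_le _ _).trans ?_) (thetaQ_nonneg f z t)
  rw [Complex.norm_cpow_eq_rpow_re_of_pos ht0, Complex.norm_cpow_eq_rpow_re_of_pos ht0, two_mul]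
  refine add_le_add ?_ ?_ <;> rw [← Real.rpow_natCast] <;>
    refine Real.rpow_le_rpow_of_exponent_le ht.le ?_
  · rw [Complex.sub_re, Complex.one_re]; linarith [hs2.2]
  · rw [Complex.neg_re]; linarith [hs2.1]

/-- The integrand of `epsteinEntire` is dominated, at every cusp. -/
theorem exists_epstein_bound (R : ℕ) : ∃ C : ℝ, 0 < C ∧ ∀ (σ : SL(2, ℤ)),
    ∀ z ∈ ModularGroup.fd, ∀ t : ℝ, 1 < t →
      thetaQ f (σ • z) t * (2 * t ^ R) ≤ C * z.im ^ (R + 2) * (t ^ 2)⁻¹ := by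
  obtain ⟨C, hC0, hC⟩ := exists_thetaQ_le f (R + 2) (by omega)
  refine ⟨2 * C, by positivity, fun σ z hz t ht => ?_⟩
  have ht0 : 0 < t := one_pos.trans ht
  refine (mul_le_mul_of_nonneg_right (hC σ z hz t ht0).2 (by positivity)).trans (le_of_eq ?_)
  rw [pow_add t]
  field_simp

theorem integrableOn_inv_sq : IntegrableOn (fun t : ℝ => (t ^ 2)⁻¹) (Set.Ioi 1) := by
  refine (integrableOn_Ioi_rpow_of_lt (by norm_num : (-2 : ℝ) < -1) one_pos).congr_fun
    (fun t ht => ?_) measurableSet_Ioi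
  have : (0 : ℝ) < t := one_pos.trans ht
  simp only
  rw [Real.rpow_neg this.le, Real.rpow_two]

theorem measurable_epstein_integrand (s : ℂ) : Measurable fun q : ℍ × ℝ =>
    (thetaQ f q.1 q.2 : ℂ) * ((q.2 : ℂ) ^ (s - 1) + (q.2 : ℂ) ^ (-s)) := by
  have h1 := Complex.measurable_ofReal.comp (measurable_thetaQ f)
  have h2 : Measurable fun q : ℍ × ℝ => (q.2 : ℂ) :=
    Complex.measurable_ofReal.comp measurable_snd
  exact h1.mul ((h2.pow_const _).add (h2.pow_const _))

theorem differentiable_epsteinEntire (z : ℍ) : Differentiable ℂ (epsteinEntire f z) := by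
  refine differentiable_integral_of_bounded (fun s => ?_) ?_ fun R => ?_
  · exact ((measurable_epstein_integrand f s).comp measurable_prodMk_left).aestronglyMeasurable
  · refine (ae_restrict_iff' measurableSet_Ioi).mpr (Filter.Eventually.of_forall fun t ht => ?_)
    have h1 : (t : ℂ) ≠ 0 := Complex.ofReal_ne_zero.mpr (one_pos.trans ht).ne'
    exact (((differentiable_id.sub_const 1).const_cpow (Or.inl h1)).add
      (differentiable_id.neg.const_cpow (Or.inl h1))).const_mul _
  · obtain ⟨R', hR'⟩ := exists_nat_ge R
    obtain ⟨C, hC0, hC⟩ := exists_epstein_bound f R'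
    obtain ⟨σ, hσ⟩ := ModularGroup.exists_smul_mem_fd z
    refine ⟨_, integrableOn_inv_sq.const_mul (C * (σ • z).im ^ (R' + 2)),
      (ae_restrict_iff' measurableSet_Ioi).mpr (Filter.Eventually.of_forall fun t ht s hs => ?_)⟩
    have := hC σ⁻¹ _ hσ t ht
    rw [inv_smul_smul] at this
    exact (norm_epstein_integrand_le f ht (hs.trans hR')).trans this

theorem measurable_epsteinEntire (s : ℂ) : Measurable fun z => epsteinEntire f z s :=
  ((measurable_epstein_integrand f s).stronglyMeasurable.integral_prod_right
    (ν := volume.restrict (Set.Ioi 1))).measurable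

/-- Moderate growth at every cusp, locally uniformly in `s`. -/
theorem exists_norm_epsteinEntire_le (R : ℕ) : ∃ C : ℝ, 0 < C ∧ ∀ (σ : SL(2, ℤ)),
    ∀ z ∈ ModularGroup.fd, ∀ s : ℂ, ‖s‖ ≤ R →
      ‖epsteinEntire f (σ • z) s‖ ≤ C * z.im ^ (R + 2) := by
  obtain ⟨C, hC0, hC⟩ := exists_epstein_bound f R
  have h0 : 0 ≤ ∫ t in Set.Ioi (1 : ℝ), (t ^ 2)⁻¹ := integral_nonneg fun t => by positivity
  refine ⟨C * (1 + ∫ t in Set.Ioi (1 : ℝ), (t ^ 2)⁻¹), by positivity, fun σ z hz s hs => ?_⟩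
  · have h := norm_integral_le_of_norm_le (μ := volume.restrict (Set.Ioi 1))
      (integrableOn_inv_sq.const_mul (C * z.im ^ (R + 2)))
      ((ae_restrict_iff' measurableSet_Ioi).mpr (Filter.Eventually.of_forall fun t ht =>
        (norm_epstein_integrand_le f ht hs).trans (hC σ z hz t ht)))
    refine h.trans ?_
    rw [integral_const_mul, mul_right_comm]
    have := z.im_pos
    gcongr
    linarith

/-- Riemann's method: the Mellin integral is split at `t = 1`. -/
theorem mellin_thetaQ (z : ℍ) {s : ℂ} (hs : 1 < s.re) :
    mellin (fun t => (thetaQ f z t : ℂ)) s = epsteinEntire f z s - 1 / s - 1 / (1 - s) := by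
  have hint : ∀ s : ℂ, IntegrableOn (fun t : ℝ => (t : ℂ) ^ (s - 1) • (thetaQ f z t : ℂ))
      (Set.Ioi 1) := by
    intro s
    obtain ⟨R', hR'⟩ := exists_nat_ge ‖s‖
    obtain ⟨C, hC0, hC⟩ := exists_epstein_bound f R'
    obtain ⟨σ, hσ⟩ := ModularGroup.exists_smul_mem_fd z
    have hm : Measurable fun t : ℝ => (t : ℂ) ^ (s - 1) • (thetaQ f z t : ℂ) :=
      (Complex.measurable_ofReal.pow_const _).mul (Complex.measurable_ofReal.comp
        ((measurable_thetaQ f).comp measurable_prodMk_left))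
    refine Integrable.mono' (integrableOn_inv_sq.const_mul (C * (σ • z).im ^ (R' + 2)))
      hm.aestronglyMeasurable
      ((ae_restrict_iff' measurableSet_Ioi).mpr (Filter.Eventually.of_forall fun t ht => ?_))
    have h1 := hC σ⁻¹ _ hσ t ht
    rw [inv_smul_smul] at h1
    refine le_trans ?_ h1
    have ht0 : (0 : ℝ) < t := one_pos.trans ht
    rw [norm_smul, Complex.norm_real, Real.norm_of_nonneg (thetaQ_nonneg f z t), mul_comm,
      Complex.norm_cpow_eq_rpow_re_of_pos ht0]
    refine mul_le_mul_of_nonneg_left ?_ (thetaQ_nonneg f z t)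
    have h2 : t ^ (s - 1).re ≤ t ^ R' := by
      rw [← Real.rpow_natCast]
      refine Real.rpow_le_rpow_of_exponent_le (le_of_lt ht) ?_
      rw [Complex.sub_re, Complex.one_re]
      linarith [Complex.re_le_norm s]
    have : 0 < t ^ R' := by positivity
    linarith
  -- the part of the theta function over `t > 1`, and the same with `1` included
  let F : ℝ → ℂ := (Set.Ioi 1).indicator fun t => (thetaQ f z t : ℂ)
  let F' : ℝ → ℂ := (Set.Ici 1).indicator fun t => (thetaQ f z t : ℂ)
  have hsub : Set.Ioi (1 : ℝ) ⊆ Set.Ioi 0 := Set.Ioi_subset_Ioi zero_le_one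
  have hF : ∀ s, MellinConvergent F s ∧
      mellin F s = ∫ t in Set.Ioi (1 : ℝ), (t : ℂ) ^ (s - 1) • (thetaQ f z t : ℂ) := by
    intro s
    have : (fun t : ℝ => (t : ℂ) ^ (s - 1) • F t) =
        (Set.Ioi 1).indicator fun t : ℝ => (t : ℂ) ^ (s - 1) • (thetaQ f z t : ℂ) := by
      funext t; simp only [F, Set.indicator_apply]; split_ifs <;> simp
    rw [MellinConvergent, mellin, this, IntegrableOn, integrable_indicator_iff measurableSet_Ioi,
      integral_indicator measurableSet_Ioi, IntegrableOn, Measure.restrict_restrict_of_subset hsub]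
    exact ⟨hint s, rfl⟩
  have hFF : F' =ᵐ[volume] F := indicator_ae_eq_of_ae_eq_set Ioi_ae_eq_Ici.symm
  have hF' : ∀ s, MellinConvergent F' s ∧ mellin F' s = mellin F s := by
    intro s
    have h1 : (fun t : ℝ => (t : ℂ) ^ (s - 1) • F' t) =ᵐ[volume.restrict (Set.Ioi 0)]
        fun t : ℝ => (t : ℂ) ^ (s - 1) • F t := by
      filter_upwards [ae_restrict_of_ae hFF] with t ht
      rw [ht]
    exact ⟨(hF s).1.congr h1.symm, integral_congr_ae h1⟩
  -- the part over `t ≤ 1` is brought to `t ≥ 1` by the functional equation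
  have hG : HasMellin (fun t : ℝ => (t : ℂ) ^ (-1 : ℂ) • F' t⁻¹) s (mellin F (1 - s)) := by
    refine ⟨MellinConvergent.cpow_smul.mpr ?_, ?_⟩
    · have h1 := MellinConvergent.comp_rpow (f := F') (s := s + -1) (a := -1) (by norm_num)
      simp only [Real.rpow_neg_one] at h1
      exact h1.mpr (hF' _).1
    · rw [mellin_cpow_smul, mellin_comp_inv, (hF' _).2]
      congr 1
      ring
  have hI := hasMellin_sub (hasMellin_cpow_Ioc (-1) (s := s)
    (by rw [Complex.neg_re, Complex.one_re]; linarith)).1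
    (hasMellin_one_Ioc (s := s) (by linarith)).1
  have hsum := hasMellin_add (hasMellin_add (hF s).1 hG.1).1 hI.1
  have heq : ∀ t ∈ Set.Ioi (0 : ℝ), (thetaQ f z t : ℂ) =
      F t + (t : ℂ) ^ (-1 : ℂ) • F' t⁻¹ +
        ((Set.Ioc 0 1).indicator (fun t : ℝ => (t : ℂ) ^ (-1 : ℂ)) t -
          (Set.Ioc 0 1).indicator (fun _ => 1) t) := by
    intro t ht
    have ht0 : (0 : ℝ) < t := ht
    rcases lt_or_ge 1 t with h1 | h1
    · have h2 : ¬ (1 ≤ t⁻¹) := by rw [not_le]; exact inv_lt_one_of_one_lt₀ h1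
      simp [F, F', h1, h2]
    · have h2 : 1 ≤ t⁻¹ := (one_le_inv₀ ht0).mpr h1
      have h3 := one_add_thetaQ_inv f z ht0
      have h4 : (thetaQ f z t⁻¹ : ℂ) = t * (1 + thetaQ f z t) - 1 := by
        rw [eq_sub_iff_add_eq, add_comm]
        exact_mod_cast h3
      have ht1 : (t : ℂ) ≠ 0 := Complex.ofReal_ne_zero.mpr ht0.ne'
      simp [F, F', h1, h2, ht0, Complex.cpow_neg_one, h4]
      field_simp
      ring
  have hm : mellin (fun t => (thetaQ f z t : ℂ)) s = mellin (fun t => F t +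
      (t : ℂ) ^ (-1 : ℂ) • F' t⁻¹ + ((Set.Ioc 0 1).indicator (fun t : ℝ => (t : ℂ) ^ (-1 : ℂ)) t -
          (Set.Ioc 0 1).indicator (fun _ => 1) t)) s :=
    setIntegral_congr_fun measurableSet_Ioi fun t ht => by simp only [heq t ht]
  have hE : epsteinEntire f z s = mellin F s + mellin F (1 - s) := by
    rw [(hF _).2, (hF _).2, ← integral_add (hint s) (hint (1 - s)), epsteinEntire]
    refine setIntegral_congr_fun measurableSet_Ioi fun t _ => ?_
    simp only [smul_eq_mul, show 1 - s - 1 = -s by ring]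
    ring
  rw [hm, hsum.2, (hasMellin_add (hF s).1 hG.1).2, hG.2, hI.2,
    (hasMellin_cpow_Ioc (-1) (s := s) (by rw [Complex.neg_re, Complex.one_re]; linarith)).2,
    (hasMellin_one_Ioc (s := s) (by linarith)).2, hE]
  have h5 : s + -1 ≠ 0 := fun h => by
    have := congrArg Complex.re h; simp at this; linarith
  have h6 : 1 - s ≠ 0 := fun h => h5 (by linear_combination -h)
  field_simp
  ring

/-- Absolute convergence and analytic continuation of the Epstein zeta function. The pair `(0, 0)`
may be included, as `0 ^ (-s) = 0` for `s ≠ 0`. -/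
theorem hasSum_epstein (z : ℍ) {s : ℂ} (hs : 1 < s.re) :
    HasSum (fun p : ℤ × ℤ => (Real.pi : ℂ) ^ (-s) * Complex.Gamma s * ((qf f z p : ℝ) : ℂ) ^ (-s))
      (epsteinEntire f z s - 1 / s - 1 / (1 - s)) := by
  have hs0 : s ≠ 0 := fun h => by rw [h, Complex.zero_re] at hs; linarith
  rw [← mellin_thetaQ f z hs]
  have h := hasSum_mellin (a := fun p : ℤ × ℤ => if p = 0 then 0 else 1)
    (p := fun p => Real.pi * qf f z p) (F := fun t => (thetaQ f z t : ℂ)) (s := s)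
    (fun p => ?_) (by linarith) (fun t ht => ?_) ?_
  · refine hasSum_of_eq h (fun p => ?_) rfl
    split_ifs with hp
    · have : qf f z p = 0 := by simp [hp, qf]
      rw [this, Complex.ofReal_zero, Complex.zero_cpow (neg_ne_zero.mpr hs0)]
      simp
    · rw [Complex.ofReal_mul, Complex.mul_cpow_ofReal_nonneg Real.pi_pos.le (qf_nonneg f z p),
        Complex.cpow_neg, Complex.cpow_neg]
      field_simp
  · rcases eq_or_ne p 0 with hp | hp
    · left; simp [hp]
    · right; exact mul_pos Real.pi_pos (qf_pos f z hp)
  · have h1 := Complex.hasSum_ofReal.mpr (summable_thetaQ f z ht).hasSum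
    refine hasSum_of_eq h1 (fun p => ?_) rfl
    split_ifs <;> simp <;> ring_nf
  · have h1 := (summable_qf_rpow f z hs).mul_left (Real.pi ^ (-s.re))
    refine Summable.of_nonneg_of_le (fun p => by
      have := qf_nonneg f z p
      positivity) (fun p => ?_) h1
    rw [← Real.mul_rpow Real.pi_pos.le (qf_nonneg f z p), Real.rpow_neg
      (mul_nonneg Real.pi_pos.le (qf_nonneg f z p)), ← one_div]
    have : ‖(if p = 0 then 0 else 1 : ℂ)‖ ≤ 1 := by split_ifs <;> simp
    have := qf_nonneg f z p
    gcongr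

end

section

variable (N : ℕ) [NeZero N]

/-! ### The Eisenstein series of weight `0` -/

/-- The lower row of the chosen representative of a coset. A coset determines it up to sign. -/
def lowerRow (q : Cosets N) : ℤ × ℤ :=
  ((Quotient.out q : CongruenceSubgroup.Gamma0 N).1 1 0,
    (Quotient.out q : CongruenceSubgroup.Gamma0 N).1 1 1)

theorem SL_mul_inv_apply_one_zero (g h : SL(2, ℤ)) :
    (g * h⁻¹) 1 0 = g 1 0 * h 1 1 - g 1 1 * h 1 0 := by
  rw [Matrix.SpecialLinearGroup.coe_mul, Matrix.SpecialLinearGroup.SL2_inv_expl, Matrix.mul_apply,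
    Fin.sum_univ_two]
  simp
  ring

theorem lowerRow_isCoprime (N : ℕ) (q : Cosets N) : IsCoprime (lowerRow N q).1 (lowerRow N q).2 :=
  ModularGroup.bottom_row_coprime _

theorem dvd_lowerRow (N : ℕ) (q : Cosets N) : (N : ℤ) ∣ (lowerRow N q).1 := by
  have h := (Quotient.out q : CongruenceSubgroup.Gamma0 N).2
  rw [CongruenceSubgroup.Gamma0_mem] at h
  exact (ZMod.intCast_zmod_eq_zero_iff_dvd _ N).mp h

theorem eq_of_lowerRow_det_eq_zero (N : ℕ) {q q' : Cosets N}
    (h : (lowerRow N q').1 * (lowerRow N q).2 - (lowerRow N q').2 * (lowerRow N q).1 = 0) :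
    q = q' := by
  refine Quotient.out_equiv_out.mp (QuotientGroup.rightRel_apply.mpr ?_)
  rw [Subgroup.mem_subgroupOf]
  change ((Quotient.out q').1 * (Quotient.out q).1⁻¹) 1 0 = 0
  rw [SL_mul_inv_apply_one_zero]
  exact h

/-- Nonzero integral multiples of the lower rows. Both signs are needed, as each coset gives only
one of the two coprime pairs `±(c, d)`. -/
def scaledRow (p : {k : ℤ // k ≠ 0} × Cosets N) : ℤ × ℤ :=
  (p.1 * (lowerRow N p.2).1, p.1 * (lowerRow N p.2).2)

theorem scaledRow_injective (N : ℕ) : Function.Injective (scaledRow N) := by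
  rintro ⟨⟨k, hk⟩, q⟩ ⟨⟨k', hk'⟩, q'⟩ h
  obtain ⟨h1, h2⟩ := Prod.mk.inj h
  simp only at h1 h2
  have hq : q = q' := by
    refine eq_of_lowerRow_det_eq_zero N ?_
    refine (mul_eq_zero.mp (?_ : (k * k') * _ = 0)).resolve_left (mul_ne_zero hk hk')
    linear_combination k' * (lowerRow N q').1 * h2 - k' * (lowerRow N q').2 * h1
  subst hq
  have hk : k = k' := by
    obtain ⟨u, v, huv⟩ := lowerRow_isCoprime N q
    linear_combination u * h1 + v * h2 - (k - k') * huv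
  subst hk
  rfl

theorem mem_range_scaledRow (N : ℕ) {p : ℤ × ℤ} (hp : p ≠ 0) (h1 : (N : ℤ) ∣ p.1)
    (h2 : IsCoprime p.2 (N : ℤ)) : p ∈ Set.range (scaledRow N) := by
  obtain ⟨m, n⟩ := p
  simp only at h1 h2
  have hg : 0 < Int.gcd m n := by
    rw [Int.gcd_pos_iff]
    by_contra! h
    exact hp (Prod.ext h.1 h.2)
  obtain ⟨c, d, hcd, hm, hn⟩ := Int.exists_gcd_one hg
  obtain ⟨γ, -, hγ⟩ := ModularGroup.bottom_row_surj (R := ℤ) (a := ![c, d])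
    (by simpa using Int.isCoprime_iff_gcd_eq_one.mpr hcd)
  have hγ0 : γ 1 0 = c := congrFun hγ 0
  have hγ1 : γ 1 1 = d := congrFun hγ 1
  have hNc : (N : ℤ) ∣ c := by
    refine IsCoprime.dvd_of_dvd_mul_right (?_ : IsCoprime (N : ℤ) (Int.gcd m n)) (hm ▸ h1)
    exact (IsCoprime.of_isCoprime_of_dvd_left h2 (Int.gcd_dvd_right m n)).symm
  have hmem : γ ∈ CongruenceSubgroup.Gamma0 N := by
    rw [CongruenceSubgroup.Gamma0_mem, hγ0]
    exact (ZMod.intCast_zmod_eq_zero_iff_dvd _ N).mpr hNc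
  let q : Cosets N := Quotient.mk _ ⟨γ, hmem⟩
  have hu : γ * ((Quotient.out q).1)⁻¹ ∈ stabInfty :=
    Subgroup.mem_subgroupOf.mp (QuotientGroup.rightRel_apply.mp
      (Quotient.mk_out (s := QuotientGroup.rightRel
        (stabInfty.subgroupOf (CongruenceSubgroup.Gamma0 N))) (⟨γ, hmem⟩ :
          CongruenceSubgroup.Gamma0 N)))
  set u := γ * ((Quotient.out q).1)⁻¹ with hudef
  have hγu : γ = u * (Quotient.out q).1 := by rw [hudef, inv_mul_cancel_right]
  have hu0 : u 1 0 = 0 := hu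
  have hu1 : u 1 1 ≠ 0 := fun h => by
    have := u.det_coe
    rw [Matrix.det_fin_two, hu0, h] at this
    simp at this
  have e1 : c = u 1 1 * (lowerRow N q).1 := by
    rw [← hγ0, hγu, Matrix.SpecialLinearGroup.coe_mul, Matrix.mul_apply, Fin.sum_univ_two, hu0]
    simp [lowerRow]
  have e2 : d = u 1 1 * (lowerRow N q).2 := by
    rw [← hγ1, hγu, Matrix.SpecialLinearGroup.coe_mul, Matrix.mul_apply, Fin.sum_univ_two, hu0]
    simp [lowerRow]
  refine ⟨(⟨Int.gcd m n * u 1 1, mul_ne_zero (by exact_mod_cast hg.ne') hu1⟩, q), ?_⟩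
  simp only [scaledRow]
  refine Prod.ext ?_ ?_
  · simp only; rw [mul_assoc, ← e1, mul_comm]; exact hm.symm
  · simp only; rw [mul_assoc, ← e2, mul_comm]; exact hn.symm

theorem eisensteinTerm_eq (N : ℕ) (z : ℍ) (s : ℂ) (q : Cosets N) :
    eisensteinTerm N z s q = ((qf 1 z (lowerRow N q) : ℝ) : ℂ) ^ (-s) := by
  have h : (((Quotient.out q : CongruenceSubgroup.Gamma0 N) : SL(2, ℤ)) • z : ℍ).im =
      (qf 1 z (lowerRow N q))⁻¹ := by
    rw [ModularGroup.im_smul_eq_div_normSq, Complex.normSq_eq_norm_sq, qf, lowerRow]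
    simp [UpperHalfPlane.denom]
  rw [eisensteinTerm, h, Complex.cpow_neg, Complex.ofReal_inv, Complex.inv_cpow]
  rw [Complex.arg_ofReal_of_nonneg (qf_nonneg 1 z _)]
  exact Real.pi_pos.ne

theorem lowerRow_injective (N : ℕ) : Function.Injective (lowerRow N) := fun q q' h =>
  eq_of_lowerRow_det_eq_zero N (by rw [h]; ring)

theorem norm_qf_cpow (f : ℕ) [NeZero f] (z : ℍ) {s : ℂ} (hs : s.re ≠ 0) (p : ℤ × ℤ) :
    ‖((qf f z p : ℝ) : ℂ) ^ (-s)‖ = qf f z p ^ (-s.re) := by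
  rw [Complex.norm_cpow_eq_rpow_re_of_nonneg (qf_nonneg f z p) (by simpa using hs), Complex.neg_re]

theorem summable_qf_cpow (f : ℕ) [NeZero f] (z : ℍ) {s : ℂ} (hs : 1 < s.re) :
    Summable fun p => ((qf f z p : ℝ) : ℂ) ^ (-s) := by
  refine Summable.of_norm ((summable_qf_rpow f z hs).congr fun p => ?_)
  rw [norm_qf_cpow f z (by linarith)]

theorem summable_eisensteinTerm (N : ℕ) (z : ℍ) {s : ℂ} (hs : 1 < s.re) :
    Summable (eisensteinTerm N z s) := by
  refine ((summable_qf_cpow 1 z hs).comp_injective (lowerRow_injective N)).congr fun q => ?_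
  rw [eisensteinTerm_eq]
  rfl

/-- The Dirichlet series of `ζ^{(N)}`, over positive and negative integers. -/
theorem hasSum_two_mul_zetaN {s : ℂ} (hs : 1 < s.re) :
    (Summable fun k : ℤ => if IsCoprime k (N : ℤ) then (((k : ℝ) ^ 2 : ℝ) : ℂ) ^ (-s) else 0) ∧
    ∑' k : ℤ, (if IsCoprime k (N : ℤ) then (((k : ℝ) ^ 2 : ℝ) : ℂ) ^ (-s) else 0) =
      2 * zetaN N (2 * s) := by
  have hs0 : s ≠ 0 := fun h => by rw [h, Complex.zero_re] at hs; linarith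
  have hsum : Summable fun k : ℤ =>
      if IsCoprime k (N : ℤ) then (((k : ℝ) ^ 2 : ℝ) : ℂ) ^ (-s) else 0 := by
    have h1 := (summable_sum_sq_rpow hs).comp_injective
      (i := fun k : ℤ => ((k, 0) : ℤ × ℤ)) fun a b h => (Prod.mk.inj h).1
    refine Summable.of_norm_bounded h1 fun k => ?_
    split_ifs
    · rw [Complex.norm_cpow_eq_rpow_re_of_nonneg (by positivity) (by simp; linarith)]
      simp [Function.comp]
    · rw [norm_zero]; simp only [Function.comp]; positivity
  refine ⟨hsum, ?_⟩
  rw [tsum_int_eq_zero_add_two_mul_tsum_pnat (fun k => by simp [IsCoprime.neg_left_iff]) hsum]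
  have h0 : (if IsCoprime (0 : ℤ) (N : ℤ) then ((((0 : ℤ) : ℝ) ^ 2 : ℝ) : ℂ) ^ (-s) else 0) =
      0 := by
    split_ifs <;> simp [hs0]
  rw [h0, zero_add, nsmul_eq_mul, Nat.cast_ofNat]
  congr 1
  have h2s : 1 < (2 * s).re := by simp; linarith
  have h2s1 : 2 * s ≠ 1 := fun h => by rw [h] at h2s; simp at h2s
  rw [zetaN, mul_comm, ← DirichletCharacter.LFunctionTrivChar_eq_mul_riemannZeta h2s1,
    DirichletCharacter.LFunctionTrivChar, DirichletCharacter.LFunction_eq_LSeries _ h2s, LSeries]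
  have hterm : ∀ n : ℕ, LSeries.term (fun n => (1 : DirichletCharacter ℂ N) n) (2 * s) n =
      if IsCoprime (n : ℤ) (N : ℤ) then ((((n : ℤ) : ℝ) ^ 2 : ℝ) : ℂ) ^ (-s) else 0 := by
    intro n
    rcases eq_or_ne n 0 with rfl | hn
    · simp [hs0]
    · rw [LSeries.term_of_ne_zero hn]
      split_ifs with hc
      · rw [MulChar.one_apply ((ZMod.isUnit_iff_coprime n N).mpr
          (Nat.isCoprime_iff_coprime.mp hc)), Complex.cpow_neg, one_div,
          show (2 * s) = ((2 : ℕ) : ℂ) * s by push_cast; ring]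
        congr 1
        rw [Complex.ofReal_pow, Complex.ofReal_intCast, Int.cast_natCast, Complex.cpow_nat_mul,
          sq, sq, Complex.natCast_mul_natCast_cpow]
      · rw [MulChar.map_nonunit _ (fun h => hc (Nat.isCoprime_iff_coprime.mpr
          ((ZMod.isUnit_iff_coprime n N).mp h))), zero_div]
  simp only [hterm]
  rw [← tsum_zero_pnat_eq_tsum_nat]
  · simp [hs0]
  · exact hsum.comp_injective Nat.cast_injective

theorem sum_moebius_dvd (n : ℤ) :
    ∑ d ∈ N.divisors, (if (d : ℤ) ∣ n then (ArithmeticFunction.moebius d : ℂ) else 0) =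
      if IsCoprime n (N : ℤ) then 1 else 0 := by
  have hN := NeZero.ne N
  have h1 : N.divisors.filter (fun d : ℕ => (d : ℤ) ∣ n) = (Int.gcd n N).divisors := by
    ext d
    rw [Finset.mem_filter, Nat.mem_divisors, Nat.mem_divisors]
    constructor
    · rintro ⟨⟨h1, -⟩, h2⟩
      exact ⟨Int.dvd_gcd h2 (Int.natCast_dvd_natCast.mpr h1), by simp [Int.gcd_eq_zero_iff, hN]⟩
    · rintro ⟨h1, -⟩
      have h3 : (d : ℤ) ∣ Int.gcd n N := Int.natCast_dvd_natCast.mpr h1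
      exact ⟨⟨Int.natCast_dvd_natCast.mp (h3.trans (Int.gcd_dvd_right _ _)), hN⟩,
        h3.trans (Int.gcd_dvd_left _ _)⟩
  have h3 : (if IsCoprime n (N : ℤ) then (1 : ℂ) else 0) = if Int.gcd n N = 1 then 1 else 0 :=
    if_congr Int.isCoprime_iff_gcd_eq_one rfl rfl
  rw [← Finset.sum_filter, h1, h3]
  have h2 := congrArg (fun F : ArithmeticFunction ℤ => F (Int.gcd n N))
    ArithmeticFunction.moebius_mul_coe_zeta
  simp only [ArithmeticFunction.coe_mul_zeta_apply, ArithmeticFunction.one_apply] at h2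
  exact_mod_cast h2

/-- The entire part of the normalized Eisenstein series of weight `0`. -/
def eisEntire (N : ℕ) (z : ℍ) (s : ℂ) : ℂ :=
  1 / 2 * ∑ f ∈ N.divisors, (ArithmeticFunction.moebius (N / f) : ℂ) * (f : ℂ) ^ s *
    epsteinEntire f z s

/-- The polar part of the normalized Eisenstein series; it does not depend on the point `z`. -/
def eisPolar (N : ℕ) (s : ℂ) : ℂ :=
  1 / 2 * ∑ f ∈ N.divisors, (ArithmeticFunction.moebius (N / f) : ℂ) * (f : ℂ) ^ s *
    (1 / s + 1 / (1 - s))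

/-- Möbius inversion for the condition that `n` is prime to `N`. -/
theorem tsum_coprime_eq_sum_divisors (z : ℍ) {s : ℂ} (hs : 1 < s.re) :
    ∑' p : ℤ × ℤ, (if (N : ℤ) ∣ p.1 ∧ IsCoprime p.2 (N : ℤ) then
      ((qf 1 z p : ℝ) : ℂ) ^ (-s) else 0) =
    ∑ d ∈ N.divisors, (ArithmeticFunction.moebius d : ℂ) *
      ∑' p : ℤ × ℤ, ((qf 1 z (N * p.1, d * p.2) : ℝ) : ℂ) ^ (-s) := by
  have hN : (N : ℤ) ≠ 0 := by exact_mod_cast NeZero.ne N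
  have hg := summable_qf_cpow 1 z hs
  have hinj : Function.Injective fun p : ℤ × ℤ => ((N * p.1, p.2) : ℤ × ℤ) := fun p q h => by
    obtain ⟨h1, h2⟩ := Prod.mk.inj h
    exact Prod.ext (mul_left_cancel₀ hN h1) h2
  rw [← hinj.tsum_eq]
  · have h1 : ∀ p : ℤ × ℤ, (if (N : ℤ) ∣ N * p.1 ∧ IsCoprime p.2 (N : ℤ) then
        ((qf 1 z (N * p.1, p.2) : ℝ) : ℂ) ^ (-s) else 0) =
        ∑ d ∈ N.divisors, (ArithmeticFunction.moebius d : ℂ) *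
          (if (d : ℤ) ∣ p.2 then ((qf 1 z (N * p.1, p.2) : ℝ) : ℂ) ^ (-s) else 0) := by
      intro p
      have h2 := congrArg (fun x : ℂ => x * ((qf 1 z (N * p.1, p.2) : ℝ) : ℂ) ^ (-s))
        (sum_moebius_dvd N p.2)
      simp only [Finset.sum_mul] at h2
      rw [if_congr (and_iff_right (dvd_mul_right _ _)) rfl rfl]
      refine Eq.trans ?_ (h2.symm.trans (Finset.sum_congr rfl fun d _ => ?_))
      · split_ifs <;> simp
      · split_ifs <;> simp
    simp only [h1]
    have hs1 : ∀ d : ℕ, Summable fun p : ℤ × ℤ => (ArithmeticFunction.moebius d : ℂ) *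
        (if (d : ℤ) ∣ p.2 then ((qf 1 z (N * p.1, p.2) : ℝ) : ℂ) ^ (-s) else 0) := fun d => by
      refine Summable.mul_left _
        (Summable.of_norm_bounded (hg.comp_injective hinj).norm fun p => ?_)
      split_ifs
      · rfl
      · rw [norm_zero]; exact norm_nonneg _
    rw [Summable.tsum_finsetSum fun d _ => hs1 d]
    refine Finset.sum_congr rfl fun d hd => ?_
    rw [tsum_mul_left]
    congr 1
    have hd0 : (d : ℤ) ≠ 0 := by exact_mod_cast (Nat.pos_of_mem_divisors hd).ne'
    have hinj' : Function.Injective fun p : ℤ × ℤ => ((p.1, d * p.2) : ℤ × ℤ) := fun p q h => by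
      obtain ⟨h1, h2⟩ := Prod.mk.inj h
      exact Prod.ext h1 (mul_left_cancel₀ hd0 h2)
    rw [← hinj'.tsum_eq]
    · simp
    · rintro ⟨m, n⟩ hp
      rw [Function.mem_support] at hp
      obtain ⟨k, hk⟩ := (ite_ne_right_iff.mp hp).1
      exact ⟨(m, k), by simp only at hk; simp [hk]⟩
  · rintro ⟨m, n⟩ hp
    rw [Function.mem_support] at hp
    obtain ⟨k, hk⟩ := (ite_ne_right_iff.mp hp).1.1
    exact ⟨(k, n), by simp only at hk; simp [hk]⟩

/-- Every nonzero pair `(m, n)` with `N ∣ m` and `n` prime to `N` is, uniquely, a multiple of the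
lower row of a coset, by an integer prime to `N`. -/
theorem two_mul_zetaN_mul_eisensteinSeries (z : ℍ) {s : ℂ} (hs : 1 < s.re) :
    2 * zetaN N (2 * s) * eisensteinSeries N z s =
      ∑' p : ℤ × ℤ, (if (N : ℤ) ∣ p.1 ∧ IsCoprime p.2 (N : ℤ) then
        ((qf 1 z p : ℝ) : ℂ) ^ (-s) else 0) := by
  have hs0 : s ≠ 0 := fun h => by rw [h, Complex.zero_re] at hs; linarith
  obtain ⟨h1, h2⟩ := hasSum_two_mul_zetaN N hs
  have h3 := summable_eisensteinTerm N z hs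
  have h4 : ∑' k : {k : ℤ // k ≠ 0}, (if IsCoprime k.1 (N : ℤ) then
      (((k.1 : ℝ) ^ 2 : ℝ) : ℂ) ^ (-s) else 0) = 2 * zetaN N (2 * s) := by
    rw [← h2]
    refine tsum_subtype_eq_of_support_subset (f := fun k : ℤ => if IsCoprime k (N : ℤ) then
      (((k : ℝ) ^ 2 : ℝ) : ℂ) ^ (-s) else 0) (s := {k : ℤ | k ≠ 0}) fun k hk => ?_
    rintro rfl
    exact hk (by simp [hs0])
  have h5 : Summable fun k : {k : ℤ // k ≠ 0} => if IsCoprime k.1 (N : ℤ) then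
      (((k.1 : ℝ) ^ 2 : ℝ) : ℂ) ^ (-s) else 0 := h1.comp_injective Subtype.val_injective
  rw [← h4, eisensteinSeries, tsum_mul_tsum_of_summable_norm h5.norm h3.norm,
    ← (scaledRow_injective N).tsum_eq]
  · congr 1
    funext p
    obtain ⟨⟨k, hk⟩, q⟩ := p
    have hcd := lowerRow_isCoprime N q
    have hq : IsCoprime (lowerRow N q).2 (N : ℤ) :=
      (IsCoprime.of_isCoprime_of_dvd_left hcd (dvd_lowerRow N q)).symm
    have hiff : ((N : ℤ) ∣ (scaledRow N (⟨k, hk⟩, q)).1 ∧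
        IsCoprime (scaledRow N (⟨k, hk⟩, q)).2 (N : ℤ)) ↔ IsCoprime k (N : ℤ) := by
      rw [scaledRow, IsCoprime.mul_left_iff]
      exact ⟨fun h => h.2.1, fun h => ⟨(dvd_lowerRow N q).mul_left _, h, hq⟩⟩
    have hqf : qf 1 z (scaledRow N (⟨k, hk⟩, q)) = (k : ℝ) ^ 2 * qf 1 z (lowerRow N q) := by
      rw [qf, qf, scaledRow]
      have : ((1 : ℕ) : ℂ) * ((k * (lowerRow N q).1 : ℤ) : ℂ) * z +
          ((k * (lowerRow N q).2 : ℤ) : ℂ) =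
          (k : ℂ) * (((1 : ℕ) : ℂ) * (lowerRow N q).1 * z + (lowerRow N q).2) := by
        push_cast; ring
      simp only
      rw [this, norm_mul, mul_pow, mul_div_assoc]
      congr 1
      rw [Complex.norm_intCast, sq_abs]
    rw [eisensteinTerm_eq, hqf, Complex.ofReal_mul, Complex.mul_cpow_ofReal_nonneg (sq_nonneg _)
      (qf_nonneg 1 z _)]
    by_cases hk' : IsCoprime k (N : ℤ)
    · rw [if_pos hk', if_pos (hiff.mpr hk')]
    · rw [if_neg hk', if_neg (fun h => hk' (hiff.mp h)), zero_mul]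
  · intro p hp
    rw [Function.mem_support] at hp
    obtain ⟨h5, h6⟩ := ite_ne_right_iff.mp hp
    refine mem_range_scaledRow N ?_ h5.1 h5.2
    rintro rfl
    exact h6 (by simp [qf, hs0])

theorem normalizedSeries_eq (z : ℍ) {s : ℂ} (hs : 1 < s.re) :
    normalizedSeries N z s = eisEntire N z s - eisPolar N s := by
  have hN := NeZero.ne N
  have h1 : normalizedSeries N z s = 1 / 2 * ((N : ℂ) ^ (2 * s) * ((Real.pi : ℂ) ^ (-s) *
      Complex.Gamma s) * (2 * zetaN N (2 * s) * eisensteinSeries N z s)) := by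
    rw [normalizedSeries]; ring
  rw [h1, two_mul_zetaN_mul_eisensteinSeries N z hs, tsum_coprime_eq_sum_divisors N z hs,
    eisEntire, eisPolar, ← mul_sub, ← Finset.sum_sub_distrib, ← Nat.sum_div_divisors,
    Finset.mul_sum]
  congr 1
  refine Finset.sum_congr rfl fun f hf => ?_
  have hfN := Nat.dvd_of_mem_divisors hf
  obtain ⟨d, hd⟩ := hfN
  have hf0 : f ≠ 0 := fun h => hN (by rw [hd, h, zero_mul])
  have hd0 : d ≠ 0 := fun h => hN (by rw [hd, h, mul_zero])
  have : NeZero f := ⟨hf0⟩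
  have hdiv : N / f = d := by rw [hd, Nat.mul_div_cancel_left _ (Nat.pos_of_ne_zero hf0)]
  rw [hdiv, ← mul_sub, ← sub_sub, ← (hasSum_epstein f z hs).tsum_eq, tsum_mul_left]
  -- `|N m z + d n|² = d² |f m z + n|²` for `N = d f`
  have hqf : ∀ p : ℤ × ℤ, ((qf 1 z (N * p.1, d * p.2) : ℝ) : ℂ) ^ (-s) =
      ((d : ℂ) ^ (-s)) ^ 2 * (f : ℂ) ^ (-s) * ((qf f z p : ℝ) : ℂ) ^ (-s) := by
    intro p
    have e1 : qf 1 z (N * p.1, d * p.2) = (d : ℝ) * (d * (f * qf f z p)) := by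
      have e2 : ((1 : ℕ) : ℂ) * ((N * p.1 : ℤ) : ℂ) * z + ((d * p.2 : ℤ) : ℂ) =
          (d : ℂ) * ((f : ℂ) * p.1 * z + p.2) := by
        rw [hd]; push_cast; ring
      have := z.im_pos
      have : (f : ℝ) ≠ 0 := by exact_mod_cast hf0
      rw [qf, qf]
      simp only
      rw [e2, norm_mul, Complex.norm_natCast]
      push_cast
      field_simp
    have hq0 := qf_nonneg f z p
    rw [e1, Complex.ofReal_mul, Complex.mul_cpow_ofReal_nonneg (by positivity) (by positivity),
      Complex.ofReal_mul, Complex.mul_cpow_ofReal_nonneg (by positivity) (by positivity),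
      Complex.ofReal_mul, Complex.mul_cpow_ofReal_nonneg (by positivity) (by positivity)]
    push_cast
    ring
  simp only [hqf]
  rw [tsum_mul_left]
  have hdC : (d : ℂ) ≠ 0 := by exact_mod_cast hd0
  have hfC : (f : ℂ) ≠ 0 := by exact_mod_cast hf0
  have hNC : (N : ℂ) ^ (2 * s) * (((d : ℂ) ^ (-s)) ^ 2 * (f : ℂ) ^ (-s)) = (f : ℂ) ^ s := by
    rw [show (2 * s) = ((2 : ℕ) : ℂ) * s by push_cast; ring, Complex.cpow_nat_mul, hd, Nat.cast_mul,
      Complex.natCast_mul_natCast_cpow, Complex.cpow_neg, Complex.cpow_neg]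
    have h5 : (d : ℂ) ^ s ≠ 0 := by simp [Complex.cpow_eq_zero_iff, hdC]
    have h6 : (f : ℂ) ^ s ≠ 0 := by simp [Complex.cpow_eq_zero_iff, hfC]
    field_simp
  rw [← hNC]
  ring

/-! ### Meromorphic continuations -/

theorem toMeromorphicNFOn_eventuallyEq {F : ℂ → ℂ} (hF : MeromorphicOn F Set.univ) {s : ℂ}
    (hs : AnalyticAt ℂ F s) : toMeromorphicNFOn F Set.univ =ᶠ[nhds s] F := by
  have h := toMeromorphicNFOn_eq_toMeromorphicNFAt_on_nhds hF (Set.mem_univ s)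
  rwa [toMeromorphicNFAt_eq_self.mpr hs.meromorphicNFAt] at h

theorem isMeromorphicContinuation_toMeromorphicNFOn {f F : ℂ → ℂ} {U : Set ℂ}
    (hF : MeromorphicOn F Set.univ) (ha : AnalyticOnNhd ℂ F U) (h : Set.EqOn F f U) :
    IsMeromorphicContinuation f U (toMeromorphicNFOn F Set.univ) :=
  ⟨meromorphicNFOn_toMeromorphicNFOn F _, fun s hs =>
    (toMeromorphicNFOn_eventuallyEq hF (ha s hs)).eq_of_nhds.trans (h hs)⟩

theorem isMeromorphicContinuation_meromorphicContinuation {f F : ℂ → ℂ} {U : Set ℂ}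
    (hF : MeromorphicOn F Set.univ) (ha : AnalyticOnNhd ℂ F U) (h : Set.EqOn F f U) :
    IsMeromorphicContinuation f U (meromorphicContinuation f U) := by
  have hex : ∃ F, IsMeromorphicContinuation f U F :=
    ⟨_, isMeromorphicContinuation_toMeromorphicNFOn hF ha h⟩
  rw [meromorphicContinuation, dif_pos hex]
  exact hex.choose_spec

/-- The continuation is the normal form of any meromorphic function that extends `f`. -/
theorem meromorphicContinuation_eq {f F : ℂ → ℂ} {U : Set ℂ} (hU : IsOpen U) (hne : U.Nonempty)
    (hF : MeromorphicOn F Set.univ) (ha : AnalyticOnNhd ℂ F U) (h : Set.EqOn F f U) :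
    meromorphicContinuation f U = toMeromorphicNFOn F Set.univ :=
  IsMeromorphicContinuation.unique hU hne
    (isMeromorphicContinuation_meromorphicContinuation hF ha h)
    (isMeromorphicContinuation_toMeromorphicNFOn hF ha h)

/-! ### Continuation of the Eisenstein series of weight `0` -/

theorem isOpen_setOf_lt_re (a : ℝ) : IsOpen {s : ℂ | a < s.re} :=
  isOpen_lt continuous_const Complex.continuous_re

theorem nonempty_setOf_lt_re (a : ℝ) : {s : ℂ | a < s.re}.Nonempty :=
  ⟨((a + 1 : ℝ) : ℂ), by simp⟩

theorem differentiable_eisEntire (N : ℕ) (z : ℍ) : Differentiable ℂ (eisEntire N z) := by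
  refine (Differentiable.fun_sum fun f hf => ?_).const_mul _
  have : NeZero f := ⟨(Nat.pos_of_mem_divisors hf).ne'⟩
  refine (Differentiable.const_mul ?_ _).mul (differentiable_epsteinEntire f z)
  exact differentiable_id.const_cpow (Or.inl (natCast_ne_zero f))

theorem measurable_eisEntire (N : ℕ) (s : ℂ) : Measurable fun z => eisEntire N z s := by
  refine (Finset.measurable_fun_sum _ fun f hf => ?_).const_mul _
  have : NeZero f := ⟨(Nat.pos_of_mem_divisors hf).ne'⟩
  exact (measurable_epsteinEntire f s).const_mul _

/-- Moderate growth at every cusp, locally uniformly in `s`. -/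
theorem exists_norm_eisEntire_le (N : ℕ) (R : ℕ) : ∃ C : ℝ, 0 < C ∧ ∀ (σ : SL(2, ℤ)),
    ∀ z ∈ ModularGroup.fd, ∀ s : ℂ, ‖s‖ ≤ R → ‖eisEntire N (σ • z) s‖ ≤ C * z.im ^ (R + 2) := by
  have h : ∀ f : ℕ, ∃ C : ℝ, 0 < C ∧ (f ∈ N.divisors → ∀ (σ : SL(2, ℤ)),
      ∀ z ∈ ModularGroup.fd, ∀ s : ℂ, ‖s‖ ≤ R →
        ‖epsteinEntire f (σ • z) s‖ ≤ C * z.im ^ (R + 2)) := fun f => by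
    by_cases hf : f ∈ N.divisors
    · have : NeZero f := ⟨(Nat.pos_of_mem_divisors hf).ne'⟩
      obtain ⟨C, hC, h⟩ := exists_norm_epsteinEntire_le f R
      exact ⟨C, hC, fun _ => h⟩
    · exact ⟨1, one_pos, fun h => absurd h hf⟩
  choose C hC0 hC using h
  refine ⟨1 + 1 / 2 * ∑ f ∈ N.divisors, (f : ℝ) ^ R * C f, ?_, fun σ z hz s hs => ?_⟩
  · have : 0 ≤ ∑ f ∈ N.divisors, (f : ℝ) ^ R * C f :=
      Finset.sum_nonneg fun f _ => mul_nonneg (by positivity) (hC0 f).le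
    linarith
  have hy := z.im_pos
  have h1 : ‖∑ f ∈ N.divisors, (ArithmeticFunction.moebius (N / f) : ℂ) * (f : ℂ) ^ s *
      epsteinEntire f (σ • z) s‖ ≤ ∑ f ∈ N.divisors, (f : ℝ) ^ R * C f * z.im ^ (R + 2) := by
    refine norm_sum_le_of_le _ fun f hf => ?_
    have hf0 : 0 < f := Nat.pos_of_mem_divisors hf
    rw [norm_mul, norm_mul, Complex.norm_natCast_cpow_of_pos hf0, Complex.norm_intCast]
    have h2 : |((ArithmeticFunction.moebius (N / f) : ℤ) : ℝ)| ≤ 1 := by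
      exact_mod_cast ArithmeticFunction.abs_moebius_le_one
    have h3 : (f : ℝ) ^ s.re ≤ (f : ℝ) ^ R := by
      rw [← Real.rpow_natCast]
      exact Real.rpow_le_rpow_of_exponent_le (by exact_mod_cast hf0)
        (((le_abs_self _).trans (Complex.abs_re_le_norm s)).trans hs)
    have h4 := hC f hf σ z hz s hs
    calc _ ≤ 1 * (f : ℝ) ^ R * (C f * z.im ^ (R + 2)) := by gcongr
      _ = _ := by ring
  rw [eisEntire, norm_mul, show ‖(1 / 2 : ℂ)‖ = 1 / 2 by norm_num]
  rw [← Finset.sum_mul] at h1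
  nlinarith [pow_pos hy (R + 2)]

theorem analyticAt_eisPolar (N : ℕ) {s : ℂ} (h0 : s ≠ 0) (h1 : s ≠ 1) :
    AnalyticAt ℂ (eisPolar N) s := by
  refine AnalyticAt.mul analyticAt_const (Finset.analyticAt_fun_sum _ fun f hf => ?_)
  have hf : (f : ℂ) ≠ 0 := by exact_mod_cast (Nat.pos_of_mem_divisors hf).ne'
  refine ((Differentiable.const_mul ?_ _).analyticAt s).mul ?_
  · exact differentiable_id.const_cpow (Or.inl hf)
  · exact (analyticAt_const.div analyticAt_id h0).add
      (analyticAt_const.div (analyticAt_const.sub analyticAt_id) (sub_ne_zero.mpr h1.symm))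

theorem meromorphicAt_eisPolar (N : ℕ) (s : ℂ) : MeromorphicAt (eisPolar N) s := by
  refine (MeromorphicAt.const _ _).mul (MeromorphicAt.fun_sum fun f hf => ?_)
  have hf : (f : ℂ) ≠ 0 := by exact_mod_cast (Nat.pos_of_mem_divisors hf).ne'
  refine ((Differentiable.const_mul ?_ _).analyticAt s).meromorphicAt.mul ?_
  · exact differentiable_id.const_cpow (Or.inl hf)
  · exact ((MeromorphicAt.const _ _).div (MeromorphicAt.id s)).add
      ((MeromorphicAt.const _ _).div ((MeromorphicAt.const _ _).sub (MeromorphicAt.id s)))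

theorem meromorphicOn_eisEntire_sub (N : ℕ) (z : ℍ) :
    MeromorphicOn (fun s => eisEntire N z s - eisPolar N s) Set.univ := fun s _ =>
  ((differentiable_eisEntire N z).analyticAt s).meromorphicAt.sub (meromorphicAt_eisPolar N s)

theorem analyticAt_eisEntire_sub (N : ℕ) (z : ℍ) {s : ℂ} (h0 : s ≠ 0) (h1 : s ≠ 1) :
    AnalyticAt ℂ (fun s => eisEntire N z s - eisPolar N s) s :=
  ((differentiable_eisEntire N z).analyticAt s).sub (analyticAt_eisPolar N h0 h1)

theorem analyticOnNhd_eisEntire_sub (N : ℕ) (z : ℍ) :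
    AnalyticOnNhd ℂ (fun s => eisEntire N z s - eisPolar N s) {s | 1 < s.re} := fun s hs =>
  analyticAt_eisEntire_sub N z (fun h => by rw [h] at hs; norm_num at hs)
    (fun h => by rw [h] at hs; norm_num at hs)

theorem isMeromorphicContinuation_calE (z : ℍ) :
    IsMeromorphicContinuation (normalizedSeries N z) {s | 1 < s.re} (calE N z) :=
  isMeromorphicContinuation_meromorphicContinuation (meromorphicOn_eisEntire_sub N z)
    (analyticOnNhd_eisEntire_sub N z) fun _ hs => (normalizedSeries_eq N z hs).symm

theorem calE_eventuallyEq (z : ℍ) {s : ℂ} (h0 : s ≠ 0) (h1 : s ≠ 1) :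
    calE N z =ᶠ[nhds s] fun s => eisEntire N z s - eisPolar N s := by
  rw [calE, meromorphicContinuation_eq (isOpen_setOf_lt_re 1) (nonempty_setOf_lt_re 1)
    (meromorphicOn_eisEntire_sub N z) (analyticOnNhd_eisEntire_sub N z)
    fun _ hs => (normalizedSeries_eq N z hs).symm]
  exact toMeromorphicNFOn_eventuallyEq (meromorphicOn_eisEntire_sub N z)
    (analyticAt_eisEntire_sub N z h0 h1)

theorem calE_eq (z : ℍ) {s : ℂ} (h0 : s ≠ 0) (h1 : s ≠ 1) :
    calE N z s = eisEntire N z s - eisPolar N s := (calE_eventuallyEq N z h0 h1).eq_of_nhds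

theorem analyticAt_calE (z : ℍ) {s : ℂ} (h0 : s ≠ 0) (h1 : s ≠ 1) : AnalyticAt ℂ (calE N z) s :=
  (analyticAt_eisEntire_sub N z h0 h1).congr (calE_eventuallyEq N z h0 h1).symm

theorem im_smul_of_mem_stabInfty {δ : SL(2, ℤ)} (hδ : δ ∈ stabInfty) (z : ℍ) :
    (δ • z).im = z.im := by
  obtain ⟨n, hn⟩ := ModularGroup.exists_eq_T_zpow_of_c_eq_zero hδ
  rw [hn, ModularGroup.im_T_zpow_smul]

/-- The action of `Γ₀(N)` on the cosets by multiplication from the right. -/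
def cosetsMul (N : ℕ) (γ : CongruenceSubgroup.Gamma0 N) : Cosets N ≃ Cosets N :=
  let f : CongruenceSubgroup.Gamma0 N → Cosets N → Cosets N := fun γ =>
    Quotient.map' (fun g => g * γ) fun g h hgh => by
      rw [QuotientGroup.rightRel_apply] at hgh ⊢
      rwa [mul_inv_rev, mul_assoc, mul_inv_cancel_left]
  { toFun := f γ
    invFun := f γ⁻¹
    left_inv := fun q => by
      induction q using Quotient.inductionOn with | _ g => ?_
      exact congrArg (Quotient.mk _) (mul_inv_cancel_right g γ)
    right_inv := fun q => by
      induction q using Quotient.inductionOn with | _ g => ?_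
      exact congrArg (Quotient.mk _) (inv_mul_cancel_right g γ) }

theorem eisensteinTerm_mk (N : ℕ) (z : ℍ) (s : ℂ) (g : CongruenceSubgroup.Gamma0 N) :
    eisensteinTerm N z s (Quotient.mk _ g) = ((g.1 • z).im : ℂ) ^ s := by
  have h1 : g.1 * ((Quotient.out (Quotient.mk _ g : Cosets N)).1)⁻¹ ∈ stabInfty :=
    Subgroup.mem_subgroupOf.mp (QuotientGroup.rightRel_apply.mp
      (Quotient.mk_out (s := QuotientGroup.rightRel
        (stabInfty.subgroupOf (CongruenceSubgroup.Gamma0 N))) g))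
  rw [eisensteinTerm, ← im_smul_of_mem_stabInfty h1, ← mul_smul, inv_mul_cancel_right]

theorem normalizedSeries_smul (N : ℕ) {γ : SL(2, ℤ)} (hγ : γ ∈ CongruenceSubgroup.Gamma0 N)
    (z : ℍ) : normalizedSeries N (γ • z) = normalizedSeries N z := by
  funext s
  rw [normalizedSeries, normalizedSeries, eisensteinSeries, eisensteinSeries,
    ← (cosetsMul N ⟨γ, hγ⟩).tsum_eq (eisensteinTerm N z s)]
  congr 2
  funext q
  induction q using Quotient.inductionOn with | _ g => ?_
  change _ = eisensteinTerm N z s (Quotient.mk _ (g * ⟨γ, hγ⟩))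
  rw [eisensteinTerm_mk, eisensteinTerm_mk, Subgroup.coe_mul, mul_smul]

theorem calE_smul (N : ℕ) {γ : SL(2, ℤ)} (hγ : γ ∈ CongruenceSubgroup.Gamma0 N)
    (z : ℍ) : calE N (γ • z) = calE N z := by
  rw [calE, normalizedSeries_smul N hγ, calE]

/-! ### The Eisenstein series of weight `3/2` -/

/-- The lower row of the chosen representative of a coset of the metaplectic group. -/
def mpRow (q : MpCosets) : ℤ × ℤ := ((Quotient.out q).mat 1 0, (Quotient.out q).mat 1 1)

theorem mpRow_isCoprime (q : MpCosets) : IsCoprime (mpRow q).1 (mpRow q).2 :=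
  ModularGroup.bottom_row_coprime _

theorem mpRow_ne_zero (q : MpCosets) : mpRow q ≠ 0 := fun h => by
  have := mpRow_isCoprime q
  rw [h] at this
  exact not_isCoprime_zero_zero this

theorem mpRow_injective : Function.Injective mpRow := by
  intro q q' h
  obtain ⟨h1, h2⟩ := Prod.mk.inj h
  refine Quotient.out_equiv_out.mp (QuotientGroup.rightRel_apply.mpr ?_)
  change (Quotient.out q').mat * ((Quotient.out q).mat)⁻¹ ∈ Subgroup.zpowers ModularGroup.T
  have e1 : ((Quotient.out q').mat * ((Quotient.out q).mat)⁻¹) 1 0 = 0 := by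
    rw [SL_mul_inv_apply_one_zero, h1, h2]; ring
  have e2 : ((Quotient.out q').mat * ((Quotient.out q).mat)⁻¹) 1 1 = 1 := by
    have hdet := (Quotient.out q).mat.det_coe
    rw [Matrix.det_fin_two] at hdet
    rw [Matrix.SpecialLinearGroup.coe_mul, Matrix.SpecialLinearGroup.SL2_inv_expl,
      Matrix.mul_apply, Fin.sum_univ_two]
    simp
    rw [← h1, ← h2]
    linarith
  generalize (Quotient.out q').mat * ((Quotient.out q).mat)⁻¹ = M at e1 e2
  have e3 := M.det_coe
  rw [Matrix.det_fin_two, e1, e2] at e3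
  refine ⟨M 0 1, ?_⟩
  ext i j
  rw [ModularGroup.coe_T_zpow]
  fin_cases i <;> fin_cases j <;> simp [e1, e2]
  linarith

/-- Negative integral multiples of the lower rows. All coprime pairs occur as lower rows, so
one sign of the multiplier is enough. The negative sign fits `thetaPart_eq`, where the part of the
theta function for `p` involves the line through `-p`. -/
def scaledMpRow (p : ℕ × MpCosets) : ℤ × ℤ :=
  (-((p.1 : ℤ) + 1) * (mpRow p.2).1, -((p.1 : ℤ) + 1) * (mpRow p.2).2)

theorem scaledMpRow_injective : Function.Injective scaledMpRow := by
  rintro ⟨m, q⟩ ⟨m', q'⟩ h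
  obtain ⟨h1, h2⟩ := Prod.mk.inj h
  simp only at h1 h2
  obtain ⟨u, v, huv⟩ := mpRow_isCoprime q
  obtain ⟨u', v', huv'⟩ := mpRow_isCoprime q'
  -- both multipliers are the greatest common divisor of the entries
  have d1 : (m' : ℤ) + 1 ∣ m + 1 := ⟨u * (mpRow q').1 + v * (mpRow q').2, by
    linear_combination (-u) * h1 - v * h2 - ((m : ℤ) + 1) * huv⟩
  have d2 : (m : ℤ) + 1 ∣ m' + 1 := ⟨u' * (mpRow q).1 + v' * (mpRow q).2, by
    linear_combination u' * h1 + v' * h2 - ((m' : ℤ) + 1) * huv'⟩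
  have hm : (m : ℤ) + 1 = m' + 1 := Int.dvd_antisymm (by positivity) (by positivity) d2 d1
  have hm0 : -((m' : ℤ) + 1) ≠ 0 := neg_ne_zero.mpr (by positivity)
  rw [hm] at h1 h2
  rw [show m = m' by omega,
    mpRow_injective (Prod.ext (mul_left_cancel₀ hm0 h1) (mul_left_cancel₀ hm0 h2))]

theorem exists_mpRow_eq {c d : ℤ} (h : IsCoprime c d) : ∃ q, mpRow q = (c, d) := by
  obtain ⟨γ, -, hγ⟩ := ModularGroup.bottom_row_surj (R := ℤ) (a := ![c, d]) (by simpa using h)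
  have hmap : (⊤ : Subgroup Mp2Z).map Mp2Z.proj = ⊤ := by
    rw [← Mp2Z.closure_S_T, MonoidHom.map_closure, Set.image_pair]
    exact SpecialLinearGroup.SL2Z_generators
  obtain ⟨g, -, hg⟩ : γ ∈ (⊤ : Subgroup Mp2Z).map Mp2Z.proj := hmap ▸ Subgroup.mem_top _
  refine ⟨Quotient.mk _ g, ?_⟩
  obtain ⟨n, hn⟩ : g.mat * ((Quotient.out (Quotient.mk _ g : MpCosets)).mat)⁻¹ ∈
      Subgroup.zpowers ModularGroup.T := by
    have := QuotientGroup.rightRel_apply.mp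
      (Quotient.mk_out (s := QuotientGroup.rightRel Mp2Z.stabInfty) g)
    exact this
  have h1 : γ = ModularGroup.T ^ n * (Quotient.out (Quotient.mk _ g : MpCosets)).mat := by
    rw [show γ = g.mat from hg.symm]
    exact eq_mul_of_mul_inv_eq hn.symm
  have h2 := ModularGroup.T_pow_mul_apply_one n (Quotient.out (Quotient.mk _ g : MpCosets)).mat
  rw [← h1] at h2
  rw [mpRow, ← h2]
  exact Prod.ext (congrFun hγ 0) (congrFun hγ 1)

theorem mem_range_scaledMpRow {p : ℤ × ℤ} (hp : p ≠ 0) : p ∈ Set.range scaledMpRow := by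
  obtain ⟨m, n⟩ := p
  have hg : 0 < Int.gcd m n := by
    rw [Int.gcd_pos_iff]
    by_contra! h
    exact hp (Prod.ext h.1 h.2)
  obtain ⟨c, d, hcd, hm, hn⟩ := Int.exists_gcd_one hg
  obtain ⟨q, hq⟩ := exists_mpRow_eq (Int.isCoprime_iff_gcd_eq_one.mpr hcd).neg_neg
  refine ⟨(Int.gcd m n - 1, q), ?_⟩
  rw [scaledMpRow, hq]
  push_cast [Nat.cast_sub hg]
  refine Prod.ext ?_ ?_
  · linear_combination -hm
  · linear_combination -hn

/-- The coefficients of `ρ_L(γ')⁻¹ e_0` for the chosen representatives. -/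
def weilCoeff (r : ZMod (2 * N)) (q : MpCosets) : ℂ :=
  weilRepresentation N (Quotient.out q)⁻¹ (basisVec N 0) r

theorem vectorTerm_apply (τ : ℍ) (s : ℂ) (q : MpCosets) (r : ZMod (2 * N)) :
    vectorTerm N τ s q r = ((Quotient.out q).root τ ^ 3)⁻¹ *
      (((qf 1 τ (mpRow q) : ℝ) : ℂ) ^ (-((s - 1) / 2)) * weilCoeff N r q) := by
  have h : ((Quotient.out q).mat • τ : ℍ).im = (qf 1 τ (mpRow q))⁻¹ := by
    rw [ModularGroup.im_smul_eq_div_normSq, Complex.normSq_eq_norm_sq, qf, mpRow]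
    simp [UpperHalfPlane.denom]
  rw [vectorTerm, slash, h, map_smul, Complex.cpow_neg, Complex.ofReal_inv, Complex.inv_cpow]
  · rfl
  · rw [Complex.arg_ofReal_of_nonneg (qf_nonneg 1 τ _)]
    exact Real.pi_pos.ne

theorem norm_root_pow_four (τ : ℍ) (q : MpCosets) :
    ‖(Quotient.out q).root τ‖ ^ 4 = τ.im * qf 1 τ (mpRow q) := by
  have h := congrArg (fun x => ‖x‖ ^ 2) ((Quotient.out q).sq τ)
  simp only [norm_pow, ← pow_mul] at h
  have := τ.im_ne_zero
  rw [h, qf, mpRow]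
  simp
  field_simp

/-- The Weil representation is unitary, so the series is dominated by an Eisenstein series of
weight `0` at `s / 2 + 1 / 4`. -/
theorem norm_vectorTerm_le (τ : ℍ) (s : ℂ) (q : MpCosets) (r : ZMod (2 * N)) :
    ‖vectorTerm N τ s q r‖ ≤ τ.im ^ (-(3 / 4) : ℝ) * qf 1 τ (mpRow q) ^ (-(s.re / 2 + 1 / 4)) := by
  have hq := qf_pos 1 τ (mpRow_ne_zero q)
  have hy := τ.im_pos
  have h1 : ‖((Quotient.out q).root τ ^ 3)⁻¹‖ =
      τ.im ^ (-(3 / 4) : ℝ) * qf 1 τ (mpRow q) ^ (-(3 / 4) : ℝ) := by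
    rw [← Real.mul_rpow hy.le hq.le, ← norm_root_pow_four, ← Real.rpow_natCast, ← Real.rpow_mul
      (norm_nonneg _), norm_inv, norm_pow, ← Real.rpow_natCast, ← Real.rpow_neg (norm_nonneg _)]
    norm_num
  rw [vectorTerm_apply, norm_mul, norm_mul, h1, Complex.norm_cpow_eq_rpow_re_of_pos hq]
  have h2 : ‖weilCoeff N r q‖ ≤ 1 := norm_weilRepresentation_le N _ r
  have h3 : (-((s - 1) / 2)).re = -(s.re / 2) + 1 / 2 := by
    rw [show -((s - 1) / 2) = ((-(1 / 2) : ℝ) : ℂ) * s + ((1 / 2 : ℝ) : ℂ) by push_cast; ring,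
      Complex.add_re, Complex.re_ofReal_mul, Complex.ofReal_re]
    ring
  rw [h3]
  calc _ ≤ τ.im ^ (-(3 / 4) : ℝ) * qf 1 τ (mpRow q) ^ (-(3 / 4) : ℝ) *
        (qf 1 τ (mpRow q) ^ (-(s.re / 2) + 1 / 2) * 1) := by gcongr
    _ = _ := by
      rw [mul_one, mul_assoc, ← Real.rpow_add hq]
      congr 2
      ring

theorem summable_qf_mpRow (τ : ℍ) {a : ℝ} (ha : 3 / 2 < a) :
    Summable fun q => qf 1 τ (mpRow q) ^ (-(a / 2 + 1 / 4)) :=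
  (summable_qf_rpow 1 τ (by linarith)).comp_injective mpRow_injective

theorem summable_vectorTerm_apply (τ : ℍ) {s : ℂ} (hs : 3 / 2 < s.re) (r : ZMod (2 * N)) :
    Summable fun q => vectorTerm N τ s q r :=
  Summable.of_norm_bounded ((summable_qf_mpRow τ hs).mul_left _)
    fun q => norm_vectorTerm_le N τ s q r

theorem summable_vectorTerm (τ : ℍ) {s : ℂ} (hs : 3 / 2 < s.re) : Summable (vectorTerm N τ s) :=
  Pi.summable.mpr fun r => summable_vectorTerm_apply N τ hs r

theorem vectorSeries_apply (τ : ℍ) {s : ℂ} (hs : 3 / 2 < s.re) (r : ZMod (2 * N)) :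
    vectorSeries N τ s r = ∑' q, vectorTerm N τ s q r :=
  tsum_apply (summable_vectorTerm N τ hs)

theorem rpow_neg_le_add {x a b c : ℝ} (hx : 0 < x) (hab : a ≤ b) (hbc : b ≤ c) :
    x ^ (-b) ≤ x ^ (-a) + x ^ (-c) := by
  rcases le_total 1 x with h | h
  · have := Real.rpow_le_rpow_of_exponent_le h (neg_le_neg hab)
    have := Real.rpow_pos_of_pos hx (-c)
    linarith
  · have := Real.rpow_le_rpow_of_exponent_ge hx h (neg_le_neg hbc)
    have := Real.rpow_pos_of_pos hx (-a)
    linarith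

theorem differentiableAt_tsum_vectorTerm (τ : ℍ) {s : ℂ} (hs : 3 / 2 < s.re)
    (r : ZMod (2 * N)) : DifferentiableAt ℂ (fun s => ∑' q, vectorTerm N τ s q r) s := by
  -- on the strip `a < Re w < Re s + 1` the two boundary exponents dominate
  set a : ℝ := (3 / 2 + s.re) / 2 with ha
  have hU : IsOpen {w : ℂ | a < w.re ∧ w.re < s.re + 1} :=
    (isOpen_setOf_lt_re a).inter (isOpen_lt Complex.continuous_re continuous_const)
  refine (Complex.differentiableOn_tsum_of_summable_norm (F := fun q w => vectorTerm N τ w q r)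
    (((summable_qf_mpRow τ (by linarith : 3 / 2 < a)).add
    (summable_qf_mpRow τ (by linarith : 3 / 2 < s.re + 1))).mul_left (τ.im ^ (-(3 / 4) : ℝ)))
    (fun q => ?_) hU fun q w hw => ?_).differentiableAt
    (hU.mem_nhds ⟨by linarith, by linarith⟩)
  · have hq : ((qf 1 τ (mpRow q) : ℝ) : ℂ) ≠ 0 := by
      exact_mod_cast (qf_pos 1 τ (mpRow_ne_zero q)).ne'
    simp only [vectorTerm_apply]
    refine Differentiable.differentiableOn
      (Differentiable.const_mul (Differentiable.mul_const ?_ _) _)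
    exact (((differentiable_id.sub_const 1).div_const 2).neg).const_cpow (Or.inl hq)
  · refine (norm_vectorTerm_le N τ w q r).trans ?_
    have := τ.im_pos
    gcongr
    exact rpow_neg_le_add (qf_pos 1 τ (mpRow_ne_zero q)) (by linarith [hw.1]) (by linarith [hw.2])

theorem differentiableAt_zetaN (N : ℕ) {s : ℂ} (hs : s ≠ 1) : DifferentiableAt ℂ (zetaN N) s := by
  refine (differentiableAt_riemannZeta hs).mul (DifferentiableAt.fun_finsetProd fun p hp => ?_)
  have hp : (p : ℂ) ≠ 0 := by exact_mod_cast (Nat.prime_of_mem_primeFactors hp).ne_zero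
  exact (differentiableAt_id.neg.const_cpow (Or.inl hp)).const_sub _

theorem differentiableOn_normalizedVectorSeries (τ : ℍ) (r : ZMod (2 * N)) :
    DifferentiableOn ℂ (normalizedVectorSeries N τ r) {s | 3 / 2 < s.re} := by
  intro s hs
  have hs' : 3 / 2 < s.re := hs
  have h : DifferentiableAt ℂ (fun s => -(s / 4) * (Real.pi : ℂ) ^ (-s - 1) * Complex.Gamma s *
      zetaN N (2 * s) * (N : ℂ) ^ (1 / 2 + 3 / 2 * s) * ∑' q, vectorTerm N τ s q r) s := by
    refine DifferentiableAt.mul (DifferentiableAt.mul (DifferentiableAt.mul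
      (DifferentiableAt.mul (DifferentiableAt.mul ?_ ?_) ?_) ?_) ?_)
      (differentiableAt_tsum_vectorTerm N τ hs r)
    · fun_prop
    · exact (differentiableAt_id.neg.sub_const 1).const_cpow
        (Or.inl (by exact_mod_cast Real.pi_pos.ne'))
    · refine Complex.differentiableAt_Gamma s fun m hm => ?_
      rw [hm] at hs'
      simp at hs'
      linarith [(Nat.cast_nonneg m : (0 : ℝ) ≤ m)]
    · refine DifferentiableAt.comp (f := fun s : ℂ => 2 * s) s
        (differentiableAt_zetaN N fun h => ?_) (differentiableAt_id.const_mul 2)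
      have := congrArg Complex.re h
      simp at this
      linarith
    · exact ((differentiableAt_id.const_mul (3 / 2 : ℂ)).const_add (1 / 2)).const_cpow
        (Or.inl (natCast_ne_zero N))
  refine h.differentiableWithinAt.congr_of_eventuallyEq_of_mem ?_ hs
  filter_upwards [self_mem_nhdsWithin] with w hw
  rw [normalizedVectorSeries, vectorSeries_apply N τ hw]

/-! ### Jacobi theta functions along a line through a lattice point -/

/-- The Jacobi theta function at `x (c τ + n)`, with the factor that makes it periodic in `x`. -/
def jacobiLine (r : ZMod (2 * N)) (τ : ℍ) (p : ℤ × ℤ) (x : ℝ) : ℂ :=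
  e (N * p.1 * x ^ 2 * (p.1 * τ + p.2)) * jacobiVec N r τ (x * (p.1 * τ + p.2))

theorem jacobiVec_eq_jacobiTheta₂ (N : ℕ) (r : ZMod (2 * N)) (τ : ℍ) (z : ℂ) :
    jacobiVec N r τ z = e (N * (r.val / (2 * N)) ^ 2 * τ + 2 * N * (r.val / (2 * N)) * z) *
      jacobiTheta₂ (2 * N * (r.val / (2 * N)) * τ + 2 * N * z) (2 * N * τ) := by
  rw [jacobiVec, jacobiTheta₂, ← tsum_mul_left]
  congr 1
  funext l
  rw [jacobiTheta₂_term, e, e, ← Complex.exp_add]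
  congr 1
  ring

theorem continuous_jacobiLine (r : ZMod (2 * N)) (τ : ℍ) (p : ℤ × ℤ) :
    Continuous (jacobiLine N r τ p) := by
  have him : 0 < (2 * N * τ : ℂ).im := by
    have := mul_pos (mul_pos two_pos (natCast_pos N)) τ.im_pos
    rw [show (2 * N * τ : ℂ) = ((2 * N : ℝ) : ℂ) * τ by push_cast; ring, Complex.im_ofReal_mul]
    exact this
  have h : Continuous fun w : ℂ => jacobiTheta₂ w (2 * N * τ) :=
    continuous_iff_continuousAt.mpr fun w => (differentiableAt_jacobiTheta₂_fst w him).continuousAt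
  unfold jacobiLine
  simp only [jacobiVec_eq_jacobiTheta₂]
  unfold e
  refine Continuous.mul (by fun_prop) (Continuous.mul (by fun_prop) (h.comp (by fun_prop)))

theorem periodic_jacobiLine (r : ZMod (2 * N)) (τ : ℍ) (p : ℤ × ℤ) :
    Function.Periodic (jacobiLine N r τ p) 1 := by
  intro x
  have hN := natCast_ne_zero N
  rw [jacobiLine, jacobiLine, jacobiVec, jacobiVec, ← tsum_mul_left, ← tsum_mul_left,
    ← (Equiv.subRight p.1).tsum_eq]
  congr 1
  funext l
  rw [← e_add, ← e_add,
    ← e_add_int _ (-(2 * N * l * p.2 + r.val * p.2 - N * p.1 * p.2))]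
  congr 1
  push_cast [Equiv.subRight_apply]
  field_simp
  ring

theorem jacobiLine_smul (N : ℕ) (r : ZMod (2 * N)) (τ : ℍ) (m : ℤ) (p : ℤ × ℤ) (x : ℝ) :
    jacobiLine N r τ (m * p.1, m * p.2) x = jacobiLine N r τ p (m * x) := by
  simp only [jacobiLine]
  push_cast
  congr 2 <;> ring

/-- A multiple of `(c, n)` runs through the same closed curve several times. -/
theorem integral_jacobiLine_smul (r : ZMod (2 * N)) (τ : ℍ) (m : ℤ) (hm : m ≠ 0) (p : ℤ × ℤ) :
    ∫ x in (0 : ℝ)..1, (starRingEnd ℂ) (jacobiLine N r τ (m * p.1, m * p.2) x) =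
      ∫ x in (0 : ℝ)..1, (starRingEnd ℂ) (jacobiLine N r τ p x) := by
  have hc : Continuous fun x => (starRingEnd ℂ) (jacobiLine N r τ p x) :=
    Complex.continuous_conj.comp (continuous_jacobiLine N r τ p)
  have hp : Function.Periodic (fun x => (starRingEnd ℂ) (jacobiLine N r τ p x)) 1 := fun x => by
    simp only [periodic_jacobiLine N r τ p x]
  have hm' : (m : ℝ) ≠ 0 := by exact_mod_cast hm
  have h := hp.intervalIntegral_add_zsmul_eq m 0 fun a b => hc.intervalIntegrable a b
  simp only [jacobiLine_smul]
  rw [intervalIntegral.integral_comp_mul_left (fun x => (starRingEnd ℂ) (jacobiLine N r τ p x)) hm']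
  simp only [zero_add, zsmul_eq_mul, mul_one] at h
  rw [mul_zero, mul_one, h, Complex.real_smul]
  push_cast
  rw [inv_mul_cancel_left₀ (by exact_mod_cast hm)]

/-! ### Expansion of the theta function along the cusp `∞` -/

/-- The part of the theta function, after Poisson summation, that belongs to `(c, n)`. -/
def thetaPart (τ : ℍ) (r : ZMod (2 * N)) (p : ℤ × ℤ) (z : ℍ) : ℂ :=
  -((freq N τ z * √(freq N τ z) : ℝ) : ℂ)⁻¹ *
    ∑' k : ℤ, dualTerm N τ z (k + r.val / (2 * N)) p.1 p.2

theorem exists_tsum_norm_dualTerm_le (τ : ℍ) (r : ZMod (2 * N)) (m : ℕ) (hm : 3 ≤ m) :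
    ∃ C : ℝ, 0 < C ∧ ∀ z : ℍ,
      Summable (fun q : (ℤ × ℤ) × ℤ => ‖dualTerm N τ z (q.2 + r.val / (2 * N)) q.1.1 q.1.2‖) ∧
      ∑' q : (ℤ × ℤ) × ℤ, ‖dualTerm N τ z (q.2 + r.val / (2 * N)) q.1.1 q.1.2‖ ≤
        C * freq N τ z ^ m := by
  have hN := natCast_pos N
  obtain ⟨C, hC0, hC⟩ := exists_norm_tsum_dualTerm_le N τ
    (inv_pos.mpr (by positivity : 0 < 2 * (N : ℝ))) m hm
  refine ⟨C, hC0, fun z => ?_⟩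
  obtain ⟨h1, h2⟩ := hC z
  -- the pairs `(b, c)` lie in the lattice `(2N)⁻¹ ℤ²`
  let j : (ℤ × ℤ) × ℤ → (ℤ × ℤ) × ℤ := fun q => ((2 * N * q.2 + r.val, 2 * N * q.1.1), q.1.2)
  have hN' : (2 * N : ℤ) ≠ 0 := by exact_mod_cast (mul_pos two_pos hN).ne'
  have hj : Function.Injective j := by
    rintro ⟨⟨c, n⟩, k⟩ ⟨⟨c', n'⟩, k'⟩ h
    simp only [j, Prod.mk.injEq, add_left_inj] at h
    rw [mul_left_cancel₀ hN' h.1.1, mul_left_cancel₀ hN' h.1.2, h.2]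
  have he : ∀ q, ‖dualTerm N τ z (q.2 + r.val / (2 * N)) q.1.1 q.1.2‖ =
      ‖dualTerm N τ z ((2 * (N : ℝ))⁻¹ * (j q).1.1) ((2 * (N : ℝ))⁻¹ * (j q).1.2) (j q).2‖ := by
    intro q
    simp only [j]
    congr 2 <;> push_cast <;> field_simp
  simp only [he]
  exact ⟨h1.comp_injective hj, (tsum_comp_le_tsum_of_inj h1 (fun _ => norm_nonneg _) hj).trans h2⟩

theorem hasSum_thetaPart (τ z : ℍ) (r : ZMod (2 * N)) :
    HasSum (fun p => thetaPart N τ r p z) (theta N τ z r) := by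
  obtain ⟨C, -, hC⟩ := exists_tsum_norm_dualTerm_le N τ r 3 le_rfl
  have hs : Summable fun q : (ℤ × ℤ) × ℤ =>
      dualTerm N τ z (q.2 + r.val / (2 * N)) q.1.1 q.1.2 := Summable.of_norm (hC z).1
  let E : (ℤ × ℤ) × ℤ ≃ (ℤ × ℤ) × ℤ :=
    { toFun := fun q => ((q.1.1, q.2), q.1.2)
      invFun := fun q => ((q.1.1, q.2), q.1.2)
      left_inv := fun q => rfl
      right_inv := fun q => rfl }
  have h1 : theta N τ z r = -((freq N τ z * √(freq N τ z) : ℝ) : ℂ)⁻¹ *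
      ∑' q : (ℤ × ℤ) × ℤ, dualTerm N τ z (q.2 + r.val / (2 * N)) q.1.1 q.1.2 := by
    have h2 : Summable fun p : (ℤ × ℤ) × ℤ =>
        phi N (latMat N p.2 (p.1.2 + r.val / (2 * N)) p.1.1) τ z :=
      (Equiv.prodAssoc ℤ ℤ ℤ).summable_iff.mpr (summable_phi_latMat N τ z (r.val / (2 * N)))
    have hsE : Summable fun q : (ℤ × ℤ) × ℤ =>
      dualTerm N τ z ((E q).2 + r.val / (2 * N)) (E q).1.1 (E q).1.2 := E.summable_iff.mpr hs
    rw [theta_eq_tsum, ← (Equiv.prodAssoc ℤ ℤ ℤ).tsum_eq,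
      ← E.tsum_eq fun q : (ℤ × ℤ) × ℤ => dualTerm N τ z (q.2 + r.val / (2 * N)) q.1.1 q.1.2]
    simp only [Equiv.prodAssoc_apply]
    rw [h2.tsum_prod, hsE.tsum_prod, ← tsum_mul_left]
    congr 1
    funext q
    obtain ⟨-, h3⟩ := hasSum_phi_latMat N τ z 0 (q.2 + r.val / (2 * N)) q.1
    simp only [add_zero, Complex.ofReal_zero, mul_zero, e_zero, one_mul] at h3
    exact h3.tsum_eq
  rw [h1]
  exact (hs.hasSum.mul_left _).prod_fiberwise fun p => (hs.prod_factor p).hasSum.mul_left _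

/-- As `freq` is proportional to `y⁻²`, the exponent `m` of `exists_norm_tsum_dualTerm_le` becomes
`2 m - 3`, where `3` stems from the factor `freq ^ (-3/2)`. -/
theorem exists_tsum_norm_thetaPart_le (τ : ℍ) (r : ZMod (2 * N)) (m : ℕ) (hm : 3 ≤ m) :
    ∃ C : ℝ, 0 < C ∧ ∀ z : ℍ, Summable (fun p => ‖thetaPart N τ r p z‖) ∧
      ∑' p, ‖thetaPart N τ r p z‖ ≤ C * (z.im ^ (2 * m - 3))⁻¹ := by
  obtain ⟨C, hC0, hC⟩ := exists_tsum_norm_dualTerm_le N τ r m hm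
  set κ : ℝ := τ.im / N with hκ
  have hκ0 : 0 < κ := div_pos τ.im_pos (natCast_pos N)
  refine ⟨(κ * √κ)⁻¹ * (C * κ ^ m), by positivity, fun z => ?_⟩
  have hy := z.im_pos
  have hF := freq_pos N τ z
  obtain ⟨h1, h2⟩ := hC z
  have hle : ∀ p, ‖thetaPart N τ r p z‖ ≤ (freq N τ z * √(freq N τ z))⁻¹ *
      ∑' k : ℤ, ‖dualTerm N τ z (k + r.val / (2 * N)) p.1 p.2‖ := fun p => by
    rw [thetaPart, norm_mul, norm_neg, norm_inv, Complex.norm_real,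
        Real.norm_of_nonneg (by positivity)]
    exact mul_le_mul_of_nonneg_left (norm_tsum_le_tsum_norm (h1.prod_factor p)) (by positivity)
  have h3 := h1.prod.mul_left (freq N τ z * √(freq N τ z))⁻¹
  refine ⟨Summable.of_nonneg_of_le (fun _ => norm_nonneg _) hle h3, ?_⟩
  refine (Summable.tsum_le_tsum hle (Summable.of_nonneg_of_le (fun _ => norm_nonneg _) hle h3)
    h3).trans ?_
  rw [tsum_mul_left, ← h1.tsum_prod]
  refine (mul_le_mul_of_nonneg_left h2 (by positivity)).trans (le_of_eq ?_)
  have hfr : freq N τ z = κ / z.im ^ 2 := by rw [freq, hκ]; field_simp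
  have hsq : √(freq N τ z) = √κ / z.im := by
    rw [hfr, Real.sqrt_div hκ0.le, Real.sqrt_sq hy.le]
  have : 0 < √κ := Real.sqrt_pos.mpr hκ0
  rw [hsq, hfr, div_pow, ← pow_mul, show z.im ^ (2 * m) = z.im ^ (2 * m - 3) * z.im ^ 3 by
    rw [← pow_add]; congr 1; omega]
  field_simp

/-- The sum over the `b`-coordinate is a Jacobi theta function, and the variables `x` and `y`
separate. -/
theorem thetaPart_eq (τ z : ℍ) (r : ZMod (2 * N)) (p : ℤ × ℤ) :
    thetaPart N τ r p z = -((τ.im / N * √(τ.im / N) : ℝ) : ℂ)⁻¹ *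
      (p.1 * (starRingEnd ℂ) (τ : ℂ) + p.2) ^ 2 *
      ((z.im : ℂ) ^ 3 * Real.exp (-(Real.pi * N * qf 1 τ p * z.im ^ 2))) *
      (starRingEnd ℂ) (jacobiLine N r τ (-1 * p.1, -1 * p.2) z.re) := by
  have hκ0 : 0 < τ.im / N := div_pos τ.im_pos (natCast_pos N)
  have hy := z.im_pos
  have hv := τ.im_pos
  have hN := natCast_pos N
  have hfr : freq N τ z = τ.im / N / z.im ^ 2 := by rw [freq]; field_simp
  have hsq : √(freq N τ z) = √(τ.im / N) / z.im := by
    rw [hfr, Real.sqrt_div hκ0.le, Real.sqrt_sq hy.le]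
  have h0 : 0 < √(τ.im / N) := Real.sqrt_pos.mpr hκ0
  have h1 : ((freq N τ z * √(freq N τ z) : ℝ) : ℂ)⁻¹ =
      ((τ.im / N * √(τ.im / N) : ℝ) : ℂ)⁻¹ * (z.im : ℂ) ^ 3 := by
    rw [hsq, hfr, ← Complex.ofReal_inv, ← Complex.ofReal_inv, ← Complex.ofReal_pow,
      ← Complex.ofReal_mul]
    congr 1
    field_simp
  have h2 : Real.pi * ‖(((p.1 : ℝ) : ℂ) * τ + p.2 : ℂ)‖ ^ 2 / freq N τ z =
      Real.pi * N * qf 1 τ p * z.im ^ 2 := by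
    rw [hfr, qf]
    simp
    field_simp
  rw [thetaPart, h1]
  simp only [dualTerm, h2, tsum_mul_left, jacobiLine, jacobiVec, map_mul, Complex.conj_tsum]
  have h3 : ∀ k : ℤ, e (-N * ((k + r.val / (2 * N) : ℝ) : ℂ) ^ 2 * (starRingEnd ℂ) (τ : ℂ) +
      (2 * N * ((k + r.val / (2 * N) : ℝ) : ℂ) * z.re - N * ((p.1 : ℝ) : ℂ) * z.re ^ 2) *
        (((p.1 : ℝ) : ℂ) * (starRingEnd ℂ) (τ : ℂ) + p.2)) =
      (starRingEnd ℂ) (e (N * ((-1 * p.1 : ℤ) : ℂ) * z.re ^ 2 *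
        (((-1 * p.1 : ℤ) : ℂ) * τ + ((-1 * p.2 : ℤ) : ℂ)))) *
      (starRingEnd ℂ) (e (N * (k + r.val / (2 * N)) ^ 2 * τ + 2 * N * (k + r.val / (2 * N)) *
        (z.re * (((-1 * p.1 : ℤ) : ℂ) * τ + ((-1 * p.2 : ℤ) : ℂ))))) := by
    intro k
    rw [conj_e, conj_e, ← e_add]
    congr 1
    simp only [map_add, map_mul, map_pow, map_div₀, Complex.conj_ofReal, map_natCast, map_intCast,
      map_ofNat]
    push_cast
    ring
  simp only [h3, tsum_mul_left]
  push_cast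
  ring

/-! ### The Mellin transform of the theta function along the cusp `∞` -/

theorem integrableOn_strip_of_im {g : ℝ → ℝ} (hg : Measurable g)
    (hi : IntegrableOn (fun y => (y ^ 2)⁻¹ * g y) (Set.Ioi 0)) :
    IntegrableOn (fun z : ℍ => g z.im) strip := by
  refine ⟨(hg.comp UpperHalfPlane.continuous_im.measurable).aestronglyMeasurable, ?_⟩
  have h1 := hi.2
  rw [hasFiniteIntegral_iff_enorm] at h1 ⊢
  have h2 := lintegral_strip (f := fun p : ℝ × ℝ => ‖g p.2‖ₑ) (by fun_prop)
  rw [h2]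
  refine lt_of_le_of_lt (le_of_eq (setLIntegral_congr_fun measurableSet_Ioi fun y hy => ?_)) h1
  simp only [lintegral_const, Measure.restrict_apply MeasurableSet.univ, Set.univ_inter,
    Real.volume_Ioc, sub_zero, ENNReal.ofReal_one, mul_one]
  have hy : 0 < y := hy
  rw [enorm_mul, Real.enorm_of_nonneg (by positivity : 0 ≤ (y ^ 2)⁻¹)]

/-- A bound for the Mellin transform: a small power of `y` near `0`, a large one near `∞`. -/
theorem integrableOn_ite_rpow {a b : ℝ} (ha : 1 < a) (hb : b < 1) :
    IntegrableOn (fun y : ℝ => (y ^ 2)⁻¹ * if y ≤ 1 then y ^ a else y ^ b) (Set.Ioi 0) := by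
  rw [← Set.Ioc_union_Ioi_eq_Ioi zero_le_one, integrableOn_union]
  have h2 : ∀ y : ℝ, 0 < y → ∀ a : ℝ, (y ^ 2)⁻¹ * y ^ a = y ^ (a - 2) := fun y hy a => by
    rw [Real.rpow_sub hy, Real.rpow_two, div_eq_inv_mul]
  constructor
  · have h := (intervalIntegral.integrableOn_Ioo_rpow_iff (s := a - 2) zero_lt_one).mpr
      (by linarith)
    rw [← integrableOn_Ioc_iff_integrableOn_Ioo] at h
    refine h.congr_fun (fun y hy => ?_) measurableSet_Ioc
    simp only
    rw [if_pos hy.2, h2 y hy.1]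
  · have h := integrableOn_Ioi_rpow_of_lt (a := b - 2) (by linarith) zero_lt_one
    refine h.congr_fun (fun y hy => ?_) measurableSet_Ioi
    have hy : 1 < y := hy
    simp only
    rw [if_neg hy.not_ge, h2 y (by linarith)]

theorem norm_im_cpow (z : ℍ) (s : ℂ) : ‖(z.im : ℂ) ^ s‖ = z.im ^ s.re :=
  Complex.norm_cpow_eq_rpow_re_of_pos z.im_pos s

theorem measurable_thetaPart (τ : ℍ) (r : ZMod (2 * N)) (p : ℤ × ℤ) :
    Measurable (thetaPart N τ r p) := by
  have h1 : Measurable fun z : ℍ => z.im := UpperHalfPlane.continuous_im.measurable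
  have h2 : Measurable fun z : ℍ => z.re := UpperHalfPlane.continuous_re.measurable
  have h3 : Measurable fun z : ℍ =>
      (starRingEnd ℂ) (jacobiLine N r τ (-1 * p.1, -1 * p.2) z.re) :=
    (Complex.continuous_conj.comp (continuous_jacobiLine N r τ _)).measurable.comp h2
  have h4 : thetaPart N τ r p = _ := funext fun z => thetaPart_eq N τ z r p
  rw [h4]
  fun_prop

/-- The sum of the parts of the theta function is `O(y⁻³)` near `y = 0` and decreases faster than
every power near `y = ∞`. Against the measure `y⁻² dy` this gives convergence for `Re s > 4`. -/
theorem exists_bound_tsum_thetaPart (τ : ℍ) (r : ZMod (2 * N)) {s : ℂ} (hs : 4 < s.re) :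
    ∃ g : ℝ → ℝ, Measurable g ∧
      IntegrableOn (fun y => (y ^ 2)⁻¹ * g y) (Set.Ioi 0) ∧
      ∀ z : ℍ, z.im ^ s.re * ∑' p, ‖thetaPart N τ r p z‖ ≤ g z.im := by
  obtain ⟨M, hM⟩ := exists_nat_gt (s.re + 3)
  have hM3 : 3 ≤ M := by
    have : (3 : ℝ) < M := by linarith
    exact_mod_cast this.le
  -- the exponent `3` serves for `y ≤ 1`, the exponent `M` for `y > 1`
  obtain ⟨C, hC0, hC⟩ := exists_tsum_norm_thetaPart_le N τ r 3 le_rfl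
  obtain ⟨C', hC0', hC'⟩ := exists_tsum_norm_thetaPart_le N τ r M hM3
  have hM' : ((2 * M - 3 : ℕ) : ℝ) = 2 * M - 3 := by
    rw [Nat.cast_sub (by omega)]
    push_cast
    ring
  refine ⟨fun y => (C + C') * if y ≤ 1 then y ^ (s.re - 3) else y ^ (s.re - (2 * M - 3)),
    ?_, ?_, fun z => ?_⟩
  · exact (Measurable.ite measurableSet_Iic (by fun_prop) (by fun_prop)).const_mul _
  · exact IntegrableOn.congr_fun ((integrableOn_ite_rpow (a := s.re - 3)
      (b := s.re - (2 * M - 3)) (by linarith) (by linarith)).const_mul (C + C'))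
      (fun y _ => by ring) measurableSet_Ioi
  · have hy := z.im_pos
    simp only
    split_ifs with h
    · calc _ ≤ z.im ^ s.re * (C * (z.im ^ (2 * 3 - 3))⁻¹) := by gcongr; exact (hC z).2
        _ = C * z.im ^ (s.re - 3) := by
          rw [Real.rpow_sub hy, show (3 : ℝ) = ((3 : ℕ) : ℝ) by norm_num, Real.rpow_natCast]
          ring
        _ ≤ _ := by gcongr; linarith
    · calc _ ≤ z.im ^ s.re * (C' * (z.im ^ (2 * M - 3))⁻¹) := by gcongr; exact (hC' z).2
        _ = C' * z.im ^ (s.re - (2 * M - 3)) := by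
          rw [Real.rpow_sub hy, ← hM', Real.rpow_natCast]
          ring
        _ ≤ _ := by gcongr; linarith

theorem integrableOn_strip_tsum_norm (τ : ℍ) (r : ZMod (2 * N)) {s : ℂ} (hs : 4 < s.re) :
    IntegrableOn (fun z : ℍ => ∑' p, ‖(z.im : ℂ) ^ s * thetaPart N τ r p z‖) strip := by
  obtain ⟨g, hg, hi, hb⟩ := exists_bound_tsum_thetaPart N τ r hs
  refine (integrableOn_strip_of_im hg hi).mono' ?_ (Filter.Eventually.of_forall fun z => ?_)
  · have h1 : Measurable fun z : ℍ => z.im := UpperHalfPlane.continuous_im.measurable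
    exact (Measurable.tsum fun p => ((h1.complex_ofReal.pow_const s).mul
      (measurable_thetaPart N τ r p)).norm).aestronglyMeasurable
  · simp only [norm_mul, norm_im_cpow, tsum_mul_left]
    rw [Real.norm_of_nonneg (Real.rpow_nonneg z.im_pos.le _),
      Real.norm_of_nonneg (tsum_nonneg fun _ => norm_nonneg _)]
    exact hb z

theorem summable_norm_thetaPart (τ z : ℍ) (r : ZMod (2 * N)) :
    Summable fun p => ‖thetaPart N τ r p z‖ := by
  obtain ⟨C, -, hC⟩ := exists_tsum_norm_thetaPart_le N τ r 3 le_rfl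
  exact (hC z).1

theorem summable_norm_im_cpow_mul_thetaPart (τ z : ℍ) (r : ZMod (2 * N)) (s : ℂ) :
    Summable fun p => ‖(z.im : ℂ) ^ s * thetaPart N τ r p z‖ := by
  simp only [norm_mul]
  exact (summable_norm_thetaPart N τ z r).mul_left _

theorem measurable_im_cpow_mul_thetaPart (τ : ℍ) (r : ZMod (2 * N)) (s : ℂ) (p : ℤ × ℤ) :
    Measurable fun z : ℍ => (z.im : ℂ) ^ s * thetaPart N τ r p z :=
  (UpperHalfPlane.continuous_im.measurable.complex_ofReal.pow_const s).mul
    (measurable_thetaPart N τ r p)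

theorem integrableOn_strip_thetaPart (τ : ℍ) (r : ZMod (2 * N)) {s : ℂ} (hs : 4 < s.re)
    (p : ℤ × ℤ) : IntegrableOn (fun z : ℍ => (z.im : ℂ) ^ s * thetaPart N τ r p z) strip :=
  (integrableOn_strip_tsum_norm N τ r hs).mono'
    (measurable_im_cpow_mul_thetaPart N τ r s p).aestronglyMeasurable
    (Filter.Eventually.of_forall fun z =>
      (summable_norm_im_cpow_mul_thetaPart N τ z r s).le_tsum p fun _ _ => norm_nonneg _)

theorem integrableOn_strip_theta (τ : ℍ) (r : ZMod (2 * N)) {s : ℂ} (hs : 4 < s.re) :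
    IntegrableOn (fun z : ℍ => (z.im : ℂ) ^ s * theta N τ z r) strip := by
  refine (integrableOn_strip_tsum_norm N τ r hs).mono'
    ((UpperHalfPlane.continuous_im.measurable.complex_ofReal.pow_const s).mul
      (measurable_theta N τ r)).aestronglyMeasurable (Filter.Eventually.of_forall fun z => ?_)
  rw [← (hasSum_thetaPart N τ z r).tsum_eq, ← tsum_mul_left]
  exact norm_tsum_le_tsum_norm (summable_norm_im_cpow_mul_thetaPart N τ z r s)

theorem hasSum_integral_strip (τ : ℍ) (r : ZMod (2 * N)) {s : ℂ} (hs : 4 < s.re) :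
    HasSum (fun p => ∫ z in strip, (z.im : ℂ) ^ s * thetaPart N τ r p z)
      (∫ z in strip, (z.im : ℂ) ^ s * theta N τ z r) :=
  hasSum_integral_of_dominated_convergence
    (fun p z => ‖(z.im : ℂ) ^ s * thetaPart N τ r p z‖)
    (fun p => (measurable_im_cpow_mul_thetaPart N τ r s p).aestronglyMeasurable)
    (fun _ => Filter.Eventually.of_forall fun _ => le_rfl)
    (Filter.Eventually.of_forall fun z => summable_norm_im_cpow_mul_thetaPart N τ z r s)
    (integrableOn_strip_tsum_norm N τ r hs)
    (Filter.Eventually.of_forall fun z => (hasSum_thetaPart N τ z r).mul_left _)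

theorem integral_cpow_mul_exp_neg_mul_sq {s : ℂ} (hs : 0 < s.re) {l : ℝ} (hl : 0 < l) :
    ∫ y in Set.Ioi (0 : ℝ), (y : ℂ) ^ (s - 1) * Real.exp (-(l * y ^ 2)) =
      1 / 2 * ((l : ℂ) ^ (-(s / 2)) * Complex.Gamma (s / 2)) := by
  have h1 := mellin_comp_rpow (fun t : ℝ => (Real.exp (-(l * t)) : ℂ)) s 2
  have h2 : mellin (fun t : ℝ => (Real.exp (-(l * t)) : ℂ)) (s / (2 : ℝ)) =
      (l : ℂ) ^ (-(s / 2)) * Complex.Gamma (s / 2) := by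
    have h3 := Complex.integral_cpow_mul_exp_neg_mul_Ioi (a := s / 2) (r := l)
      (by simpa using hs) hl
    rw [mellin]
    push_cast
    simp only [smul_eq_mul]
    rw [h3, one_div, Complex.inv_cpow _ _ (by
      rw [Complex.arg_ofReal_of_nonneg hl.le]; exact Real.pi_pos.ne), Complex.cpow_neg]
  rw [h2, mellin, Complex.real_smul] at h1
  simp only [smul_eq_mul, Real.rpow_two] at h1
  rw [h1]
  norm_num

theorem integral_strip_thetaPart (τ : ℍ) (r : ZMod (2 * N)) {s : ℂ} (hs : 4 < s.re)
    {p : ℤ × ℤ} (hp : p ≠ 0) :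
    ∫ z in strip, (z.im : ℂ) ^ s * thetaPart N τ r p z =
      -((τ.im / N * √(τ.im / N) : ℝ) : ℂ)⁻¹ * (p.1 * (starRingEnd ℂ) (τ : ℂ) + p.2) ^ 2 *
      (1 / 2 * (((Real.pi * N * qf 1 τ p : ℝ) : ℂ) ^ (-((s + 2) / 2)) *
        Complex.Gamma ((s + 2) / 2))) *
      ∫ x in (0 : ℝ)..1, (starRingEnd ℂ) (jacobiLine N r τ (-1 * p.1, -1 * p.2) x) := by
  set A : ℂ := -((τ.im / N * √(τ.im / N) : ℝ) : ℂ)⁻¹ *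
    (p.1 * (starRingEnd ℂ) (τ : ℂ) + p.2) ^ 2 with hA
  have hl : 0 < Real.pi * N * qf 1 τ p := by
    have := natCast_pos N
    have := qf_pos 1 τ hp
    positivity
  have h1 : ∀ z : ℍ, (z.im : ℂ) ^ s * thetaPart N τ r p z = (z.im : ℂ) ^ s *
      (A * ((z.im : ℂ) ^ 3 * Real.exp (-(Real.pi * N * qf 1 τ p * z.im ^ 2))) *
      (starRingEnd ℂ) (jacobiLine N r τ (-1 * p.1, -1 * p.2) z.re)) := fun z => by
    rw [thetaPart_eq]
  have hi := integrableOn_strip_thetaPart N τ r hs p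
  simp only [h1] at hi ⊢
  refine (integral_strip (f := fun q : ℝ × ℝ => (q.2 : ℂ) ^ s *
      (A * ((q.2 : ℂ) ^ 3 * Real.exp (-(Real.pi * N * qf 1 τ p * q.2 ^ 2))) *
      (starRingEnd ℂ) (jacobiLine N r τ (-1 * p.1, -1 * p.2) q.1))) hi).trans ?_
  rw [intervalIntegral.integral_of_le zero_le_one]
  generalize hJ : ∫ x in Set.Ioc (0 : ℝ) 1,
    (starRingEnd ℂ) (jacobiLine N r τ (-1 * p.1, -1 * p.2) x) = J
  rw [← integral_cpow_mul_exp_neg_mul_sq (s := s + 2) (by simp; linarith) hl, ← integral_const_mul,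
    ← integral_mul_const]
  refine setIntegral_congr_fun measurableSet_Ioi fun y hy => ?_
  have hy : 0 < y := hy
  have hy0 : (y : ℂ) ≠ 0 := by exact_mod_cast hy.ne'
  simp only
  rw [← hJ, ← integral_const_mul]
  congr 1
  funext x
  have h2 : (y : ℂ) ^ (s + 2 - 1) = (y : ℂ) ^ s * y := by
    rw [show s + 2 - 1 = s + 1 by ring, Complex.cpow_add _ _ hy0, Complex.cpow_one]
  rw [Complex.real_smul, h2]
  push_cast
  field_simp

/-- The factor `(c τ̄ + n)²` removes the pair `(0, 0)`, whose integral would diverge. -/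
theorem thetaPart_zero (τ z : ℍ) (r : ZMod (2 * N)) : thetaPart N τ r 0 z = 0 := by
  rw [thetaPart_eq]
  simp

theorem cpow_neg_three_halves {x : ℝ} (hx : 0 < x) :
    (x : ℂ) ^ (-(3 / 2) : ℂ) = ((x * √x : ℝ) : ℂ)⁻¹ := by
  rw [show (-(3 / 2) : ℂ) = ((-(3 / 2) : ℝ) : ℂ) by push_cast; ring, ← Complex.ofReal_cpow hx.le,
    ← Complex.ofReal_inv, Real.rpow_neg hx.le, Real.sqrt_eq_rpow,
    ← Real.rpow_one_add' hx.le (by norm_num)]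
  norm_num

theorem norm_root_pow_six (τ : ℍ) (q : MpCosets) :
    (starRingEnd ℂ) ((Quotient.out q).root τ) ^ 3 * (Quotient.out q).root τ ^ 3 =
      ((τ.im * √τ.im : ℝ) : ℂ) * ((qf 1 τ (mpRow q) * √(qf 1 τ (mpRow q)) : ℝ) : ℂ) := by
  have hv := τ.im_pos
  have hq := qf_nonneg 1 τ (mpRow q)
  have h1 : ‖(Quotient.out q).root τ‖ ^ 2 = √τ.im * √(qf 1 τ (mpRow q)) := by
    rw [← Real.sqrt_mul hv.le, ← norm_root_pow_four, ← Real.sqrt_sq (sq_nonneg _)]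
    ring_nf
  rw [← mul_pow, mul_comm, Complex.mul_conj, Complex.normSq_eq_norm_sq, h1, ← Complex.ofReal_pow,
    ← Complex.ofReal_mul]
  congr 1
  have e1 := Real.sq_sqrt hv.le
  have e2 := Real.sq_sqrt hq
  rw [mul_pow]
  calc _ = (√τ.im ^ 2 * √τ.im) * (√(qf 1 τ (mpRow q)) ^ 2 * √(qf 1 τ (mpRow q))) := by ring
    _ = _ := by rw [e1, e2]

theorem qf_scaledMpRow (τ : ℍ) (m : ℕ) (q : MpCosets) :
    qf 1 τ (scaledMpRow (m, q)) = ((m : ℝ) + 1) * ((m + 1) * qf 1 τ (mpRow q)) := by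
  have h : ((1 : ℕ) : ℂ) * ((-((m : ℤ) + 1) * (mpRow q).1 : ℤ) : ℂ) * τ +
      ((-((m : ℤ) + 1) * (mpRow q).2 : ℤ) : ℂ) =
      -((m + 1 : ℕ) : ℂ) * (((1 : ℕ) : ℂ) * (mpRow q).1 * τ + (mpRow q).2) := by
    push_cast; ring
  simp only [qf, scaledMpRow]
  rw [h, norm_mul, norm_neg, Complex.norm_natCast]
  push_cast
  ring

/-- The powers of a multiplier in `integral_strip_thetaPart_scaledMpRow` combine to a term of
`ζ(s)`. -/
theorem natCast_add_one_mul_cpow (m : ℕ) (s : ℂ) :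
    ((m + 1 : ℝ) : ℂ) ^ (-((s + 2) / 2)) * (((m + 1 : ℝ) : ℂ) ^ (-((s + 2) / 2)) *
      ((m + 1 : ℝ) : ℂ) ^ 2) = 1 / ((m : ℂ) + 1) ^ s := by
  have h0 : ((m + 1 : ℝ) : ℂ) ≠ 0 := by exact_mod_cast (by positivity : ((m : ℝ) + 1) ≠ 0)
  rw [← mul_assoc, ← Complex.cpow_add _ _ h0, ← Complex.cpow_natCast, ← Complex.cpow_add _ _ h0,
    one_div, ← Complex.cpow_neg]
  push_cast
  congr 1
  ring

theorem integral_strip_thetaPart_scaledMpRow (τ : ℍ) (r : ZMod (2 * N)) {s : ℂ} (hs : 4 < s.re)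
    (m : ℕ) (q : MpCosets) :
    ∫ z in strip, (z.im : ℂ) ^ s * thetaPart N τ r (scaledMpRow (m, q)) z =
      -(1 / 2) * (Complex.Gamma ((s + 2) / 2) * (Real.pi : ℂ) ^ (-((s + 2) / 2)) *
        (N : ℂ) ^ ((1 - s) / 2)) * (1 / ((m : ℂ) + 1) ^ s * vectorTerm N τ s q r) := by
  have hN := natCast_pos N
  have hN0 := natCast_ne_zero N
  have hv := τ.im_pos
  have hq := qf_pos 1 τ (mpRow_ne_zero q)
  have hq0 : ((qf 1 τ (mpRow q) : ℝ) : ℂ) ≠ 0 := by exact_mod_cast hq.ne'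
  have hp : scaledMpRow (m, q) ≠ 0 := fun h => by
    have := qf_scaledMpRow τ m q
    rw [h] at this
    have h' : qf 1 τ 0 = 0 := by simp [qf]
    rw [h'] at this
    have : 0 < ((m : ℝ) + 1) * ((m + 1) * qf 1 τ (mpRow q)) := by positivity
    linarith
  have hm : (m : ℤ) + 1 ≠ 0 := by positivity
  have hrow : (-1 * (scaledMpRow (m, q)).1, -1 * (scaledMpRow (m, q)).2) =
      (((m : ℤ) + 1) * (mpRow q).1, ((m : ℤ) + 1) * (mpRow q).2) := by
    simp only [scaledMpRow]
    ext <;> ring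
  have hW : ∫ x in (0 : ℝ)..1, (starRingEnd ℂ) (jacobiLine N r τ (mpRow q) x) =
      ((starRingEnd ℂ) ((Quotient.out q).root τ))⁻¹ * weilCoeff N r q :=
    integral_jacobiVec_denom N (Quotient.out q) r τ
  have hj : ((scaledMpRow (m, q)).1 : ℂ) * (starRingEnd ℂ) (τ : ℂ) + (scaledMpRow (m, q)).2 =
      -((m + 1 : ℝ) : ℂ) * (starRingEnd ℂ) ((Quotient.out q).root τ) ^ 2 := by
    rw [← map_pow, Mp2Z.sq]
    simp [scaledMpRow, mpRow]
    ring
  rw [integral_strip_thetaPart N τ r hs hp, hrow, integral_jacobiLine_smul N r τ _ hm, hW, hj,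
    qf_scaledMpRow, vectorTerm_apply, ← natCast_add_one_mul_cpow]
  have hroot := Mp2Z.root_ne_zero (Quotient.out q) τ
  have hroot' : (starRingEnd ℂ) ((Quotient.out q).root τ) ≠ 0 := by simpa using hroot
  have h6 := norm_root_pow_six τ q
  have e1 : ((Real.pi * N * (((m : ℝ) + 1) * ((m + 1) * qf 1 τ (mpRow q))) : ℝ) : ℂ) ^
      (-((s + 2) / 2)) = (Real.pi : ℂ) ^ (-((s + 2) / 2)) * (N : ℂ) ^ (-((s + 2) / 2)) *
        (((m + 1 : ℝ) : ℂ) ^ (-((s + 2) / 2)) * (((m + 1 : ℝ) : ℂ) ^ (-((s + 2) / 2)) *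
          ((qf 1 τ (mpRow q) : ℝ) : ℂ) ^ (-((s + 2) / 2)))) := by
    rw [Complex.ofReal_mul, Complex.mul_cpow_ofReal_nonneg (by positivity) (by positivity),
      Complex.ofReal_mul, Complex.mul_cpow_ofReal_nonneg (by positivity) (by positivity),
      Complex.ofReal_mul, Complex.mul_cpow_ofReal_nonneg (by positivity) (by positivity),
      Complex.ofReal_mul, Complex.mul_cpow_ofReal_nonneg (by positivity) (by positivity),
      Complex.ofReal_natCast]
  have e2 : (N : ℂ) ^ (-((s + 2) / 2)) = (N : ℂ) ^ ((1 - s) / 2) * ((N * √N : ℝ) : ℂ)⁻¹ := by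
    rw [← cpow_neg_three_halves hN, Complex.ofReal_natCast, ← Complex.cpow_add _ _ hN0]
    congr 1
    ring
  have e3 : ((qf 1 τ (mpRow q) : ℝ) : ℂ) ^ (-((s + 2) / 2)) =
      ((qf 1 τ (mpRow q) : ℝ) : ℂ) ^ (-((s - 1) / 2)) *
        ((qf 1 τ (mpRow q) * √(qf 1 τ (mpRow q)) : ℝ) : ℂ)⁻¹ := by
    rw [← cpow_neg_three_halves hq, ← Complex.cpow_add _ _ hq0]
    congr 1
    ring
  have e4 : ((τ.im / N * √(τ.im / N) : ℝ) : ℂ)⁻¹ =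
      ((N * √N : ℝ) : ℂ) * ((τ.im * √τ.im : ℝ) : ℂ)⁻¹ := by
    rw [← Complex.ofReal_inv, ← Complex.ofReal_inv, ← Complex.ofReal_mul, Real.sqrt_div hv.le]
    congr 1
    field_simp
  rw [e1, e2, e3, e4]
  have n1 : ((N * √N : ℝ) : ℂ) ≠ 0 := by
    have := Real.sqrt_pos.mpr hN
    exact_mod_cast (by positivity : (N * √N : ℝ) ≠ 0)
  have n2 : ((τ.im * √τ.im : ℝ) : ℂ) ≠ 0 := by
    have := Real.sqrt_pos.mpr hv
    exact_mod_cast (by positivity : (τ.im * √τ.im : ℝ) ≠ 0)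
  have n3 : ((qf 1 τ (mpRow q) * √(qf 1 τ (mpRow q)) : ℝ) : ℂ) ≠ 0 := by
    have := Real.sqrt_pos.mpr hq
    exact_mod_cast (by positivity : (qf 1 τ (mpRow q) * √(qf 1 τ (mpRow q)) : ℝ) ≠ 0)
  -- what is left is algebra with `|φ(τ)|⁶`, where `φ(τ)² = c τ + d`
  generalize ((N * √N : ℝ) : ℂ) = a at *
  generalize ((τ.im * √τ.im : ℝ) : ℂ) = b at *
  generalize ((qf 1 τ (mpRow q) * √(qf 1 τ (mpRow q)) : ℝ) : ℂ) = c at *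
  generalize (starRingEnd ℂ) ((Quotient.out q).root τ) = ρ' at *
  generalize (Quotient.out q).root τ = ρ at *
  have h7 : ρ' ^ 3 = b * c * (ρ ^ 3)⁻¹ := by
    rw [← h6, mul_inv_cancel_right₀ (pow_ne_zero 3 hroot)]
  generalize ((m + 1 : ℝ) : ℂ) ^ (-((s + 2) / 2)) = u
  generalize ((m + 1 : ℝ) : ℂ) = M
  have h8 : (-M * ρ' ^ 2) ^ 2 = M ^ 2 * (b * c * (ρ ^ 3)⁻¹) * ρ' := by rw [← h7]; ring
  rw [h8]
  field_simp

/-- The unfolded theta integral is the Eisenstein series of weight `3/2`, up to elementary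
factors; the factor `ζ(s)` comes from the sum over the multiples of the coprime pairs. -/
theorem integral_strip_theta (τ : ℍ) (r : ZMod (2 * N)) {s : ℂ} (hs : 4 < s.re) :
    ∫ z in strip, (z.im : ℂ) ^ s * theta N τ z r =
      -(1 / 2) * (Complex.Gamma ((s + 2) / 2) * (Real.pi : ℂ) ^ (-((s + 2) / 2)) *
        (N : ℂ) ^ ((1 - s) / 2)) * (riemannZeta s * vectorSeries N τ s r) := by
  have h1 : Summable fun m : ℕ => 1 / ((m : ℂ) + 1) ^ s := by
    have := (summable_nat_add_iff 1).mpr (Complex.summable_one_div_nat_cpow.mpr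
      (by linarith : 1 < s.re))
    simpa using this
  have h2 := summable_vectorTerm_apply N τ (by linarith : 3 / 2 < s.re) r
  rw [← (hasSum_integral_strip N τ r hs).tsum_eq, ← scaledMpRow_injective.tsum_eq,
    zeta_eq_tsum_one_div_nat_add_one_cpow (by linarith), vectorSeries_apply N τ (by linarith),
    tsum_mul_tsum_of_summable_norm h1.norm h2.norm, ← tsum_mul_left]
  · exact tsum_congr fun p => integral_strip_thetaPart_scaledMpRow N τ r hs p.1 p.2
  · intro p hp
    refine mem_range_scaledMpRow fun h => hp ?_
    simp [h, thetaPart_zero]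

theorem mul_integral_strip_theta (τ : ℍ) (r : ZMod (2 * N)) {s : ℂ} (hs : 4 < s.re) :
    (N : ℂ) ^ (2 * s) * (Real.pi : ℂ) ^ (-s) * Complex.Gamma s * zetaN N (2 * s) *
      ∫ z in strip, (z.im : ℂ) ^ s * theta N τ z r =
    zetaStar s * normalizedVectorSeries N τ r s := by
  have hs0 : s / 2 ≠ 0 := fun h => by
    have := congrArg Complex.re h
    simp at this
    linarith
  have hpi : (Real.pi : ℂ) ≠ 0 := by exact_mod_cast Real.pi_pos.ne'
  rw [integral_strip_theta N τ r hs, zetaStar_eq (by linarith), normalizedVectorSeries,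
    show (s + 2) / 2 = s / 2 + 1 by ring, Complex.Gamma_add_one _ hs0,
    show -(s / 2 + 1) = -s / 2 + -1 by ring, Complex.cpow_add _ _ hpi,
    show -s - 1 = -s + -1 by ring, Complex.cpow_add _ _ hpi,
    show (1 / 2 + 3 / 2 * s : ℂ) = 2 * s + (1 - s) / 2 by ring,
    Complex.cpow_add _ _ (natCast_ne_zero N)]
  ring

/-! ### The Fricke involution -/

theorem coe_fricke_smul (z : ℍ) : ((fricke N • z : ℍ) : ℂ) = -1 / (N * z) := by
  rw [UpperHalfPlane.coe_smul_of_det_pos (fricke_det_pos N)]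
  simp [UpperHalfPlane.num, UpperHalfPlane.denom, fricke_val]

theorem fricke_smul_fricke_smul (z : ℍ) : fricke N • fricke N • z = z := by
  have := natCast_ne_zero N
  have := z.ne_zero
  refine UpperHalfPlane.ext ?_
  rw [coe_fricke_smul, coe_fricke_smul]
  field_simp

theorem exists_fricke_conj {γ : SL(2, ℤ)} (hγ : γ ∈ CongruenceSubgroup.Gamma0 N) :
    ∃ γ' ∈ CongruenceSubgroup.Gamma0 N, ∀ z : ℍ, fricke N • γ • fricke N • z = γ' • z := by
  rw [CongruenceSubgroup.Gamma0_mem] at hγ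
  obtain ⟨c, hc⟩ := (ZMod.intCast_zmod_eq_zero_iff_dvd _ N).mp hγ
  have hdet := γ.det_coe
  rw [Matrix.det_fin_two, hc] at hdet
  let γ' : SL(2, ℤ) := ⟨!![γ 1 1, -c; -(N * γ 0 1), γ 0 0], by
    rw [Matrix.det_fin_two]
    simp
    linarith⟩
  refine ⟨γ', ?_, fun z => ?_⟩
  · rw [CongruenceSubgroup.Gamma0_mem]
    simp [γ']
  have h : fricke N * (γ : GL (Fin 2) ℝ) = (γ' : GL (Fin 2) ℝ) * fricke N := by
    refine Units.ext ?_
    rw [Units.val_mul, Units.val_mul, SL_val, SL_val, fricke_val]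
    ext i j
    fin_cases i <;> fin_cases j <;> simp [γ', Matrix.mul_apply, Fin.sum_univ_two, hc, mul_comm]
  have h2 : fricke N • γ • fricke N • z =
      (fricke N * (γ : GL (Fin 2) ℝ)) • fricke N • z := (mul_smul _ _ _).symm
  rw [h2, h, mul_smul, fricke_smul_fricke_smul]
  rfl

/-- Conjugation by the Fricke involution, which normalizes `Γ₀(N)`. -/
def frickeConj : gammaBar N ≃ gammaBar N :=
  let W : Equiv.Perm ℍ := MulAction.toPerm (fricke N)
  have hW : W * W = 1 := Equiv.ext fun z => fricke_smul_fricke_smul N z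
  let f : gammaBar N → gammaBar N := fun g => ⟨W * g * W, by
    obtain ⟨_, γ, hγ, rfl⟩ := g
    obtain ⟨γ', hγ', h⟩ := exists_fricke_conj N hγ
    exact ⟨γ', hγ', Equiv.ext fun z => (h z).symm⟩⟩
  have hf : Function.Involutive f := fun g => Subtype.ext (by
    change W * (W * g * W) * W = g
    rw [mul_assoc W g W, ← mul_assoc W W, hW, one_mul, mul_assoc, hW, mul_one])
  hf.toPerm

theorem fricke_smul_frickeConj_smul (g : gammaBar N) (z : ℍ) :
    fricke N • frickeConj N g • z = g • fricke N • z :=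
  fricke_smul_fricke_smul N _

theorem measurableEmbedding_fricke_smul : MeasurableEmbedding fun z : ℍ => fricke N • z :=
  measurableEmbedding_const_smul _

theorem measurePreserving_fricke_smul :
    MeasurePreserving (fun z : ℍ => fricke N • z) volume volume :=
  measurePreserving_smul (fricke N) volume

theorem isFundamentalDomain_fricke :
    IsFundamentalDomain (gammaBar N) ((fun z : ℍ => fricke N • z) '' fundamentalDomain N)
      volume :=
  (isFundamentalDomain_fundamentalDomain N).image_of_equiv (MulAction.toPerm (fricke N))
    (measurePreserving_smul (fricke N)⁻¹ volume).quasiMeasurePreserving (frickeConj N)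
    (fun g z => fricke_smul_frickeConj_smul N g z)

theorem integrableOn_fricke_iff {f : ℍ → ℂ}
    (hf : ∀ γ ∈ CongruenceSubgroup.Gamma0 N, ∀ z : ℍ, f (γ • z) = f z) :
    IntegrableOn (fun z => f (fricke N • z)) (fundamentalDomain N) ↔
      IntegrableOn f (fundamentalDomain N) := by
  have h := (measurePreserving_fricke_smul N).integrableOn_image
    (measurableEmbedding_fricke_smul N) (f := f) (s := fundamentalDomain N)
  rw [← (isFundamentalDomain_fricke N).integrableOn_iff
    (isFundamentalDomain_fundamentalDomain N) (f := f)
    (fun g z => by obtain ⟨γ, rfl⟩ := toGammaBar_surjective N g; exact hf γ.1 γ.2 z), h]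
  rfl

theorem setIntegral_fricke {f : ℍ → ℂ}
    (hf : ∀ γ ∈ CongruenceSubgroup.Gamma0 N, ∀ z : ℍ, f (γ • z) = f z) :
    ∫ z in fundamentalDomain N, f (fricke N • z) = ∫ z in fundamentalDomain N, f z := by
  rw [← (measurePreserving_fricke_smul N).setIntegral_image_emb
    (measurableEmbedding_fricke_smul N)]
  exact (isFundamentalDomain_fricke N).setIntegral_eq (isFundamentalDomain_fundamentalDomain N)
    (fun g z => by obtain ⟨γ, rfl⟩ := toGammaBar_surjective N g; exact hf γ.1 γ.2 z)

/-! ### The theta lift as a meromorphic function -/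

theorem half_le_im_of_mem_fd {z : ℍ} (hz : z ∈ ModularGroup.fd) : 1 / 2 ≤ z.im := by
  have := ModularGroup.three_le_four_mul_im_sq_of_mem_fd hz
  nlinarith [z.im_pos]

/-- The rapid decay of the theta kernel outweighs the moderate growth of the Eisenstein series. -/
theorem exists_norm_eisEntire_mul_theta_le (τ : ℍ) (r : ZMod (2 * N)) (R : ℕ) (σ : SL(2, ℤ)) :
    ∃ C : ℝ, ∀ z ∈ ModularGroup.fd, ∀ s : ℂ, ‖s‖ ≤ R →
      ‖eisEntire N (σ • z) s * theta N τ (σ • z) r‖ ≤ C := by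
  obtain ⟨C, hC0, hC⟩ := exists_norm_eisEntire_le N R
  obtain ⟨C', hC0', hC'⟩ := exists_norm_theta_le N τ σ (R + 2) r
  refine ⟨C * C', fun z hz s hs => ?_⟩
  have hy := z.im_pos
  rw [norm_mul]
  calc _ ≤ C * z.im ^ (R + 2) * (C' * (z.im ^ (R + 2))⁻¹) :=
        mul_le_mul (hC σ z hz s hs) (hC' z (half_le_im_of_mem_fd hz)) (norm_nonneg _)
          (by positivity)
    _ = _ := by field_simp

theorem measurable_eisEntire_mul_theta (τ : ℍ) (r : ZMod (2 * N)) (s : ℂ) :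
    Measurable fun z => eisEntire N z s * theta N τ z r :=
  (measurable_eisEntire N s).mul (measurable_theta N τ r)

theorem integrableOn_eisEntire_mul_theta (τ : ℍ) (r : ZMod (2 * N)) (s : ℂ) :
    IntegrableOn (fun z => eisEntire N z s * theta N τ z r) (fundamentalDomain N) := by
  obtain ⟨R, hR⟩ := exists_nat_ge ‖s‖
  refine integrableOn_fundamentalDomain N (measurable_eisEntire_mul_theta N τ r s) fun σ => ?_
  obtain ⟨C, hC⟩ := exists_norm_eisEntire_mul_theta_le N τ r R σ
  exact ⟨C, fun z hz => hC z hz s hR⟩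

theorem integrableOn_theta (τ : ℍ) (r : ZMod (2 * N)) :
    IntegrableOn (fun z => theta N τ z r) (fundamentalDomain N) := by
  refine integrableOn_fundamentalDomain N (measurable_theta N τ r) fun σ => ?_
  obtain ⟨C, -, hC⟩ := exists_norm_theta_le N τ σ 0 r
  exact ⟨C, fun z hz => (hC z (half_le_im_of_mem_fd hz)).trans (by simp)⟩

/-- The contribution of the entire part of the Eisenstein series to the theta lift. -/
def liftEntire (τ : ℍ) (r : ZMod (2 * N)) (s : ℂ) : ℂ :=
  ∫ z in fundamentalDomain N, eisEntire N z s * theta N τ z r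

theorem differentiable_liftEntire (τ : ℍ) (r : ZMod (2 * N)) :
    Differentiable ℂ (liftEntire N τ r) := by
  have hm := (isFundamentalDomain_fundamentalDomain N).nullMeasurableSet
  have := Fintype.ofFinite (SL(2, ℤ) ⧸ CongruenceSubgroup.Gamma0 N)
  refine differentiable_integral_of_bounded (G := fun z s => eisEntire N z s * theta N τ z r)
    (fun s => (measurable_eisEntire_mul_theta N τ r s).aestronglyMeasurable)
    (Filter.Eventually.of_forall fun z => (differentiable_eisEntire N z).mul_const _)
    fun R => ?_
  obtain ⟨R', hR'⟩ := exists_nat_ge R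
  choose C hC using exists_norm_eisEntire_mul_theta_le N τ r R'
  refine ⟨fun _ => ∑ q : SL(2, ℤ) ⧸ CongruenceSubgroup.Gamma0 N, |C (Quotient.out q)⁻¹|, ?_, ?_⟩
  · have h1 : IntegrableOn (fun _ : ℍ => (1 : ℂ)) (fundamentalDomain N) :=
      integrableOn_fundamentalDomain N measurable_const fun σ => ⟨1, fun z _ => by simp⟩
    have h2 := h1.norm.const_mul
      (∑ q : SL(2, ℤ) ⧸ CongruenceSubgroup.Gamma0 N, |C (Quotient.out q)⁻¹|)
    simpa using h2
  · refine (ae_restrict_iff'₀ hm).mpr (Filter.Eventually.of_forall fun z hz s hs => ?_)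
    obtain ⟨q, w, hw, rfl⟩ := Set.mem_iUnion.mp hz
    refine (hC _ w hw s (hs.trans hR')).trans ((le_abs_self _).trans ?_)
    exact Finset.single_le_sum (f := fun q : SL(2, ℤ) ⧸ CongruenceSubgroup.Gamma0 N =>
      |C (Quotient.out q)⁻¹|) (fun _ _ => abs_nonneg _) (Finset.mem_univ q)

/-- The theta lift of the Eisenstein series of weight `0`, as a meromorphic function. -/
def liftMero (τ : ℍ) (r : ZMod (2 * N)) (s : ℂ) : ℂ :=
  liftEntire N τ r s - eisPolar N s * ∫ z in fundamentalDomain N, theta N τ z r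

theorem calE_mul_theta_eq (τ : ℍ) (r : ZMod (2 * N)) {s : ℂ} (h0 : s ≠ 0) (h1 : s ≠ 1) :
    (fun z => calE N z s * theta N τ z r) =
      fun z => eisEntire N z s * theta N τ z r - eisPolar N s * theta N τ z r := by
  funext z
  rw [calE_eq N z h0 h1, sub_mul]

theorem thetaLiftConverges_calE (τ : ℍ) (r : ZMod (2 * N)) {s : ℂ} (h0 : s ≠ 0) (h1 : s ≠ 1) :
    ThetaLiftConverges N τ (fun z => calE N z s) r := by
  rw [ThetaLiftConverges, calE_mul_theta_eq N τ r h0 h1]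
  exact (integrableOn_eisEntire_mul_theta N τ r s).sub ((integrableOn_theta N τ r).const_mul _)

theorem thetaLift_calE (τ : ℍ) (r : ZMod (2 * N)) {s : ℂ} (h0 : s ≠ 0) (h1 : s ≠ 1) :
    thetaLift N τ (fun z => calE N z s) r = liftMero N τ r s := by
  rw [thetaLift, calE_mul_theta_eq N τ r h0 h1, integral_sub
    (integrableOn_eisEntire_mul_theta N τ r s) ((integrableOn_theta N τ r).const_mul _),
    integral_const_mul]
  rfl

theorem calE_mul_theta_smul (τ : ℍ) (r : ZMod (2 * N)) (s : ℂ) {γ : SL(2, ℤ)}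
    (hγ : γ ∈ CongruenceSubgroup.Gamma0 N) (z : ℍ) :
    calE N (γ • z) s * theta N τ (γ • z) r = calE N z s * theta N τ z r := by
  rw [calE_smul N hγ, theta_gamma0 N hγ]

theorem thetaLiftConverges_calE_fricke (τ : ℍ) (r : ZMod (2 * N)) {s : ℂ} (h0 : s ≠ 0)
    (h1 : s ≠ 1) : ThetaLiftConverges N τ (fun z => calE N (fricke N • z) s) r := by
  have h := (integrableOn_fricke_iff N (f := fun z => calE N z s * theta N τ z r)
    fun γ hγ z => calE_mul_theta_smul N τ r s hγ z).mpr (thetaLiftConverges_calE N τ r h0 h1)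
  simp only [theta_fricke] at h
  exact h

theorem thetaLift_calE_fricke (τ : ℍ) (r : ZMod (2 * N)) (s : ℂ) :
    thetaLift N τ (fun z => calE N (fricke N • z) s) r =
      thetaLift N τ (fun z => calE N z s) r := by
  have h := setIntegral_fricke N (f := fun z => calE N z s * theta N τ z r)
    fun γ hγ z => calE_mul_theta_smul N τ r s hγ z
  simp only [theta_fricke] at h
  exact h

/-- The Rankin--Selberg identity in the region where the unfolded integral converges. -/
theorem liftMero_eq (τ : ℍ) (r : ZMod (2 * N)) {s : ℂ} (hs : 4 < s.re) :
    liftMero N τ r s = zetaStar s * normalizedVectorSeries N τ r s := by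
  have h0 : s ≠ 0 := fun h => by rw [h, Complex.zero_re] at hs; linarith
  have h1 : s ≠ 1 := fun h => by rw [h, Complex.one_re] at hs; linarith
  have h2 : ∀ z, calE N z s * theta N τ z r = (N : ℂ) ^ (2 * s) * (Real.pi : ℂ) ^ (-s) *
      Complex.Gamma s * zetaN N (2 * s) * (eisensteinSeries N z s * theta N τ z r) := fun z => by
    rw [(isMeromorphicContinuation_calE N z).2 (by change 1 < s.re; linarith), normalizedSeries,
      mul_assoc]
  rw [← thetaLift_calE N τ r h0 h1, thetaLift, ← mul_integral_strip_theta N τ r hs,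
    ← setIntegral_eisensteinSeries_mul N (fun γ hγ z => theta_gamma0 N hγ τ z r)
      (integrableOn_strip_theta N τ r hs), ← integral_const_mul]
  simp only [h2]

theorem analyticAt_liftMero (τ : ℍ) (r : ZMod (2 * N)) {s : ℂ} (h0 : s ≠ 0) (h1 : s ≠ 1) :
    AnalyticAt ℂ (liftMero N τ r) s :=
  ((differentiable_liftEntire N τ r).analyticAt s).sub
    ((analyticAt_eisPolar N h0 h1).mul analyticAt_const)

theorem meromorphicAt_liftMero (τ : ℍ) (r : ZMod (2 * N)) (s : ℂ) :
    MeromorphicAt (liftMero N τ r) s :=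
  ((differentiable_liftEntire N τ r).analyticAt s).meromorphicAt.sub
    ((meromorphicAt_eisPolar N s).mul (MeromorphicAt.const _ _))

/-! ### The completed zeta function -/

theorem analyticAt_zetaStar {s : ℂ} (h0 : s ≠ 0) (h1 : s ≠ 1) : AnalyticAt ℂ zetaStar s := by
  have hU : IsOpen ({0, 1}ᶜ : Set ℂ) := (Set.toFinite _).isClosed.isOpen_compl
  have hd : DifferentiableOn ℂ zetaStar ({0, 1}ᶜ : Set ℂ) := fun w hw => by
    simp only [Set.mem_compl_iff, Set.mem_insert_iff, Set.mem_singleton_iff, not_or] at hw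
    exact (differentiableAt_completedZeta hw.1 hw.2).differentiableWithinAt
  exact hd.analyticAt (hU.mem_nhds (by simp [h0, h1]))

theorem meromorphicOn_zetaStar : MeromorphicOn zetaStar Set.univ := by
  have h : zetaStar = fun s => completedRiemannZeta₀ s - 1 / s - 1 / (1 - s) :=
    funext completedRiemannZeta_eq
  rw [h]
  exact fun s _ => ((differentiable_completedZeta₀.analyticAt s).meromorphicAt.sub
    ((MeromorphicAt.const _ _).div (MeromorphicAt.id s))).sub
    ((MeromorphicAt.const _ _).div ((MeromorphicAt.const _ _).sub (MeromorphicAt.id s)))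

theorem zetaStar_ne_zero {s : ℂ} (hs : 1 < s.re) : zetaStar s ≠ 0 := by
  rw [zetaStar_eq (by linarith)]
  refine mul_ne_zero (mul_ne_zero ?_ ?_) (riemannZeta_ne_zero_of_one_le_re hs.le)
  · rw [Complex.cpow_def_of_ne_zero (by exact_mod_cast Real.pi_pos.ne')]
    exact Complex.exp_ne_zero _
  · exact Complex.Gamma_ne_zero_of_re_pos (by simp; linarith)

/-- `ζ*` is nonzero at `2`, so its order is finite everywhere. -/
theorem eventually_zetaStar_ne_zero (s : ℂ) : ∀ᶠ w in nhdsWithin s {s}ᶜ, zetaStar w ≠ 0 := by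
  have h2 : AnalyticAt ℂ zetaStar 2 := analyticAt_zetaStar (by norm_num) (by norm_num)
  have h3 : meromorphicOrderAt zetaStar 2 ≠ ⊤ := by
    rw [(h2.meromorphicNFAt.meromorphicOrderAt_eq_zero_iff).mpr (zetaStar_ne_zero (by norm_num))]
    exact WithTop.zero_ne_top
  have h4 := (meromorphicOn_zetaStar.exists_meromorphicOrderAt_ne_top_iff_forall
    ⟨Set.univ_nonempty, isPreconnected_univ⟩).mp ⟨⟨2, trivial⟩, h3⟩ ⟨s, trivial⟩
  exact (meromorphicOrderAt_ne_top_iff_eventually_ne_zero (meromorphicOn_zetaStar s trivial)).mp h4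

/-! ### Continuation of the Eisenstein series of weight `3/2` -/

theorem meromorphicOn_lift_div (τ : ℍ) (r : ZMod (2 * N)) :
    MeromorphicOn (fun s => liftMero N τ r s / zetaStar s) Set.univ := fun s _ =>
  (meromorphicAt_liftMero N τ r s).div (meromorphicOn_zetaStar s trivial)

theorem analyticAt_lift_div (τ : ℍ) (r : ZMod (2 * N)) {s : ℂ} (hs : 1 < s.re) :
    AnalyticAt ℂ (fun s => liftMero N τ r s / zetaStar s) s := by
  have h0 : s ≠ 0 := fun h => by rw [h, Complex.zero_re] at hs; linarith
  have h1 : s ≠ 1 := fun h => by rw [h, Complex.one_re] at hs; linarith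
  exact (analyticAt_liftMero N τ r h0 h1).div (analyticAt_zetaStar h0 h1) (zetaStar_ne_zero hs)

theorem analyticOnNhd_lift_div (τ : ℍ) (r : ZMod (2 * N)) :
    AnalyticOnNhd ℂ (fun s => liftMero N τ r s / zetaStar s) {s | 3 / 2 < s.re} := fun s hs =>
  analyticAt_lift_div N τ r (by have : 3 / 2 < s.re := hs; linarith)

/-- The identity theorem extends the Rankin--Selberg identity to the half plane of absolute
convergence of the series. -/
theorem lift_div_eqOn (τ : ℍ) (r : ZMod (2 * N)) :
    Set.EqOn (fun s => liftMero N τ r s / zetaStar s) (normalizedVectorSeries N τ r)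
      {s | 3 / 2 < s.re} := by
  refine (analyticOnNhd_lift_div N τ r).eqOn_of_preconnected_of_eventuallyEq
    ((differentiableOn_normalizedVectorSeries N τ r).analyticOnNhd (isOpen_setOf_lt_re _))
    (convex_halfSpace_re_gt _).isPreconnected (z₀ := 5) (by norm_num) ?_
  filter_upwards [(isOpen_setOf_lt_re 4).mem_nhds (by norm_num : (4 : ℝ) < (5 : ℂ).re)] with s hs
  have hs : 4 < s.re := hs
  rw [liftMero_eq N τ r hs, mul_div_cancel_left₀ _ (zetaStar_ne_zero (by linarith))]

theorem isMeromorphicContinuation_calEL (τ : ℍ) (r : ZMod (2 * N)) :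
    IsMeromorphicContinuation (normalizedVectorSeries N τ r) {s | 3 / 2 < s.re} (calEL N τ r) :=
  isMeromorphicContinuation_meromorphicContinuation (meromorphicOn_lift_div N τ r)
    (analyticOnNhd_lift_div N τ r) (lift_div_eqOn N τ r)

theorem calEL_eq (τ : ℍ) (r : ZMod (2 * N)) : calEL N τ r =
    toMeromorphicNFOn (fun s => liftMero N τ r s / zetaStar s) Set.univ :=
  meromorphicContinuation_eq (isOpen_setOf_lt_re _) (nonempty_setOf_lt_re _)
    (meromorphicOn_lift_div N τ r) (analyticOnNhd_lift_div N τ r) (lift_div_eqOn N τ r)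

theorem analyticAt_calEL (τ : ℍ) (r : ZMod (2 * N)) {s : ℂ} (hs : 1 < s.re) :
    AnalyticAt ℂ (calEL N τ r) s := by
  rw [calEL_eq]
  exact (analyticAt_lift_div N τ r hs).congr
    (toMeromorphicNFOn_eventuallyEq (meromorphicOn_lift_div N τ r)
      (analyticAt_lift_div N τ r hs)).symm

/-- Both sides are continuous at `s` and agree in a punctured neighbourhood. This includes the zeros
of `ζ*`, where the quotient that defines `calEL` may have a removable singularity. -/
theorem thetaLift_calE_eq (τ : ℍ) (r : ZMod (2 * N)) {s : ℂ} (h0 : s ≠ 0) (h1 : s ≠ 1)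
    (ha : AnalyticAt ℂ (calEL N τ r) s) :
    thetaLift N τ (fun z => calE N z s) r = zetaStar s * calEL N τ r s := by
  rw [thetaLift_calE N τ r h0 h1]
  have hc1 : ContinuousAt (liftMero N τ r) s := (analyticAt_liftMero N τ r h0 h1).continuousAt
  have hc2 : ContinuousAt (fun s => zetaStar s * calEL N τ r s) s :=
    (analyticAt_zetaStar h0 h1).continuousAt.mul ha.continuousAt
  refine ((hc1.eventuallyEq_nhds_iff_eventuallyEq_nhdsNE hc2).mp ?_).eq_of_nhds
  have h2 := (meromorphicOn_lift_div N τ r).toMeromorphicNFOn_eq_self_on_nhdsNE (Set.mem_univ s)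
  rw [← calEL_eq] at h2
  filter_upwards [h2, eventually_zetaStar_ne_zero s] with w hw hw0
  rw [hw, mul_div_cancel₀ _ hw0]

end

end KudlaMillson

end

open KudlaMillson
theorem theorem1p3 (N : ℕ) [NeZero N] :
    -- `ρ_L` is the Weil representation
    IsWeilRepresentation N (weilRepresentation N) ∧
    -- convergence and meromorphic continuation of the Eisenstein series of weight `0`
    (∀ (z : UpperHalfPlane) (s : ℂ), 1 < s.re → Summable (eisensteinTerm N z s)) ∧
    (∀ z : UpperHalfPlane,
      IsMeromorphicContinuation (normalizedSeries N z) {s | 1 < s.re} (calE N z)) ∧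
    (∀ (z : UpperHalfPlane) (s : ℂ), s ≠ 0 → s ≠ 1 → AnalyticAt ℂ (calE N z) s) ∧
    -- convergence and meromorphic continuation of the Eisenstein series of weight `3/2`
    (∀ (τ : UpperHalfPlane) (s : ℂ), 3 / 2 < s.re → Summable (vectorTerm N τ s)) ∧
    (∀ (τ : UpperHalfPlane) (μ : ZMod (2 * N)),
      IsMeromorphicContinuation (normalizedVectorSeries N τ μ) {s | 3 / 2 < s.re}
        (calEL N τ μ)) ∧
    (∀ (τ : UpperHalfPlane) (μ : ZMod (2 * N)) (s : ℂ), 1 < s.re →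
      AnalyticAt ℂ (calEL N τ μ) s) ∧
    -- convergence of the theta function
    (∀ (τ z : UpperHalfPlane) (μ : ZMod (2 * N)),
      Summable (fun w : coset N μ => phi N (w : Matrix (Fin 2) (Fin 2) ℝ) τ z)) ∧
    -- the theta lifts
    ∀ (τ : UpperHalfPlane) (s : ℂ), s ≠ 0 → s ≠ 1 → ∀ μ : ZMod (2 * N),
      ThetaLiftConverges N τ (fun z => calE N z s) μ ∧
      ThetaLiftConverges N τ (fun z => calE N (fricke N • z) s) μ ∧
      thetaLift N τ (fun z => calE N z s) μ =
        thetaLift N τ (fun z => calE N (fricke N • z) s) μ ∧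
      (AnalyticAt ℂ (calEL N τ μ) s →
        thetaLift N τ (fun z => calE N z s) μ = zetaStar s * calEL N τ μ s) := by
  refine ⟨isWeilRepresentation_weilRepresentation N, fun z _ hs => summable_eisensteinTerm N z hs,
    isMeromorphicContinuation_calE N, fun z _ h0 h1 => analyticAt_calE N z h0 h1,
    fun τ _ hs => summable_vectorTerm N τ hs, isMeromorphicContinuation_calEL N,
    fun τ μ _ hs => analyticAt_calEL N τ μ hs, fun τ z μ => summable_phi N τ z μ,
    fun τ s h0 h1 μ => ?_⟩
  exact ⟨thetaLiftConverges_calE N τ μ h0 h1, thetaLiftConverges_calE_fricke N τ μ h0 h1,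
    (thetaLift_calE_fricke N τ μ s).symm, thetaLift_calE_eq N τ μ h0 h1⟩
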